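/- All graphs are finite and simple. For a graph $G$, $\rho(G)$ is the largest eigenvalue of its adjacency matrix. $\mathbb{G}_{n,\alpha}$ is the set of connected graphs with $n$ vertices and independence number $\alpha$, and a minimizer graph is a graph in $\mathbb{G}_{n,\alpha}$ whose spectral radius is minimum over $\mathbb{G}_{n,\alpha}$. For a tree $T$, the leaf set $L(T)$ is the set of all vertices of degree one, except that for a path $P_{2t}$ on an even number of vertices it consists of one (arbitrarily chosen) end vertex. Control vertices. Let $D_m$ ($m\ge 4$) be the path $p_0p_1\cdots p_{m-2}$ together with one further vertex joined to $p_1$. A vertex $v$ of a tree $T$ that is neither a path nor a $D_m$ is a control vertex if $d(v)\ge 3$ and at least $d(v)-1$ components of $T-v$ are paths. The control vertices of a path $v_1v_2\cdots v_m$ (labelled so that $v_1\in L$) are $v_2$ and $v_{2\lfloor m/2\rfloor}$; those of $D_m$ are $p_1$ and $p_{m-3}$. A control path is a path whose two ends are control vertices. Main trees. Let $d\ge 0$ be even and $h\ge 0$. Take a path $P=v_0v_1\cdots v_d$ and put $M_0=\{v_{2i-1}v_{2i} : 1\le i\le \frac d2-1\}$. For $1\le s\le h$ take a nonempty set of disjoint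 edges $M_s=\{x_{s1}y_{s1},\dots,x_{st_s}y_{st_s}\}$ on new vertices, and let $\sigma^*$ be a map with $\sigma^*:M_s\to M_{s-1}$ for $1\le s\le h$. The tree $T(d;M_1,\dots,M_h;\sigma^*)$ is obtained from $P$ and these edges by joining, for every $s\ge1$ and $j$, the vertex $x_{sj}$ to $y_{s-1,j'}$ if $\sigma^*(x_{sj}y_{sj})=x_{s-1,j'}y_{s-1,j'}$ ($s\ge 2$), and to $v_{2i}$ if $s=1$ and $\sigma^*(x_{1j}y_{1j})=v_{2i-1}v_{2i}$. Let $V_1^*$ consist of the $v_i$ with $i$ odd and all $x_{sj}$, and $V_2^*$ of the $v_i$ with $i$ even and all $y_{sj}$. For $\lceil n/2\rceil\le\alpha\le n-1$, let $\mathcal{T}^*_-(n,\alpha)$ be the set of all trees $T(d;M_1,\dots,M_h;\sigma^*)$ of diameter $d$ such that $$\begin{cases} d=2(n-\alpha)-2 \text{ if } \alpha\in\{n-2,n-1\};\quad 4\le d\le 2(n-\alpha)-2 \text{ if } \lceil n/2\rceil\le\alpha\le n-3,\\ h\le\min\{\,n-\alpha-1-\frac d2,\ \lfloor \frac d4\rfloor\,\},\\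 \sum_{s=1}^h|M_s|=n-\alpha-1-\frac d2. \end{cases}$$ For $l:V_2^*\to\{0,1,2,\dots\}$, the graph $T^*_-\circ l_{V_2^*}$ is obtained from $T^*_-$ by attaching $l(u)$ new pendant vertices to every $u\in V_2^*$. Theorem. Let $n\ge2$, $\alpha\ge\lceil n/2\rceil$, and let $T^*$ be a minimizer graph in $\mathbb{G}_{n,\alpha}$. Then (for either choice of $L(T^*)$ if $T^*$ is an even path) there exist $T^*_-=T(d;M_1,\dots,M_h;\sigma^*)\in\mathcal{T}^*_-(n,\alpha)$ and $l:V_2^*\to\{0,1,2,\dots\}$ such that $T^*= T^*_-\circ l_{V_2^*}$ (up to isomorphism), where the attached pendant vertices are exactly the vertices in $L(T^*)$, so that $T^*_-=T^*\setminus L(T^*)$, and $$\sum_{u\in V_2^*}l(u)=|L(T^*)|=2\alpha-n+1 .$$ Moreover $T^*_-$ is a tree, bipartite with parts $V_1^*$ and $V_2^*$, $|V_2^*|=n-\alpha$, $|V_1^*|=n-\alpha-1$, every vertex of $V_1^*$ has degree $2$ in $T^*_-$, and the path $P=v_0v_1\cdots v_d$ is a control path of $T^*$. -/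

import Mathlib

namespace MinimizerGraph

noncomputable section

/-- The spectral radius of a finite graph: the largest eigenvalue of its adjacency matrix. -/
def rho {V : Type*} [Fintype V] (G : SimpleGraph V) : ℝ := by
  classical exact sSup (spectrum ℝ (G.adjMatrix ℝ))

theorem rho_isGreatest {V : Type*} [Fintype V] [DecidableEq V] [Nonempty V]
    (G : SimpleGraph V) [DecidableRel G.Adj] :
    IsGreatest (spectrum ℝ (G.adjMatrix ℝ)) (rho G) := by
  have hA : (G.adjMatrix ℝ).IsHermitian := G.isHermitian_adjMatrix ℝ
  have hs := hA.spectrum_real_eq_range_eigenvalues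
  have h1 : (spectrum ℝ (G.adjMatrix ℝ)).Nonempty := by
    rw [hs]; exact Set.range_nonempty _
  have h2 : (spectrum ℝ (G.adjMatrix ℝ)).Finite := by
    rw [hs]; exact Set.finite_range _
  have h3 : rho G = sSup (spectrum ℝ (G.adjMatrix ℝ)) := by
    unfold rho
    congr!
  rw [h3]
  exact ⟨h1.csSup_mem h2, fun x hx => le_csSup h2.bddAbove hx⟩

/-- Membership in `𝔾_{n,α}`: connected graphs of order `n` and independence number `α`. -/
structure InClass {V : Type*} [Fintype V] (n α : ℕ) (G : SimpleGraph V) : Prop where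
  connected : G.Connected
  order : Fintype.card V = n
  indep : G.indepNum = α

/-- `G` attains the minimum spectral radius over `𝔾_{n,α}`. Every graph of order `n` has a copy
on `Fin n`, so it suffices to compare with those. -/
structure IsMinimizer {V : Type*} [Fintype V] (n α : ℕ) (G : SimpleGraph V) : Prop where
  mem : InClass n α G
  le : ∀ H : SimpleGraph (Fin n), InClass n α H → rho G ≤ rho H

/-- The degree of a vertex (all graphs below are finite). -/
def deg {V : Type*} (G : SimpleGraph V) (v : V) : ℕ := (G.neighborSet v).ncard

/-- `L` is the leaf set `L(T)`: for an even path `P_{2t}` it consists of one of the two end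
vertices, otherwise it is the set of all vertices of degree one. -/
def IsLeafSet {V : Type*} (T : SimpleGraph V) (L : Set V) : Prop :=
  ((∃ t : ℕ, 1 ≤ t ∧ Nonempty (SimpleGraph.pathGraph (2 * t) ≃g T)) ∧
      ∃ u, deg T u = 1 ∧ L = {u}) ∨
  ((¬ ∃ t : ℕ, 1 ≤ t ∧ Nonempty (SimpleGraph.pathGraph (2 * t) ≃g T)) ∧
      L = {v | deg T v = 1})

theorem exists_isLeafSet {V : Type*} (T : SimpleGraph V) : ∃ L, IsLeafSet T L := by
  by_cases h : ∃ t : ℕ, 1 ≤ t ∧ Nonempty (SimpleGraph.pathGraph (2 * t) ≃g T)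
  · obtain ⟨t, ht, ⟨φ⟩⟩ := id h
    refine ⟨{φ ⟨0, by omega⟩}, Or.inl ⟨h, φ ⟨0, by omega⟩, ?_, rfl⟩⟩
    have hs : T.neighborSet (φ ⟨0, by omega⟩) = {φ ⟨1, by omega⟩} := by
      ext w
      obtain ⟨i, rfl⟩ := φ.surjective w
      rw [SimpleGraph.mem_neighborSet, φ.map_adj_iff, SimpleGraph.pathGraph_adj,
        Set.mem_singleton_iff, φ.injective.eq_iff, Fin.ext_iff]
      simp only
      omega
    rw [deg, hs, Set.ncard_singleton]
  · exact ⟨_, Or.inr ⟨h, rfl⟩⟩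

/-- The graph `D_n` (for `n ≥ 4`): the path `0, 1, …, n - 2` with one further vertex `n - 1`
joined to `1`. -/
def dGraph (n : ℕ) : SimpleGraph (Fin n) :=
  SimpleGraph.fromRel fun i j =>
    (i.val + 1 = j.val ∧ j.val + 1 < n) ∨ (i.val = 1 ∧ j.val + 1 = n)

/-- The number of components of `T - v` that are paths. -/
def numPathComponents {V : Type*} (T : SimpleGraph V) (v : V) : ℕ :=
  {c : (T.induce {v}ᶜ).ConnectedComponent |
    ∃ m : ℕ, Nonempty (SimpleGraph.pathGraph m ≃g c.toSimpleGraph)}.ncard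

/-- `v` is a control vertex of the tree `T` with leaf set `L`.

* In a path `v_1 v_2 ⋯ v_m` (labelled with `v_1 ∈ L`; this matters for even `m` only) the control
  vertices are `v_2` and `v_{2⌊m/2⌋}`.
* In `D_m` they are the vertex of degree three and the neighbour of the far end of the long leg.
* In any other tree they are the vertices `v` of degree at least three such that `T - v` contains
  at least `d(v) - 1` paths. -/
def IsControlVertex {V : Type*} (T : SimpleGraph V) (L : Set V) (v : V) : Prop :=
  (∃ (m : ℕ) (φ : SimpleGraph.pathGraph m ≃g T) (i₀ i : Fin m),
      i₀.val = 0 ∧ φ i₀ ∈ L ∧ φ i = v ∧ (i.val = 1 ∨ i.val + 1 = 2 * (m / 2))) ∨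
  (∃ (m : ℕ) (φ : dGraph m ≃g T) (i : Fin m),
      4 ≤ m ∧ φ i = v ∧ (i.val = 1 ∨ i.val + 3 = m)) ∨
  ((¬ ∃ m : ℕ, Nonempty (SimpleGraph.pathGraph m ≃g T)) ∧
    (¬ ∃ m : ℕ, 4 ≤ m ∧ Nonempty (dGraph m ≃g T)) ∧
    3 ≤ deg T v ∧ deg T v ≤ numPathComponents T v + 1)

/-- `G ∘ l`: to every vertex `u ∈ A`, attach `l u` new pendant vertices. -/
def attachPendants {V : Type*} (G : SimpleGraph V) (A : Set V) (l : A → ℕ) :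
    SimpleGraph (V ⊕ (Σ u : A, Fin (l u))) :=
  SimpleGraph.fromRel fun a b =>
    match a, b with
    | .inl a, .inl b => G.Adj a b
    | .inl a, .inr p => a = p.1
    | _, _ => False

/-- The data of a tree `T(d; M_1, …, M_h; σ*)`: a path `v_0 v_1 ⋯ v_d` of even length, layers
`M_s = {x_{s1} y_{s1}, x_{s2} y_{s2}, …}` of independent edges for `1 ≤ s ≤ h`, and maps
`σ* : M_s → M_{s-1}`. Here `M_0` stands for the path edges `v_1 v_2, v_3 v_4, …, v_{d-3} v_{d-2}`,
so that `σ*` sends an edge of `M_1` to an edge `v_{2i-1} v_{2i}` with `v_{2i} ≠ v_0, v_d`. -/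
structure MainTreeData where
  /-- the length of the path -/
  d : ℕ
  /-- the number of layers -/
  h : ℕ
  /-- `size s = |M_s|`; the values for `s > h` are not used -/
  size : ℕ → ℕ
  even_d : Even d
  size_zero : size 0 = d / 2 - 1
  size_pos : ∀ s, 1 ≤ s → s ≤ h → 0 < size s
  /-- the map `σ* : M_{s+1} → M_s` -/
  σ : ∀ s, s < h → Fin (size (s + 1)) → Fin (size s)

namespace MainTreeData

/-- The vertices `v_i`, then the vertices `x_{s+1,j}`, then the vertices `y_{s+1,j}`. -/
abbrev Vertex (D : MainTreeData) : Type :=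
  Fin (D.d + 1) ⊕ ((Σ s : Fin D.h, Fin (D.size (s.val + 1))) ⊕
    (Σ s : Fin D.h, Fin (D.size (s.val + 1))))

/-- The edges: the path edges, the edges joining an `x` of the first layer to an inner even vertex
of the path, the layer edges `x_{sj} y_{sj}`, and the edges joining an `x` of a later layer to a
`y` of the preceding layer. The second and fourth kind are given by `σ*`: if `σ*` sends `x y` to
`x' y'`, then `x` is joined to `y'`. -/
def rel (D : MainTreeData) : D.Vertex → D.Vertex → Prop
  | .inl i, .inl j => i.val + 1 = j.val
  | .inr (.inl ⟨s, j⟩), .inl i => s.val = 0 ∧ i.val = 2 * ((D.σ s.val s.isLt j).val + 1)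
  | .inr (.inl ⟨s, j⟩), .inr (.inr ⟨r, i⟩) =>
      (s.val = r.val ∧ j.val = i.val) ∨
      (s.val = r.val + 1 ∧ (D.σ s.val s.isLt j).val = i.val)
  | _, _ => False

/-- The tree `T(d; M_1, …, M_h; σ*)`. -/
def graph (D : MainTreeData) : SimpleGraph D.Vertex := SimpleGraph.fromRel D.rel

/-- `V_1`: the odd vertices of the path and all the `x_{sj}`. -/
def V₁ (D : MainTreeData) : Set D.Vertex :=
  {a | match a with
    | .inl i => Odd i.val
    | .inr (.inl _) => True
    | .inr (.inr _) => False}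

/-- `V_2`: the even vertices of the path and all the `y_{sj}`. -/
def V₂ (D : MainTreeData) : Set D.Vertex :=
  {a | match a with
    | .inl i => Even i.val
    | .inr (.inl _) => False
    | .inr (.inr _) => True}

/-- The end `v_0` of the path. -/
def pathStart (D : MainTreeData) : D.Vertex := .inl 0

/-- The end `v_d` of the path. -/
def pathEnd (D : MainTreeData) : D.Vertex := .inl (Fin.last D.d)

end MainTreeData

/-- The set `𝒯*₋(n, α)`, for `⌈n/2⌉ ≤ α ≤ n - 1`: the trees `T(d; M_1, …, M_h; σ*)` of diameter
`d` whose parameters satisfy the four constraints. (The first two of the constraints below give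
`d / 2 ≤ n - α - 1`, so no natural subtraction is truncated.) -/
def mainTrees (n α : ℕ) : Set MainTreeData :=
  {D | D.graph.diam = D.d ∧
    ((α = n - 1 ∨ α = n - 2) → D.d = 2 * (n - α) - 2) ∧
    ((⌈(n : ℝ) / 2⌉₊ ≤ α ∧ α + 3 ≤ n) → 4 ≤ D.d ∧ D.d ≤ 2 * (n - α) - 2) ∧
    D.h ≤ min (n - α - 1 - D.d / 2) (D.d / 4) ∧
    ∑ s ∈ Finset.Icc 1 D.h, D.size s = n - α - 1 - D.d / 2}

end

end MinimizerGraph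

/-! Put k = n - α. The complement of a maximum independent set is a vertex cover of size k, so the
class lies inside the larger family of connected graphs of order n having a vertex cover of size k.
That condition survives passing to spanning trees and local surgery. Estimates of `rho` come from
test vectors: a positive f with A f ≤ r f gives `rho` ≤ r, and a nonnegative nonzero f with A f ≥ r
f gives the reverse.

Two moves drive the case n ≥ 2k + 3. Deleting a leaf outside the cover strictly lowers `rho`. A tree
with these parameters has four leaves, hence `rho` ≥ 2, and then some vertex can be split into two
at distance two without raising `rho`; the order grows by two and the cover by one (`Adm.expand`).
In a graph that is minimal for the cover problem, an edge inside the cover could be subdivided, and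
a vertex of degree at least three outside it could be split into two sharing a neighbour. Either
would raise the order at no cost, and deleting a leaf would then beat the minimum. So the cover is
independent and free of leaves, and the other vertices have degree at most two (`IsGood`). Double
counting shows that such a graph has independence number exactly n - k, so a minimizer of the class
is minimal for the cover problem as well and has this structure (`IsMinimizer.exists_isGood`).

For n = 2k + 2 the graph D_n has `rho` < 2, which leaves room for only three leaves and forces T to
be D_n. For n ≤ 2k + 1 the path wins: a comparison of rooted branches by means of Chebyshev
polynomials shows that a connected graph with a vertex of degree three has larger `rho` than the
path of the same order.

In every case T - L is a tree in which the cover C is one colour class and all vertices of the other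
class have degree two. Fix a diametral pair a, b. The vertices of C off the path from a to b lie at
even depth 2s, and paired with their parents they are the edges of M_s; the parent of the parent
gives σ* (`IsFrame.iso`). An end of the path has at most one neighbour outside L, which makes it a
control vertex. -/

namespace MinimizerGraph

set_option linter.unusedSectionVars false

section
open scoped Classical

variable {V W : Type*} [Fintype V] [Fintype W]

/-! ### Spectral radius, Perron vector and test vectors. -/

/-- The sum of `f` over the neighbours of `u`. -/
noncomputable def nsum (G : SimpleGraph V) (f : V → ℝ) (u : V) : ℝ :=
  ∑ w, if G.Adj u w then f w else 0

theorem mulVec_adjMatrix (G : SimpleGraph V) (f : V → ℝ) :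
    (G.adjMatrix ℝ).mulVec f = nsum G f := by
  ext u
  simp [Matrix.mulVec, dotProduct, nsum, SimpleGraph.adjMatrix_apply]

theorem nsum_symm (G : SimpleGraph V) (f g : V → ℝ) :
    ∑ u, f u * nsum G g u = ∑ u, nsum G f u * g u := by
  simp only [nsum, Finset.mul_sum, Finset.sum_mul]
  rw [Finset.sum_comm]
  refine Finset.sum_congr rfl fun u _ => Finset.sum_congr rfl fun w _ => ?_
  simp only [G.adj_comm u w]
  split_ifs <;> ring

theorem nsum_nonneg {G : SimpleGraph V} {f : V → ℝ} (hf : ∀ v, 0 ≤ f v) (u : V) :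
    0 ≤ nsum G f u :=
  Finset.sum_nonneg fun w _ => by split_ifs <;> simp [hf]

theorem nsum_mono {G H : SimpleGraph V} (h : G ≤ H) {f g : V → ℝ} (hf : ∀ v, 0 ≤ g v)
    (hfg : ∀ v, f v ≤ g v) (u : V) : nsum G f u ≤ nsum H g u := by
  refine Finset.sum_le_sum fun w _ => ?_
  by_cases hG : G.Adj u w
  · simp [hG, h hG, hfg]
  · simp only [hG, if_false]
    split_ifs <;> simp [hf]

theorem nsum_eq_sum_filter (G : SimpleGraph V) (f : V → ℝ) (u : V) :
    nsum G f u = ∑ w ∈ Finset.univ.filter (G.Adj u), f w := by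
  rw [nsum, Finset.sum_filter]

theorem sum_le_nsum {G : SimpleGraph V} {f : V → ℝ} (hf : ∀ v, 0 ≤ f v) {u : V}
    {s : Finset V} (hs : ∀ w ∈ s, G.Adj u w) : ∑ w ∈ s, f w ≤ nsum G f u := by
  rw [nsum_eq_sum_filter]
  exact Finset.sum_le_sum_of_subset_of_nonneg (fun w hw => by simpa using hs w hw)
    fun w _ _ => hf w

theorem le_nsum {G : SimpleGraph V} {f : V → ℝ} (hf : ∀ v, 0 ≤ f v) {u w : V}
    (h : G.Adj u w) : f w ≤ nsum G f u := by
  simpa using sum_le_nsum hf (s := {w}) (by simpa using h)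

/-- The matrix `rho G • 1 - A` is positive semidefinite. Replacing an eigenvector for `rho G` by its
absolute values cannot increase the quadratic form, which is already zero, and a zero of a
semidefinite form lies in the kernel. -/
theorem exists_abs_eigenvector [Nonempty V] (G : SimpleGraph V) :
    ∃ y : V → ℝ, (∀ v, 0 ≤ y v) ∧ y ≠ 0 ∧ ∀ v, nsum G y v = rho G * y v := by
  set A := G.adjMatrix ℝ with hAdef
  have hA : A.IsHermitian := G.isHermitian_adjMatrix ℝ
  have hg := rho_isGreatest G
  have hB : (rho G • (1 : Matrix V V ℝ) - A).IsHermitian :=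
    (Matrix.isHermitian_one.smul (by simp [IsSelfAdjoint])).sub hA
  have hpsd : (rho G • (1 : Matrix V V ℝ) - A).PosSemidef := by
    rw [hB.posSemidef_iff_eigenvalues_nonneg]
    intro i
    have h1 : hB.eigenvalues i ∈ spectrum ℝ (rho G • (1 : Matrix V V ℝ) - A) := by
      rw [hB.spectrum_real_eq_range_eigenvalues]; exact ⟨i, rfl⟩
    have h2 : rho G - hB.eigenvalues i ∈ spectrum ℝ A := by
      generalize hB.eigenvalues i = μ at h1
      rw [← Algebra.algebraMap_eq_smul_one, ← spectrum.singleton_sub_eq, Set.mem_sub] at h1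
      obtain ⟨a, ha, b, hb, hab⟩ := h1
      rw [Set.mem_singleton_iff] at ha
      subst ha
      rw [← hab]
      simpa using hb
    have := hg.2 h2
    simp only [Pi.zero_apply]
    linarith
  obtain ⟨x, hx0, hx⟩ : ∃ x : V → ℝ, x ≠ 0 ∧ A.mulVec x = rho G • x := by
    have h1 := hg.1
    rw [← Matrix.spectrum_toLin', ← Module.End.hasEigenvalue_iff_mem_spectrum] at h1
    obtain ⟨x, hx⟩ := h1.exists_hasEigenvector
    exact ⟨x, hx.2, by simpa using hx.apply_eq_smul⟩
  refine ⟨fun v => |x v|, fun v => abs_nonneg _, ?_, ?_⟩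
  · intro h
    apply hx0
    ext v
    simpa using congrFun h v
  set z : V → ℝ := fun v => |x v| with hz
  have key : ∀ f : V → ℝ, dotProduct (star f) ((rho G • (1 : Matrix V V ℝ) - A).mulVec f)
      = ∑ u, (rho G * f u * f u - f u * nsum G f u) := by
    intro f
    simp only [Matrix.sub_mulVec, Matrix.smul_mulVec, Matrix.one_mulVec, mulVec_adjMatrix,
      dotProduct, hAdef]
    refine Finset.sum_congr rfl fun u _ => ?_
    simp
    ring
  have hzero : dotProduct (star z) ((rho G • (1 : Matrix V V ℝ) - A).mulVec z) = 0 := by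
    apply le_antisymm _ (hpsd.dotProduct_mulVec_nonneg z)
    have h0 : dotProduct (star x) ((rho G • (1 : Matrix V V ℝ) - A).mulVec x) = 0 := by
      rw [Matrix.sub_mulVec, hx, Matrix.smul_mulVec, Matrix.one_mulVec]
      simp
    rw [← h0, key, key]
    refine Finset.sum_le_sum fun u _ => ?_
    have h1 : rho G * z u * z u = rho G * x u * x u := by
      rw [mul_assoc, mul_assoc, hz]; simp
    have h2 : x u * nsum G x u ≤ z u * nsum G z u := by
      simp only [nsum, Finset.mul_sum]
      refine Finset.sum_le_sum fun w _ => ?_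
      split_ifs
      · rw [hz]; simp only; rw [← abs_mul]; exact le_abs_self _
      · simp
    linarith
  rw [hpsd.dotProduct_mulVec_zero_iff] at hzero
  intro v
  have := congrFun hzero v
  simp only [Matrix.sub_mulVec, Matrix.smul_mulVec, Matrix.one_mulVec, mulVec_adjMatrix,
      hAdef, Pi.sub_apply, Pi.smul_apply, Pi.zero_apply, smul_eq_mul] at this
  linarith

/-- The eigenvalue equation at a zero of a nonnegative eigenvector forces zeros at all neighbours,
and connectedness would spread them everywhere. -/
theorem exists_perron {G : SimpleGraph V} (hG : G.Connected) :
    ∃ y : V → ℝ, (∀ v, 0 < y v) ∧ ∀ v, nsum G y v = rho G * y v := by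
  have := hG.nonempty
  obtain ⟨y, h0, hne, hy⟩ := exists_abs_eigenvector G
  refine ⟨y, ?_, hy⟩
  by_contra! hcon
  obtain ⟨v, hv⟩ := hcon
  apply hne
  have hadj : ∀ a b, G.Adj a b → y a = 0 → y b = 0 := by
    intro a b hab ha
    apply le_antisymm _ (h0 b)
    have := le_nsum h0 hab
    rwa [hy, ha, mul_zero] at this
  ext w
  obtain ⟨p⟩ := hG.preconnected v w
  induction p with
  | nil => exact le_antisymm hv (h0 _)
  | cons h p ih => exact ih (hadj _ _ h (le_antisymm hv (h0 _))).le

/-- Pair A f ≤ r f with the Perron vector y and use the symmetry of A: `rho G` ⟨y, f⟩ = ⟨y, A f⟩ ≤ r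
⟨y, f⟩, with ⟨y, f⟩ positive. -/
theorem rho_le_of_super {G : SimpleGraph V} (hG : G.Connected) {f : V → ℝ} {r : ℝ}
    (hf : ∀ v, 0 < f v) (h : ∀ v, nsum G f v ≤ r * f v) : rho G ≤ r := by
  have := hG.nonempty
  obtain ⟨y, h0, hy⟩ := exists_perron hG
  have h1 := nsum_symm G y f
  have h2 : ∑ u, nsum G y u * f u = rho G * ∑ u, y u * f u := by
    rw [Finset.mul_sum]; exact Finset.sum_congr rfl fun u _ => by rw [hy]; ring
  have h3 : ∑ u, y u * nsum G f u ≤ r * ∑ u, y u * f u := by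
    rw [Finset.mul_sum]
    exact Finset.sum_le_sum fun u _ => by nlinarith [h u, h0 u]
  have h4 : 0 < ∑ u, y u * f u :=
    Finset.sum_pos (fun u _ => mul_pos (h0 u) (hf u)) Finset.univ_nonempty
  rw [h1, h2] at h3
  exact le_of_mul_le_mul_right h3 h4

theorem rho_lt_of_super {G : SimpleGraph V} (hG : G.Connected) {f : V → ℝ} {r : ℝ}
    (hf : ∀ v, 0 < f v) (h : ∀ v, nsum G f v ≤ r * f v) (w : V) (hw : nsum G f w < r * f w) :
    rho G < r := by
  have := hG.nonempty
  obtain ⟨y, h0, hy⟩ := exists_perron hG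
  have h1 := nsum_symm G y f
  have h2 : ∑ u, nsum G y u * f u = rho G * ∑ u, y u * f u := by
    rw [Finset.mul_sum]; exact Finset.sum_congr rfl fun u _ => by rw [hy]; ring
  have h3 : ∑ u, y u * nsum G f u < r * ∑ u, y u * f u := by
    rw [Finset.mul_sum]
    exact Finset.sum_lt_sum (fun u _ => by nlinarith [h u, h0 u])
      ⟨w, Finset.mem_univ _, by nlinarith [h0 w]⟩
  have h4 : 0 < ∑ u, y u * f u :=
    Finset.sum_pos (fun u _ => mul_pos (h0 u) (hf u)) Finset.univ_nonempty
  rw [h1, h2] at h3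
  exact lt_of_mul_lt_mul_right h3 h4.le

theorem le_rho_of_sub {G : SimpleGraph V} (hG : G.Connected) {f : V → ℝ} {r : ℝ}
    (hf : ∀ v, 0 ≤ f v) (w : V) (hw : 0 < f w) (h : ∀ v, r * f v ≤ nsum G f v) :
    r ≤ rho G := by
  have := hG.nonempty
  obtain ⟨y, h0, hy⟩ := exists_perron hG
  have h1 := nsum_symm G y f
  have h2 : ∑ u, nsum G y u * f u = rho G * ∑ u, y u * f u := by
    rw [Finset.mul_sum]; exact Finset.sum_congr rfl fun u _ => by rw [hy]; ring
  have h3 : r * ∑ u, y u * f u ≤ ∑ u, y u * nsum G f u := by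
    rw [Finset.mul_sum]
    exact Finset.sum_le_sum fun u _ => by nlinarith [h u, h0 u]
  have h4 : 0 < ∑ u, y u * f u :=
    Finset.sum_pos' (fun u _ => mul_nonneg (h0 u).le (hf u))
      ⟨w, Finset.mem_univ _, mul_pos (h0 w) hw⟩
  rw [h1, h2] at h3
  exact le_of_mul_le_mul_right h3 h4

theorem nsum_comp_iso {G : SimpleGraph V} {H : SimpleGraph W} (φ : G ≃g H) (f : W → ℝ) (u : V) :
    nsum G (fun v => f (φ v)) u = nsum H f (φ u) := by
  unfold nsum
  rw [← Equiv.sum_comp φ.toEquiv]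
  refine Finset.sum_congr rfl fun w _ => ?_
  have : H.Adj (φ u) (φ.toEquiv w) ↔ G.Adj u w := φ.map_adj_iff
  simp only [this]
  rfl

theorem rho_le_of_iso {G : SimpleGraph V} {H : SimpleGraph W} (hH : H.Connected) (φ : G ≃g H) :
    rho G ≤ rho H := by
  obtain ⟨y, h0, hy⟩ := exists_perron hH
  refine rho_le_of_super (φ.connected_iff.2 hH) (f := fun v => y (φ v)) (fun v => h0 _)
    fun v => ?_
  rw [nsum_comp_iso, hy]

theorem rho_mono {G H : SimpleGraph V} (hG : G.Connected) (h : G ≤ H) : rho G ≤ rho H := by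
  obtain ⟨y, h0, hy⟩ := exists_perron (hG.mono h)
  refine rho_le_of_super hG h0 fun v => ?_
  rw [← hy]
  exact nsum_mono h (fun v => (h0 v).le) (fun v => le_rfl) v

theorem rho_strictMono {G H : SimpleGraph V} (hG : G.Connected) (h : G < H) :
    rho G < rho H := by
  obtain ⟨y, h0, hy⟩ := exists_perron (hG.mono h.le)
  obtain ⟨a, b, hH, hGab⟩ : ∃ a b, H.Adj a b ∧ ¬ G.Adj a b := by
    by_contra! hcon
    exact h.not_ge fun a b hab => hcon a b hab
  refine rho_lt_of_super hG h0 (fun v => ?_) a ?_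
  · rw [← hy]
    exact nsum_mono h.le (fun v => (h0 v).le) (fun v => le_rfl) v
  · rw [← hy]
    refine Finset.sum_lt_sum (fun w _ => ?_) ⟨b, Finset.mem_univ _, ?_⟩
    · by_cases hw : G.Adj a w
      · simp [hw, h.le hw]
      · simp only [hw, if_false]
        split_ifs <;> simp [(h0 w).le]
    · simp [hH, hGab, h0]

theorem nsum_induce (G : SimpleGraph V) (s : Set V) [Fintype s] (f : V → ℝ) (u : s) :
    nsum (G.induce s) (fun v => f v) u = ∑ w, if G.Adj u w ∧ w ∈ s then f w else 0 := by
  unfold nsum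
  simp only [SimpleGraph.comap_adj, Function.Embedding.subtype_apply]
  rw [← Finset.sum_subtype (Finset.univ.filter (· ∈ s)) (by simp)
    (fun w => if G.Adj u w then f w else 0), Finset.sum_filter]
  refine Finset.sum_congr rfl fun w _ => ?_
  by_cases h1 : w ∈ s <;> by_cases h2 : G.Adj u w <;> simp [h1, h2]

/-- Deleting vertices from a connected graph decreases the spectral radius. -/
theorem rho_induce_lt {G : SimpleGraph V} (hG : G.Connected) {s : Set V} [Fintype s]
    (hs : s ≠ Set.univ)
    (hc : (G.induce s).Connected) : rho (G.induce s) < rho G := by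
  obtain ⟨y, h0, hy⟩ := exists_perron hG
  have hle : ∀ u : s, nsum (G.induce s) (fun v => y v) u ≤ nsum G y u := by
    intro u
    rw [nsum_induce]
    refine Finset.sum_le_sum fun w _ => ?_
    by_cases h1 : w ∈ s <;> by_cases h2 : G.Adj u w <;> simp [h1, h2, (h0 w).le]
  obtain ⟨⟨a, ha⟩⟩ := hc.nonempty
  obtain ⟨b, hb⟩ : ∃ b, b ∉ s := by
    by_contra! h; exact hs (Set.eq_univ_of_forall h)
  obtain ⟨p⟩ := hG.preconnected a b
  -- Strictness comes from an edge leaving `s`: its inner end loses a neighbour of positive weight.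
  obtain ⟨d, -, hd1, hd2⟩ := p.exists_boundary_dart s ha hb
  refine rho_lt_of_super hc (fun v => h0 v) (fun u => (hle u).trans_eq (hy u)) ⟨d.fst, hd1⟩ ?_
  rw [← hy, nsum_induce]
  refine Finset.sum_lt_sum (fun w _ => ?_) ⟨d.snd, Finset.mem_univ _, ?_⟩
  · by_cases h1 : w ∈ s <;> by_cases h2 : G.Adj d.fst w <;> simp [h1, h2, (h0 w).le]
  · simp [hd2, d.adj, h0]

/-! ### Grafting a new vertex; vertex covers and admissible parameters. -/

/-- The graph obtained from `G` by moving the edges between `v` and `S` to a new vertex, which is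
also joined to `z`. -/
def graft (G : SimpleGraph V) (v : V) (S : Finset V) (z : V) : SimpleGraph (Option V) where
  Adj a b := match a, b with
    | some a, some b => G.Adj a b ∧ ¬ (a = v ∧ b ∈ S) ∧ ¬ (b = v ∧ a ∈ S)
    | some a, none => a ∈ S ∨ a = z
    | none, some b => b ∈ S ∨ b = z
    | none, none => False
  symm := ⟨by
    intro a b h
    cases a <;> cases b <;> simp only at h ⊢
    · exact h
    · exact h
    · exact ⟨h.1.symm, h.2.2, h.2.1⟩⟩
  loopless := ⟨by
    intro a h
    cases a <;> simp at h⟩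

theorem graft_adj_some {G : SimpleGraph V} {v : V} {S : Finset V} {z a b : V} :
    (graft G v S z).Adj (some a) (some b) ↔
      G.Adj a b ∧ ¬ (a = v ∧ b ∈ S) ∧ ¬ (b = v ∧ a ∈ S) := Iff.rfl

theorem graft_adj_none {G : SimpleGraph V} {v : V} {S : Finset V} {z a : V} :
    (graft G v S z).Adj none (some a) ↔ a ∈ S ∨ a = z := Iff.rfl

theorem graft_adj_none' {G : SimpleGraph V} {v : V} {S : Finset V} {z a : V} :
    (graft G v S z).Adj (some a) none ↔ a ∈ S ∨ a = z := Iff.rfl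

theorem nsum_graft_none {G : SimpleGraph V} {v : V} {S : Finset V} {z : V} (hzS : z ∉ S)
    (f : Option V → ℝ) :
    nsum (graft G v S z) f none = ∑ s ∈ S, f (some s) + f (some z) := by
  rw [nsum, Fintype.sum_option]
  simp only [graft_adj_none, SimpleGraph.irrefl, if_false, zero_add]
  rw [← Finset.sum_filter]
  have : Finset.univ.filter (fun a => a ∈ S ∨ a = z) = insert z S := by
    ext a; simp [or_comm]
  rw [this, Finset.sum_insert hzS, add_comm]

theorem nsum_graft_some {G : SimpleGraph V} {v : V} {S : Finset V} {z : V}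
    (hS : ∀ s ∈ S, G.Adj v s) (f : Option V → ℝ) (u : V) :
    nsum (graft G v S z) f (some u) = nsum G (fun w => f (some w)) u
      - (if u ∈ S then f (some v) else 0) - (if u = v then ∑ s ∈ S, f (some s) else 0)
      + (if u ∈ S ∨ u = z then f none else 0) := by
  rw [nsum, Fintype.sum_option]
  simp only [graft_adj_some, graft_adj_none', nsum]
  have hvS : v ∉ S := fun h => (hS v h).ne rfl
  have h1 : (if u ∈ S then f (some v) else 0)
      = ∑ w, if w = v ∧ u ∈ S then f (some w) else 0 := by
    by_cases hu : u ∈ S <;> simp [hu]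
  have h2 : (if u = v then ∑ s ∈ S, f (some s) else 0)
      = ∑ w, if u = v ∧ w ∈ S then f (some w) else 0 := by
    by_cases hu : u = v <;> simp [hu]
  rw [h1, h2, ← Finset.sum_sub_distrib, ← Finset.sum_sub_distrib, add_comm]
  congr 1
  refine Finset.sum_congr rfl fun w _ => ?_
  by_cases ha : w = v ∧ u ∈ S
  · have h3 : ¬ (u = v ∧ w ∈ S) := by rintro ⟨rfl, -⟩; exact hvS ha.2
    have h4 : G.Adj u w := by rw [ha.1]; exact (hS u ha.2).symm
    rw [if_pos ha, if_neg h3, if_pos h4, if_neg fun h => h.2.2 ha]; simp [ha.1]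
  · by_cases hb : u = v ∧ w ∈ S
    · have h4 : G.Adj u w := by rw [hb.1]; exact hS w hb.2
      rw [if_neg ha, if_pos hb, if_pos h4, if_neg fun h => h.2.1 hb]; simp
    · simp only [ha, hb]; simp

theorem reachable_of_forall_adj {V W : Type*} {G : SimpleGraph V} {H : SimpleGraph W} (f : V → W)
    (h : ∀ a b, G.Adj a b → H.Reachable (f a) (f b)) {a c : V} (hac : G.Reachable a c) :
    H.Reachable (f a) (f c) := by
  obtain ⟨p⟩ := hac
  induction p with
  | nil => exact .rfl
  | cons hab p ih => exact (h _ _ hab).trans ih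

theorem graft_connected {G : SimpleGraph V} (hG : G.Connected) {v : V} {S : Finset V} {z : V}
    (hS : ∀ s ∈ S, G.Adj v s) (hzS : z ∉ S) (hz : z = v ∨ G.Adj v z) :
    (graft G v S z).Connected := by
  have hvS : v ∉ S := fun h => (hS v h).ne rfl
  have hzn : (graft G v S z).Reachable (some z) none :=
    SimpleGraph.Adj.reachable (graft_adj_none'.2 (Or.inr rfl))
  have hvz : (graft G v S z).Reachable (some v) (some z) := by
    rcases hz with rfl | hz
    · exact .rfl
    · exact SimpleGraph.Adj.reachable
        (graft_adj_some.2 ⟨hz, fun h => hzS h.2, fun h => hvS h.2⟩)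
  have hSv : ∀ s ∈ S, (graft G v S z).Reachable (some v) (some s) := fun s hs =>
    (hvz.trans hzn).trans (SimpleGraph.Adj.reachable (graft_adj_none.2 (Or.inl hs)))
  have hadj : ∀ a b, G.Adj a b → (graft G v S z).Reachable (some a) (some b) := by
    intro a b hab
    by_cases h1 : a = v ∧ b ∈ S
    · rw [h1.1]; exact hSv b h1.2
    · by_cases h2 : b = v ∧ a ∈ S
      · rw [h2.1]; exact (hSv a h2.2).symm
      · exact SimpleGraph.Adj.reachable (graft_adj_some.2 ⟨hab, h1, h2⟩)
  rw [SimpleGraph.connected_iff_exists_forall_reachable]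
  refine ⟨some v, fun w => ?_⟩
  cases w with
  | none => exact hvz.trans hzn
  | some w =>
    exact reachable_of_forall_adj some hadj (hG.preconnected v w)

/-- One surgery serves three purposes. With `z = v` and `S = {b}` it subdivides the edge v b; with
`z` another neighbour of `v` it splits `v` into two vertices sharing `z`; two grafts in a row split
`v` into two vertices at distance two. -/
theorem rho_graft_le {G : SimpleGraph V} (hG : G.Connected) {v : V} {S : Finset V} {z : V}
    (hS : ∀ s ∈ S, G.Adj v s) (hzS : z ∉ S) (hz : z = v ∨ G.Adj v z) {f : V → ℝ} {t r : ℝ}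
    (hf : ∀ u, 0 < f u) (ht : 0 < t) (h0 : ∑ s ∈ S, f s + f z ≤ r * t)
    (h : ∀ u, nsum G f u - (if u ∈ S then f v else 0) - (if u = v then ∑ s ∈ S, f s else 0)
      + (if u ∈ S ∨ u = z then t else 0) ≤ r * f u) : rho (graft G v S z) ≤ r := by
  refine rho_le_of_super (graft_connected hG hS hzS hz)
    (f := fun a => a.elim t f) (fun a => ?_) fun a => ?_
  · cases a <;> simp [hf, ht]
  · cases a with
    | none => rw [nsum_graft_none hzS]; exact h0
    | some u => rw [nsum_graft_some hS]; exact h u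

/-- `C` is a vertex cover. -/
def IsCover {V : Type*} (G : SimpleGraph V) (C : Finset V) : Prop :=
  ∀ ⦃a b⦄, G.Adj a b → a ∈ C ∨ b ∈ C

theorem IsCover.mono {G H : SimpleGraph V} {C : Finset V} (h : IsCover H C) (hle : G ≤ H) :
    IsCover G C := fun _ _ hab => h (hle hab)

/-- If everything the new vertex touches is covered, the new vertex need not be: the order grows and
the cover does not. -/
theorem graft_cover {G : SimpleGraph V} {v : V} {S : Finset V} {z : V} {C : Finset V}
    (hC : IsCover G C) (hS : S ⊆ C) (hz : z ∈ C) :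
    IsCover (graft G v S z) (C.map Function.Embedding.some) := by
  intro a b hab
  cases a <;> cases b
  · exact absurd hab (SimpleGraph.irrefl _)
  · right
    rcases graft_adj_none.1 hab with h | rfl <;> simp [*]
    exact hS h
  · left
    rcases graft_adj_none'.1 hab with h | rfl <;> simp [*]
    exact hS h
  · simpa using hC hab.1

theorem graft_cover_insert {G : SimpleGraph V} {v : V} {S : Finset V} {z : V} {C : Finset V}
    (hC : IsCover G C) :
    IsCover (graft G v S z) (insert none (C.map Function.Embedding.some)) := by
  intro a b hab
  cases a <;> cases b
  · simp
  · simp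
  · simp
  · simpa using hC hab.1

theorem card_insert_none (C : Finset V) :
    (insert none (C.map Function.Embedding.some)).card = C.card + 1 := by
  rw [Finset.card_insert_of_notMem (by simp), Finset.card_map]

/-- There is a connected graph of order `n` with spectral radius at most `r` and a vertex cover of
size `k`. -/
def Adm (n k : ℕ) (r : ℝ) : Prop :=
  ∃ (G : SimpleGraph (Fin n)) (C : Finset (Fin n)),
    G.Connected ∧ IsCover G C ∧ C.card = k ∧ rho G ≤ r

theorem Adm.of_graph {G : SimpleGraph V} {C : Finset V} {n k : ℕ} {r : ℝ} (hG : G.Connected)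
    (hC : IsCover G C) (hn : Fintype.card V = n) (hk : C.card = k) (hr : rho G ≤ r) :
    Adm n k r := by
  obtain ⟨e⟩ : Nonempty (V ≃ Fin n) := ⟨Fintype.equivFinOfCardEq hn⟩
  refine ⟨G.map e.toEmbedding, C.map e.toEmbedding, (SimpleGraph.Iso.map e G).connected_iff.1 hG,
    ?_, by simpa using hk, (rho_le_of_iso hG (SimpleGraph.Iso.map e G).symm).trans hr⟩
  intro a b hab
  obtain ⟨-, a, b, h, rfl, rfl⟩ := hab
  simpa using hC h

theorem Adm.mono {n k : ℕ} {r r' : ℝ} (h : Adm n k r) (hr : r ≤ r') : Adm n k r' := by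
  obtain ⟨G, C, h1, h2, h3, h4⟩ := h
  exact ⟨G, C, h1, h2, h3, h4.trans hr⟩

/-- The spanning tree may be used in place of the graph. -/
theorem Adm.exists_tree {n k : ℕ} {r : ℝ} (h : Adm n k r) :
    ∃ (G : SimpleGraph (Fin n)) (C : Finset (Fin n)),
      G.IsTree ∧ IsCover G C ∧ C.card = k ∧ rho G ≤ r := by
  obtain ⟨G, C, h1, h2, h3, h4⟩ := h
  obtain ⟨T, hT, hTt⟩ := h1.exists_isTree_le
  exact ⟨T, C, hTt, h2.mono hT, h3, (rho_mono hTt.connected hT).trans h4⟩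

/-! ### Surgeries on trees that do not raise the spectral radius. -/

/-- One of the two sides of an edge of a tree. -/
theorem exists_side {G : SimpleGraph V} (hG : G.IsTree) {a b : V} (hab : G.Adj a b) :
    ∃ B : Set V, a ∈ B ∧ b ∉ B ∧ ∀ u w, G.Adj u w → u ∈ B → w ∉ B → u = a ∧ w = b := by
  have hbr := SimpleGraph.isAcyclic_iff_forall_adj_isBridge.1 hG.isAcyclic hab
  rw [SimpleGraph.isBridge_iff] at hbr
  refine ⟨{u | (G.deleteEdges {s(a, b)}).Reachable a u}, .rfl, hbr, ?_⟩
  intro u w huw hu hw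
  by_contra hne
  apply hw
  refine SimpleGraph.Reachable.trans hu (SimpleGraph.Adj.reachable ?_)
  rw [SimpleGraph.deleteEdges_adj]
  refine ⟨huw, fun h => ?_⟩
  rw [Set.mem_singleton_iff, Sym2.eq_iff] at h
  rcases h with h | h
  · exact hne h
  · exact hbr (h.1 ▸ hu)

theorem rho_pos {G : SimpleGraph V} (hG : G.Connected) {a b : V} (hab : G.Adj a b) :
    0 < rho G := by
  obtain ⟨y, h0, hy⟩ := exists_perron hG
  have := le_nsum (fun v => (h0 v).le) hab
  rw [hy] at this
  exact pos_of_mul_pos_left ((h0 b).trans_le this) (h0 a).le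

/-- Rescaling a vector on one side of a bridge disturbs the neighbour sums only at the two ends of
the bridge. The factor `c` is thus a free parameter in building test vectors. -/
theorem nsum_scaled {G : SimpleGraph V} {B : Set V} {a b : V} (hab : G.Adj a b) (ha : a ∈ B)
    (hb : b ∉ B) (hB : ∀ u w, G.Adj u w → u ∈ B → w ∉ B → u = a ∧ w = b)
    (y : V → ℝ) (c : ℝ) (u : V) :
    nsum G (fun w => if w ∈ B then c * y w else y w) u =
      (if u ∈ B then c * nsum G y u else nsum G y u) + (if u = a then (1 - c) * y b else 0)
        + (if u = b then (c - 1) * y a else 0) := by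
  have key : ∀ w, (if G.Adj u w then (if w ∈ B then c * y w else y w) else 0) =
      (if u ∈ B then c * (if G.Adj u w then y w else 0) else (if G.Adj u w then y w else 0))
      + (if u = a then (if w = b then (1 - c) * y b else 0) else 0)
      + (if u = b then (if w = a then (c - 1) * y a else 0) else 0) := by
    intro w
    by_cases huw : G.Adj u w
    · by_cases hu : u ∈ B <;> by_cases hw : w ∈ B
      · have h1 : ¬ (w = b) := by rintro rfl; exact hb hw
        have h2 : ¬ (u = b) := by rintro rfl; exact hb hu
        simp [huw, hu, hw, h1, h2]
      · obtain ⟨rfl, rfl⟩ := hB u w huw hu hw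
        have h2 : ¬ (u = w) := huw.ne
        simp [huw, hu, hw, h2]; ring
      · obtain ⟨rfl, rfl⟩ := hB w u huw.symm hw hu
        have h2 : ¬ (u = w) := huw.ne
        simp [huw, hu, hw, h2]; ring
      · have h1 : ¬ (w = a) := by rintro rfl; exact hw ha
        have h2 : ¬ (u = a) := by rintro rfl; exact hu ha
        simp [huw, hu, hw, h1, h2]
    · have h1 : ¬ (u = a ∧ w = b) := by rintro ⟨rfl, rfl⟩; exact huw hab
      have h2 : ¬ (u = b ∧ w = a) := by rintro ⟨rfl, rfl⟩; exact huw hab.symm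
      have h3 : (if u = a then (if w = b then (1 - c) * y b else 0) else 0) = 0 := by
        rw [← ite_and, if_neg h1]
      have h4 : (if u = b then (if w = a then (c - 1) * y a else 0) else 0) = 0 := by
        rw [← ite_and, if_neg h2]
      rw [h3, h4]
      simp [huw]
  rw [nsum, Finset.sum_congr rfl fun w _ => key w, Finset.sum_add_distrib,
    Finset.sum_add_distrib]
  congr 1
  · congr 1
    · split_ifs
      · rw [nsum, Finset.mul_sum]
      · rfl
    · split_ifs <;> simp
  · split_ifs <;> simp

/-- Subdividing an edge of a tree. -/
theorem rho_subdivide_le {G : SimpleGraph V} (hG : G.IsTree) {y : V → ℝ} (h0 : ∀ v, 0 < y v)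
    (hy : ∀ v, nsum G y v = rho G * y v) {a b : V} (hab : G.Adj a b)
    (h : y a ^ 2 ≤ y b * (rho G * y a - y b)) : rho (graft G a {b} a) ≤ rho G := by
  obtain ⟨B, haB, hbB, hB⟩ := exists_side hG hab
  have hne : a ≠ b := hab.ne
  have ha := h0 a
  have hb := h0 b
  -- The factor `y a / y b` on the side of `a` and the value `y a` at the new vertex keep the
  -- eigenvalue equation exact at `a` and `b`. The inequality at the new vertex is then the
  -- hypothesis `h`.
  refine rho_graft_le hG.connected (f := fun w => if w ∈ B then (y a / y b) * y w else y w)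
    (t := y a) (by simpa using hab) (by simpa using hne) (Or.inl rfl) (fun u => ?_) ha ?_
    fun u => ?_
  · split_ifs
    · exact mul_pos (div_pos ha hb) (h0 u)
    · exact h0 u
  · simp only [Finset.sum_singleton, hbB, haB, if_true, if_false]
    rw [div_mul_eq_mul_div, ← le_sub_iff_add_le', div_le_iff₀ hb]
    nlinarith
  · rw [nsum_scaled hab haB hbB hB]
    simp only [Finset.sum_singleton, Finset.mem_singleton, haB, hbB, if_true, if_false]
    by_cases hua : u = a
    · subst hua
      simp only [hne, haB, if_true, if_false, or_true, hy]
      have : y u / y b * y b = y u := by field_simp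
      nlinarith
    · by_cases hub : u = b
      · subst hub
        simp only [hua, hbB, if_true, if_false, true_or, hy]
        nlinarith
      · simp only [hua, hub, if_false, or_false, hy]
        split_ifs <;> nlinarith

/-- Splitting a vertex `x` of a tree into two vertices with a common neighbour `c`. -/
theorem rho_share_le {G : SimpleGraph V} (hG : G.IsTree) {y : V → ℝ} (h0 : ∀ v, 0 < y v)
    (hy : ∀ v, nsum G y v = rho G * y v) {x c b d : V} (hc : G.Adj x c) (hb : G.Adj x b)
    (hd : G.Adj x d) (hcb : c ≠ b) (hcd : c ≠ d) (hbd : b ≠ d) (h1 : y c ≤ y b)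
    (h2 : y c ≤ y d) : rho (graft G x {b} c) ≤ rho G := by
  obtain ⟨B, hcB, hxB, hB⟩ := exists_side hG hc.symm
  have hr : 0 < rho G := rho_pos hG.connected hc
  have hout : ∀ u, G.Adj x u → u ≠ c → u ∉ B := by
    intro u hu hne hmem
    exact hne (hB u x hu.symm hmem hxB).1
  have hbB := hout b hb hcb.symm
  have hsum : y c + y b + y d ≤ rho G * y x := by
    rw [← hy]
    have := sum_le_nsum (G := G) (fun v => (h0 v).le) (u := x) (s := {c, b, d})
      (by simp [hc, hb, hd])
    rw [Finset.sum_insert (by simp [hcb, hcd]), Finset.sum_pair hbd] at this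
    linarith
  -- The weights on the side of `c` are doubled, to pay for the second copy of `x`. The values `t`
  -- (new vertex) and `s` (at `x`) make the equation exact at both copies. What remains is `s + t ≤
  -- 2 * y x` at `c`, `t ≤ y x` at `b`, and `s ≤ y x` at the other neighbours of `x`; the minimality
  -- of `y c` supplies these.
  set t := (y b + 2 * y c) / rho G with ht
  have htr : rho G * t = y b + 2 * y c := by rw [ht]; field_simp
  have hc0 := h0 c
  have hb0 := h0 b
  have hx0 := h0 x
  have htpos : 0 < t := by positivity
  have htx : t ≤ y x := by
    rw [← mul_le_mul_iff_right₀ hr, htr]; linarith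
  -- the value at `x`
  set s := y x - (y b - y c) / rho G with hs
  have hsr : rho G * s = rho G * y x - (y b - y c) := by rw [hs]; field_simp
  have hspos : 0 < s := by
    rw [← mul_lt_mul_iff_right₀ hr, mul_zero, hsr]; linarith
  have hsx : s ≤ y x := by
    rw [← mul_le_mul_iff_right₀ hr, hsr]; linarith
  have hst : s + t ≤ 2 * y x := by linarith
  have hst' : t + s ≤ y x + 3 * y c / rho G := by
    rw [hs, ht]; apply le_of_eq; field_simp; ring
  set f : V → ℝ := fun w => if w = x then s else if w ∈ B then 2 * y w else y w with hf
  have hfx : f x = s := by simp [hf]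
  have hns : ∀ u, nsum G f u ≤ nsum G (fun w => if w ∈ B then 2 * y w else y w) u
      + (if G.Adj u x then s - y x else 0) := by
    intro u
    have : ∀ w, (if G.Adj u w then f w else 0) =
        (if G.Adj u w then (if w ∈ B then 2 * y w else y w) else 0)
        + (if w = x then (if G.Adj u x then s - y x else 0) else 0) := by
      intro w
      by_cases hw : w = x
      · subst hw; by_cases h : G.Adj u w <;> simp [hf, hxB, h]
      · simp [hf, hw]
    rw [nsum, Finset.sum_congr rfl fun w _ => this w, Finset.sum_add_distrib]
    simp [nsum]
  have hbx : b ≠ x := hb.ne'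
  have hcx : c ≠ x := hc.ne'
  refine rho_graft_le hG.connected (f := f) (t := t) (by simpa using hb) (by simpa using hcb)
    (Or.inr hc) (fun u => ?_) htpos ?_ fun u => ?_
  · simp only [hf]; split_ifs
    · exact hspos
    · linarith [h0 u]
    · exact h0 u
  · simp only [Finset.sum_singleton, hf, hbB, hcB, hbx, hcx, if_true, if_false]
    rw [htr]
  · have h3 := hns u
    rw [nsum_scaled hc.symm hcB hxB hB] at h3
    simp only [Finset.sum_singleton, Finset.mem_singleton, hfx]
    by_cases hux : u = x
    · subst hux
      simp only [hbx.symm, hcx.symm, hxB, hfx, if_true, if_false, or_false,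
        SimpleGraph.irrefl, hy] at h3 ⊢
      have : f b = y b := by simp [hf, hbx, hbB]
      rw [this, hsr]
      linarith
    · have hfu : f u = if u ∈ B then 2 * y u else y u := by simp [hf, hux]
      rw [hfu]
      by_cases huc : u = c
      · subst huc
        simp only [hux, hcb, hcB, hc.symm, if_true, if_false, or_true, hy] at h3 ⊢
        linarith
      · simp only [hux, huc, if_false, or_false, hy] at h3 ⊢
        by_cases hub : u = b
        · subst hub
          simp only [hbB, hb.symm, if_true, if_false] at h3 ⊢
          linarith
        · simp only [hub, if_false]
          have h4 : (if G.Adj u x then s - y x else 0) ≤ 0 := by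
            split_ifs <;> linarith
          split_ifs at h3 ⊢ <;> linarith

/-- Splitting a vertex `v` into two vertices at distance two. -/
theorem rho_split_le {G : SimpleGraph V} (hG : G.Connected) {y : V → ℝ} (h0 : ∀ v, 0 < y v)
    (hy : ∀ v, nsum G y v = rho G * y v) (hr : 0 < rho G) {v : V} {S : Finset V}
    (hS : ∀ s ∈ S, G.Adj v s) (h1 : 2 * y v ≤ rho G * ∑ s ∈ S, y s)
    (h2 : 2 * y v ≤ rho G * (rho G * y v - ∑ s ∈ S, y s)) :
    (graft (graft G v S v) none {some v} none).Connected ∧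
      rho (graft (graft G v S v) none {some v} none) ≤ rho G := by
  have hvS : v ∉ S := fun h => (hS v h).ne rfl
  have hc1 := graft_connected hG hS hvS (Or.inl rfl)
  have hA : ∀ s ∈ ({some v} : Finset (Option V)), (graft G v S v).Adj none s := by
    simp [graft_adj_none]
  refine ⟨graft_connected hc1 hA (by simp) (Or.inl rfl), ?_⟩
  have hv0 := h0 v
  set t := 2 * y v / rho G with ht
  have htr : rho G * t = 2 * y v := by rw [ht]; field_simp
  have hts : t ≤ ∑ s ∈ S, y s := by rw [← mul_le_mul_iff_right₀ hr, htr]; exact h1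
  have hts' : t ≤ rho G * y v - ∑ s ∈ S, y s := by
    rw [← mul_le_mul_iff_right₀ hr, htr]; exact h2
  -- Both copies of `v` keep the weight `y v`, and `t` makes the equation exact at the middle
  -- vertex. The inequality at `v` is `hts`, the one at its copy is `hts'`.
  refine rho_graft_le hc1 (f := fun a => a.elim (y v) y) (t := t) hA (by simp) (Or.inl rfl)
    (fun u => ?_) (by positivity) ?_ fun u => ?_
  · cases u <;> simp [h0]
  · simp; linarith
  · cases u with
    | none =>
      rw [nsum_graft_none hvS]
      simp
      linarith
    | some u =>
      rw [nsum_graft_some hS]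
      have : nsum G (fun w => (some w).elim (y v) y) u = rho G * y u := hy u
      rw [this]
      simp only [Option.elim_some, Option.elim_none, Finset.mem_singleton, Option.some.injEq,
        reduceCtorEq, if_false, or_false]
      by_cases huv : u = v
      · subst huv
        simp [hvS]
        linarith
      · by_cases hu : u ∈ S <;> simp [huv, hu]

/-! ### Counting leaves; four leaves force spectral radius at least two. -/

theorem sum_degree_tree {G : SimpleGraph V} (hG : G.IsTree) :
    ∑ v, (G.degree v : ℤ) = 2 * Fintype.card V - 2 := by
  have h1 := G.sum_degrees_eq_twice_card_edges
  have h2 := hG.card_edgeFinset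
  rw [← Nat.cast_sum, h1, ← h2]
  push_cast
  ring

theorem one_le_degree {G : SimpleGraph V} (hG : G.Connected) (hV : 2 ≤ Fintype.card V) (v : V) :
    1 ≤ G.degree v := by
  have : Nontrivial V := Fintype.one_lt_card_iff_nontrivial.1 hV
  exact hG.preconnected.degree_pos_of_nontrivial v

/-- The complement of a cover is independent, so no edge is counted twice. -/
theorem sum_degree_compl_cover {G : SimpleGraph V} {C : Finset V} (hC : IsCover G C) :
    ∑ x ∈ Cᶜ, G.degree x = (Cᶜ.biUnion fun x => G.incidenceFinset x).card := by
  rw [Finset.card_biUnion]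
  · exact Finset.sum_congr rfl fun x _ => (G.card_incidenceFinset_eq_degree x).symm
  · intro x hx y hy hxy
    rw [Function.onFun, Finset.disjoint_left]
    intro e he he'
    rw [SimpleGraph.mem_incidenceFinset] at he he'
    have hadj := G.adj_of_mem_incidenceSet hxy he he'
    rcases hC hadj with h | h
    · exact (Finset.mem_compl.1 hx) h
    · exact (Finset.mem_compl.1 hy) h

theorem sum_degree_compl_cover_le {G : SimpleGraph V} (hG : G.IsTree) {C : Finset V}
    (hC : IsCover G C) : ∑ x ∈ Cᶜ, G.degree x + 1 ≤ Fintype.card V := by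
  rw [sum_degree_compl_cover hC, ← hG.card_edgeFinset]
  gcongr
  intro e he
  rw [Finset.mem_biUnion] at he
  obtain ⟨x, -, hx⟩ := he
  exact G.incidenceFinset_subset x hx

theorem sum_degree_compl_cover_lt {G : SimpleGraph V} (hG : G.IsTree) {C : Finset V}
    (hC : IsCover G C) {a b : V} (hab : G.Adj a b) (ha : a ∈ C) (hb : b ∈ C) :
    ∑ x ∈ Cᶜ, G.degree x + 1 < Fintype.card V := by
  rw [sum_degree_compl_cover hC, ← hG.card_edgeFinset]
  gcongr
  refine Finset.ssubset_iff_subset_ne.2 ⟨?_, ?_⟩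
  · intro e he
    rw [Finset.mem_biUnion] at he
    obtain ⟨x, -, hx⟩ := he
    exact G.incidenceFinset_subset x hx
  · intro h
    have : s(a, b) ∈ Cᶜ.biUnion fun x => G.incidenceFinset x := by
      rw [h]; simpa using hab
    rw [Finset.mem_biUnion] at this
    obtain ⟨x, hx, hxe⟩ := this
    rw [SimpleGraph.mem_incidenceFinset] at hxe
    have := hxe.2
    rw [Sym2.mem_iff] at this
    rw [Finset.mem_compl] at hx
    rcases this with rfl | rfl
    · exact hx ha
    · exact hx hb

/-- The number of leaves outside a vertex cover is at least `n - 2 k + 1`. -/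
theorem le_card_leaves {G : SimpleGraph V} (hG : G.IsTree) (hV : 2 ≤ Fintype.card V)
    {C : Finset V} (hC : IsCover G C) :
    Fintype.card V + 1 ≤ (Cᶜ.filter fun x => G.degree x = 1).card + 2 * C.card := by
  have h1 := sum_degree_compl_cover_le hG hC
  -- Outside the cover every vertex that is not a leaf has degree at least two, whence 2 (n - k) ≤
  -- (n - 1) + number of leaves.
  have h2 : ∑ x ∈ Cᶜ, 2 ≤ ∑ x ∈ Cᶜ, (G.degree x + if G.degree x = 1 then 1 else 0) := by
    refine Finset.sum_le_sum fun x _ => ?_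
    have := one_le_degree hG.connected hV x
    split_ifs <;> omega
  rw [Finset.sum_add_distrib, ← Finset.card_filter, Finset.sum_const, smul_eq_mul,
    Finset.card_compl] at h2
  have := Finset.card_le_univ C
  omega

/-- A tree with four leaves has a vertex of degree four or two vertices of degree three. -/
theorem exists_branch {G : SimpleGraph V} (hG : G.IsTree) (hV : 2 ≤ Fintype.card V)
    (h4 : 4 ≤ (Finset.univ.filter fun x => G.degree x = 1).card) :
    (∃ w, 4 ≤ G.degree w) ∨ ∃ w u, w ≠ u ∧ 3 ≤ G.degree w ∧ 3 ≤ G.degree u := by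
  by_contra! hcon
  obtain ⟨h1, h2⟩ := hcon
  have h3 := sum_degree_tree hG
  -- Four leaves contribute -4 to a total of -2, while a single vertex of degree three gives back
  -- only 1.
  have hsum : ∑ v, ((G.degree v : ℤ) - 2) = -2 := by
    rw [Finset.sum_sub_distrib, h3]; simp; ring
  have hle : ∀ v, (G.degree v : ℤ) - 2 ≤
      (if G.degree v = 3 then 1 else 0) - (if G.degree v = 1 then 1 else 0) := by
    intro v
    have := h1 v
    have := one_le_degree hG.connected hV v
    split_ifs <;> omega
  have h5 := Finset.sum_le_sum fun v (_ : v ∈ Finset.univ) => hle v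
  rw [hsum, Finset.sum_sub_distrib, ← Nat.cast_one (R := ℤ)] at h5
  have h6 : (Finset.univ.filter fun x => G.degree x = 3).card ≤ 1 := by
    rw [Finset.card_le_one]
    intro a ha b hb
    by_contra hne
    simp only [Finset.mem_filter, Finset.mem_univ, true_and] at ha hb
    have := h2 a b hne ha.ge
    omega
  simp only [Finset.sum_ite, Finset.sum_const_zero, add_zero, Finset.sum_const, nsmul_eq_mul] at h5
  push_cast at h5
  omega

theorem path_interior {G : SimpleGraph V} {w u v : V} {p : G.Walk w u} (hp : p.IsPath)
    (hv : v ∈ p.support) (h1 : v ≠ w) (h2 : v ≠ u) :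
    ∃ a b, a ≠ b ∧ a ∈ p.support ∧ b ∈ p.support ∧ G.Adj v a ∧ G.Adj v b := by
  rw [SimpleGraph.Walk.mem_support_iff_exists_getVert] at hv
  obtain ⟨i, hi, hil⟩ := hv
  have hi0 : i ≠ 0 := by rintro rfl; exact h1 (by rw [← hi]; simp)
  have hi1 : i ≠ p.length := by rintro rfl; exact h2 (by rw [← hi]; simp)
  obtain ⟨j, rfl⟩ := Nat.exists_eq_succ_of_ne_zero hi0
  refine ⟨p.getVert j, p.getVert (j + 2), ?_, p.getVert_mem_support _, p.getVert_mem_support _,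
    ?_, ?_⟩
  · intro h
    have := hp.getVert_injOn (by simp; omega) (by simp; omega) h
    omega
  · rw [← hi]; exact (p.adj_getVert_succ (by omega)).symm
  · rw [← hi]; exact p.adj_getVert_succ (by omega)

theorem path_start {G : SimpleGraph V} {w u : V} (p : G.Walk w u) (h : w ≠ u) :
    ∃ a ∈ p.support, G.Adj w a := by
  cases p with
  | nil => exact absurd rfl h
  | cons h q => exact ⟨_, by simp, h⟩

/-- The test vector is that of the star with four rays: 2 at the centre, 1 at its neighbours. -/
theorem two_le_rho_of_degree {G : SimpleGraph V} (hG : G.Connected) {w : V}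
    (hw : 4 ≤ G.degree w) : 2 ≤ rho G := by
  set f : V → ℝ := fun v => if v = w then 2 else if G.Adj w v then 1 else 0 with hf
  have hf0 : ∀ v, 0 ≤ f v := by intro v; simp only [hf]; split_ifs <;> norm_num
  refine le_rho_of_sub hG hf0 w (by simp [hf]) fun v => ?_
  by_cases hvw : v = w
  · subst hvw
    have h1 := sum_le_nsum (G := G) hf0 (u := v) (s := G.neighborFinset v) (by simp)
    have h2 : ∑ u ∈ G.neighborFinset v, f u = ∑ u ∈ G.neighborFinset v, (1 : ℝ) := by
      refine Finset.sum_congr rfl fun u hu => ?_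
      rw [SimpleGraph.mem_neighborFinset] at hu
      simp [hf, hu, hu.ne']
    rw [h2, Finset.sum_const, SimpleGraph.card_neighborFinset_eq_degree] at h1
    have : (4 : ℝ) ≤ G.degree v := by exact_mod_cast hw
    simp [hf] at h1 ⊢
    linarith
  · by_cases hadj : G.Adj w v
    · have := le_nsum hf0 hadj.symm
      simp [hf, hvw, hadj] at this ⊢
      linarith
    · simpa [hf, hvw, hadj] using nsum_nonneg hf0 v

/-- The marks of an extended Dynkin diagram of type D: 2 on a path joining the two branching
vertices, 1 on the neighbours of its ends. An inner vertex of the path sees two marks 2; an end sees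
one mark 2 and at least two further marks that are at least 1. -/
theorem two_le_rho_of_two_branch {G : SimpleGraph V} (hG : G.Connected) {w u : V} (hne : w ≠ u)
    (hw : 3 ≤ G.degree w) (hu : 3 ≤ G.degree u) : 2 ≤ rho G := by
  obtain ⟨p, hp⟩ := hG.exists_isPath w u
  set f : V → ℝ := fun v => if v ∈ p.support then 2 else if G.Adj w v ∨ G.Adj u v then 1 else 0
    with hf
  have hf0 : ∀ v, 0 ≤ f v := by intro v; simp only [hf]; split_ifs <;> norm_num
  have hend : ∀ v a, 3 ≤ G.degree v → (v = w ∨ v = u) → a ∈ p.support → G.Adj v a →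
      4 ≤ nsum G f v := by
    intro v a hv hvw ha hva
    have h1 := sum_le_nsum (G := G) hf0 (u := v) (s := G.neighborFinset v) (by simp)
    have h2 : ∑ x ∈ G.neighborFinset v, ((1 : ℝ) + if x = a then 1 else 0)
        ≤ ∑ x ∈ G.neighborFinset v, f x := by
      refine Finset.sum_le_sum fun x hx => ?_
      rw [SimpleGraph.mem_neighborFinset] at hx
      have hx' : G.Adj w x ∨ G.Adj u x := by
        rcases hvw with rfl | rfl
        · exact Or.inl hx
        · exact Or.inr hx
      by_cases hxa : x = a
      · subst hxa; simp [hf, ha]; norm_num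
      · simp only [hf, hx', hxa, if_true, if_false]; split_ifs <;> norm_num
    rw [Finset.sum_add_distrib, Finset.sum_const, SimpleGraph.card_neighborFinset_eq_degree,
      Finset.sum_ite_eq', if_pos (by simpa using hva)] at h2
    have : (3 : ℝ) ≤ G.degree v := by exact_mod_cast hv
    simp at h2
    linarith
  refine le_rho_of_sub hG hf0 w (by simp [hf]) fun v => ?_
  by_cases hvs : v ∈ p.support
  · have hfv : f v = 2 := by simp [hf, hvs]
    rw [hfv]
    norm_num
    by_cases hvw : v = w
    · obtain ⟨a, ha, hwa⟩ := path_start p hne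
      subst hvw
      exact hend v a hw (Or.inl rfl) ha hwa
    · by_cases hvu : v = u
      · obtain ⟨a, ha, hua⟩ := path_start p.reverse hne.symm
        subst hvu
        exact hend v a hu (Or.inr rfl) (by simpa using ha) hua
      · obtain ⟨a, b, hab, ha, hb, hva, hvb⟩ := path_interior hp hvs hvw hvu
        have h1 := sum_le_nsum (G := G) hf0 (u := v) (s := {a, b}) (by simp [hva, hvb])
        rw [Finset.sum_pair hab] at h1
        simp only [hf, ha, hb, if_true] at h1
        linarith
  · by_cases hadj : G.Adj w v ∨ G.Adj u v
    · have : ∃ x ∈ p.support, G.Adj v x := by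
        rcases hadj with h | h
        · exact ⟨w, by simp, h.symm⟩
        · exact ⟨u, by simp, h.symm⟩
      obtain ⟨x, hx, hvx⟩ := this
      have := le_nsum hf0 hvx
      simp only [hf, hx, hvs, hadj, if_true, if_false] at this ⊢
      linarith
    · simpa [hf, hvs, hadj] using nsum_nonneg hf0 v

theorem two_le_rho_of_leaves {G : SimpleGraph V} (hG : G.IsTree) (hV : 2 ≤ Fintype.card V)
    (h4 : 4 ≤ (Finset.univ.filter fun x => G.degree x = 1).card) : 2 ≤ rho G := by
  rcases exists_branch hG hV h4 with ⟨w, hw⟩ | ⟨w, u, hne, hw, hu⟩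
  · exact two_le_rho_of_degree hG.connected hw
  · exact two_le_rho_of_two_branch hG.connected hne hw hu

/-! ### Trading order against cover size: expansion and deletion. -/

/-- A vertex that may be split into two vertices at distance two. -/
theorem exists_split {G : SimpleGraph V} (hG : G.IsTree) (hV : 2 ≤ Fintype.card V)
    (h4 : 4 ≤ (Finset.univ.filter fun x => G.degree x = 1).card) {y : V → ℝ}
    (h0 : ∀ v, 0 < y v) (hy : ∀ v, nsum G y v = rho G * y v) :
    ∃ (v : V) (S : Finset V), (∀ s ∈ S, G.Adj v s) ∧ 2 * y v ≤ rho G * ∑ s ∈ S, y s ∧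
      2 * y v ≤ rho G * (rho G * y v - ∑ s ∈ S, y s) := by
  have h2 := two_le_rho_of_leaves hG hV h4
  have hr : 0 < rho G := by linarith
  have hadj : ∀ v s, G.Adj v s → y v ≤ rho G * y s := by
    intro v s h
    rw [← hy]
    exact le_nsum (fun v => (h0 v).le) h.symm
  -- A neighbour of `v` has weight at least `y v / rho G`, so any two neighbours carry enough weight
  -- for one half.
  have hcard : ∀ v (S : Finset V), (∀ s ∈ S, G.Adj v s) → 2 ≤ S.card →
      2 * y v ≤ rho G * ∑ s ∈ S, y s := by
    intro v S hS hS2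
    rw [Finset.mul_sum]
    have h3 := Finset.sum_le_sum fun s hs => hadj v s (hS s hs)
    rw [Finset.sum_const, nsmul_eq_mul] at h3
    have h5 : (2 : ℝ) ≤ S.card := by exact_mod_cast hS2
    nlinarith [h0 v]
  have hsub : ∀ v, ∀ S ⊆ G.neighborFinset v,
      ∑ s ∈ G.neighborFinset v \ S, y s = rho G * y v - ∑ s ∈ S, y s := by
    intro v S hS
    rw [← hy, nsum_eq_sum_filter, eq_sub_iff_add_eq, Finset.sum_sdiff hS]
    congr 1
    ext; simp
  have hrest : ∀ v, ∀ S ⊆ G.neighborFinset v, S.card + 2 ≤ G.degree v →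
      2 * y v ≤ rho G * (rho G * y v - ∑ s ∈ S, y s) := by
    intro v S hS hS2
    rw [← hsub v S hS]
    refine hcard v _ (fun s hs => ?_) ?_
    · simpa using (Finset.mem_sdiff.1 hs).1
    · rw [Finset.card_sdiff_of_subset hS, SimpleGraph.card_neighborFinset_eq_degree]; omega
  rcases exists_branch hG hV h4 with ⟨w, hw⟩ | ⟨w, u, hne, hw, hu⟩
  · rw [← SimpleGraph.card_neighborFinset_eq_degree] at hw
    obtain ⟨S, hS, hS2⟩ := Finset.exists_subset_card_eq (s := G.neighborFinset w) (n := 2) (by omega)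
    rw [SimpleGraph.card_neighborFinset_eq_degree] at hw
    have hSa : ∀ s ∈ S, G.Adj w s := fun s hs => by simpa using hS hs
    exact ⟨w, S, hSa, hcard w S hSa (by omega), hrest w S hS (by omega)⟩
  · obtain ⟨p, hp⟩ := hG.connected.exists_isPath w u
    -- At the lightest vertex of a path between two branching vertices a single neighbour on the
    -- path suffices for one half, because its weight is at least `y v` and `rho G ≥ 2`. The other
    -- half is the second path neighbour, or at an end the two or more remaining neighbours.
    obtain ⟨v, hv, hmin⟩ := Finset.exists_min_image p.support.toFinset y ⟨w, by simp⟩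
    simp only [List.mem_toFinset] at hv hmin
    have hone : ∀ a, a ∈ p.support → 2 * y v ≤ rho G * y a := by
      intro a ha
      have := hmin a ha
      nlinarith [h0 a, h0 v]
    have hends : ∀ a, 3 ≤ G.degree v → a ∈ p.support → G.Adj v a →
        ∃ (v : V) (S : Finset V), (∀ s ∈ S, G.Adj v s) ∧ 2 * y v ≤ rho G * ∑ s ∈ S, y s ∧
        2 * y v ≤ rho G * (rho G * y v - ∑ s ∈ S, y s) := by
      intro a hd ha hva
      exact ⟨v, {a}, by simpa using hva, by simpa using hone a ha,
        hrest v {a} (by simpa using hva) (by simpa using hd)⟩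
    by_cases hvw : v = w
    · obtain ⟨a, ha, hwa⟩ := path_start p hne
      subst hvw
      exact hends a hw ha hwa
    · by_cases hvu : v = u
      · obtain ⟨a, ha, hua⟩ := path_start p.reverse hne.symm
        subst hvu
        exact hends a hu (by simpa using ha) hua
      · obtain ⟨a, b, hab, ha, hb, hva, hvb⟩ := path_interior hp hv hvw hvu
        refine ⟨v, {a}, by simpa using hva, by simpa using hone a ha, ?_⟩
        rw [← hsub v {a} (by simpa using hva)]
        have : y b ≤ ∑ s ∈ G.neighborFinset v \ {a}, y s :=
          Finset.single_le_sum (f := y) (fun s _ => (h0 s).le)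
            (by simp [hvb, hab.symm])
        have h6 := hone b hb
        nlinarith

theorem adm_expand {G : SimpleGraph V} (hG : G.IsTree) {C : Finset V} (hC : IsCover G C)
    (hp : 2 * C.card + 3 ≤ Fintype.card V) :
    Adm (Fintype.card V + 2) (C.card + 1) (rho G) := by
  obtain ⟨y, h0, hy⟩ := exists_perron hG.connected
  have hV : 2 ≤ Fintype.card V := by omega
  have hl := le_card_leaves hG hV hC
  have h4 : 4 ≤ (Finset.univ.filter fun x => G.degree x = 1).card := by
    have : (Cᶜ.filter fun x => G.degree x = 1).card ≤
        (Finset.univ.filter fun x => G.degree x = 1).card :=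
      Finset.card_le_card (Finset.filter_subset_filter _ (Finset.subset_univ _))
    omega
  have h2 := two_le_rho_of_leaves hG hV h4
  obtain ⟨v, S, hS, hS1, hS2⟩ := exists_split hG hV h4 h0 hy
  obtain ⟨hc, hle⟩ := rho_split_le hG.connected h0 hy (by linarith) hS hS1 hS2
  -- If `v` is covered, its copy joins the cover and the middle vertex stays out. If not, all
  -- neighbours of `v` are covered and the middle vertex joins instead. The cover grows by one
  -- either way.
  by_cases hvC : v ∈ C
  · refine Adm.of_graph hc (graft_cover (graft_cover_insert hC) ?_ ?_) (by simp) ?_ hle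
    · simpa using hvC
    · simp
    · rw [Finset.card_map, card_insert_none]
  · refine Adm.of_graph (C := insert none ((C.map Function.Embedding.some).map
      Function.Embedding.some)) hc ?_ (by simp) ?_ hle
    · have hSC : ∀ s ∈ S, s ∈ C := fun s hs => (hC (hS s hs)).resolve_left hvC
      rintro (_ | _ | a) (_ | _ | b) hab
      any_goals simp
      · exact absurd hab.1 (SimpleGraph.irrefl _)
      · rw [graft_adj_some] at hab
        obtain ⟨hab, h5, h6⟩ := hab
        rcases graft_adj_none.1 hab with h | rfl
        · exact hSC _ h
        · simp at h5
      · rw [graft_adj_some] at hab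
        obtain ⟨hab, h5, h6⟩ := hab
        rcases graft_adj_none'.1 hab with h | rfl
        · exact hSC _ h
        · simp at h6
      · exact hC hab.1.1
    · rw [Finset.card_insert_of_notMem (by simp), Finset.card_map, Finset.card_map]

/-- A connected graph can be enlarged by one vertex inside and one vertex outside the cover,
without increasing the spectral radius. -/
theorem Adm.expand {n k : ℕ} {r : ℝ} (h : Adm n k r) (hp : 2 * k + 3 ≤ n) :
    Adm (n + 2) (k + 1) r := by
  obtain ⟨G, C, hG, hC, hk, hr⟩ := h.exists_tree
  have := adm_expand hG hC (by rw [hk]; simpa using hp)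
  rw [hk, Fintype.card_fin] at this
  exact this.mono hr

/-- Deleting a vertex of degree one outside the cover. -/
theorem rho_delete_leaf {G : SimpleGraph V} (hG : G.Connected) {x : V} (hx : G.degree x = 1) :
    (G.induce {x}ᶜ).Connected ∧ rho (G.induce {x}ᶜ) < rho G := by
  have := hG.induce_compl_singleton_of_degree_eq_one hx
  exact ⟨this, rho_induce_lt hG (by simp) this⟩

theorem IsCover.induce {G : SimpleGraph V} {C : Finset V} (hC : IsCover G C) (s : Set V) :
    IsCover (G.induce s) (C.subtype (· ∈ s)) := by
  intro a b hab
  simpa using hC hab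

theorem exists_leaf {G : SimpleGraph V} (hG : G.IsTree) (hV : 2 ≤ Fintype.card V)
    {C : Finset V} (hC : IsCover G C) (hp : 2 * C.card ≤ Fintype.card V) :
    ∃ x ∉ C, G.degree x = 1 := by
  have hl := le_card_leaves hG hV hC
  obtain ⟨x, hx⟩ : (Cᶜ.filter fun x => G.degree x = 1).Nonempty := by
    rw [← Finset.card_pos]; omega
  rw [Finset.mem_filter, Finset.mem_compl] at hx
  exact ⟨x, hx⟩

theorem card_subtype_of_subset {C : Finset V} {s : Set V} [DecidablePred (· ∈ s)]
    (h : ∀ c ∈ C, c ∈ s) :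
    (C.subtype (· ∈ s)).card = C.card := by
  rw [Finset.card_subtype, Finset.filter_true_of_mem h]

theorem card_compl_singleton (x : V) : Fintype.card ({x}ᶜ : Set V) = Fintype.card V - 1 := by
  rw [Fintype.card_of_subtype (Finset.univ.erase x) (by simp),
    Finset.card_erase_of_mem (Finset.mem_univ x), Finset.card_univ]

theorem adm_delete_leaf {G : SimpleGraph V} (hG : G.IsTree) (hV : 2 ≤ Fintype.card V)
    {C : Finset V} (hC : IsCover G C) (hp : 2 * C.card ≤ Fintype.card V) :
    ∃ r' < rho G, Adm (Fintype.card V - 1) C.card r' := by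
  obtain ⟨x, hxC, hx⟩ := exists_leaf hG hV hC hp
  obtain ⟨h1, h2⟩ := rho_delete_leaf hG.connected hx
  have h3 : ∀ c ∈ C, c ∈ ({x}ᶜ : Set V) := fun c hc h => hxC (h ▸ hc)
  refine ⟨_, h2, Adm.of_graph h1 (hC.induce _) (card_compl_singleton x) ?_ le_rfl⟩
  convert card_subtype_of_subset h3

theorem Adm.delete_leaf {n k : ℕ} {r : ℝ} (h : Adm (n + 1) k r) (hp : 2 * k ≤ n + 1)
    (hn : 1 ≤ n) : ∃ r' < r, Adm n k r' := by
  obtain ⟨G, C, hG, hC, hk, hr⟩ := h.exists_tree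
  obtain ⟨r', h1, h2⟩ := adm_delete_leaf hG (by simp; omega) hC (by rw [hk]; simpa using hp)
  rw [hk, Fintype.card_fin] at h2
  exact ⟨r', h1.trans_le hr, h2⟩

theorem Adm.delete_leaf' {n k : ℕ} {r : ℝ} (h : Adm (n + 1) k r) (hp : 2 * k ≤ n + 1)
    (hn : 1 ≤ n) : Adm n k r := by
  obtain ⟨r', h1, h2⟩ := h.delete_leaf hp hn
  exact h2.mono h1.le

/-- A cover of smaller size allows for a strictly smaller spectral radius. -/
theorem Adm.succ {n k : ℕ} {r : ℝ} (h : Adm n k r) (hp : 2 * k + 3 ≤ n) :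
    ∃ r' < r, Adm n (k + 1) r' := by
  -- After expansion to order n + 2 and cover size k + 1, deleting two leaves outside the cover
  -- restores the order. The first deletion already makes the inequality strict.
  obtain ⟨r', h1, h2⟩ := (h.expand hp).delete_leaf (by omega) (by omega)
  exact ⟨r', h1, h2.delete_leaf' (by omega) (by omega)⟩

theorem Adm.of_lt {n k k' : ℕ} {r : ℝ} (h : Adm n k r) (hk : k < k') (hp : 2 * k' + 1 ≤ n) :
    ∃ r' < r, Adm n k' r' := by
  induction k', hk using Nat.le_induction with
  | base => exact h.succ (by omega)
  | succ m hm ih =>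
    obtain ⟨r', h1, h2⟩ := ih (by omega)
    obtain ⟨r'', h3, h4⟩ := h2.succ (by omega)
    exact ⟨r'', h3.trans h1, h4⟩

theorem eq_of_degree_one {G : SimpleGraph V} {x a b : V} (hx : G.degree x = 1) (ha : G.Adj x a)
    (hb : G.Adj x b) : a = b :=
  (SimpleGraph.degree_eq_one_iff_existsUnique_adj.1 hx).unique ha hb

theorem not_adj_of_degree_one {G : SimpleGraph V} (hG : G.Connected)
    (hV : 3 ≤ Fintype.card V) {a b : V} (ha : G.degree a = 1) (hb : G.degree b = 1) :
    ¬ G.Adj a b := by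
  intro hab
  have : ∃ v, v ∉ ({a, b} : Finset V) := by
    by_contra! h
    have h1 := Finset.card_le_card (Finset.subset_iff.2 fun v (_ : v ∈ Finset.univ) => h v)
    rw [Finset.card_univ] at h1
    have := Finset.card_le_two (a := a) (b := b)
    omega
  obtain ⟨v, hv⟩ := this
  obtain ⟨p⟩ := hG.preconnected a v
  obtain ⟨d, -, h1, h2⟩ := p.exists_boundary_dart (({a, b} : Finset V) : Set V) (by simp)
    (by simpa using hv)
  simp only [Finset.coe_insert, Finset.coe_singleton, Set.mem_insert_iff,
    Set.mem_singleton_iff, not_or] at h1 h2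
  rcases h1 with h1 | h1
  · exact h2.2 (eq_of_degree_one ha (h1 ▸ d.adj) hab)
  · exact h2.1 (eq_of_degree_one hb (h1 ▸ d.adj) hab.symm)

/-- A cover may be changed into one without leaves. -/
theorem exists_leafless_cover {G : SimpleGraph V} (hG : G.Connected)
    (hV : 3 ≤ Fintype.card V) {C : Finset V} (hC : IsCover G C) :
    ∃ C' : Finset V, IsCover G C' ∧ C'.card ≤ C.card ∧ ∀ x ∈ C', G.degree x ≠ 1 := by
  -- Leaves are dropped and all neighbours of leaves are taken in. The injection back into `C` fixes
  -- `u` if `u ∈ C`, and otherwise sends it to a leaf at `u`, which `C` must contain.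
  set C' := Finset.univ.filter fun u => G.degree u ≠ 1 ∧
    (u ∈ C ∨ ∃ x, G.degree x = 1 ∧ G.Adj u x) with hC'
  refine ⟨C', fun a b hab => ?_, ?_, fun x hx => (Finset.mem_filter.1 hx).2.1⟩
  · simp only [hC', Finset.mem_filter, Finset.mem_univ, true_and]
    have hn := not_adj_of_degree_one hG hV (a := a) (b := b)
    by_cases ha : G.degree a = 1
    · exact Or.inr ⟨fun hb => hn ha hb hab, Or.inr ⟨a, ha, hab.symm⟩⟩
    · by_cases hb : G.degree b = 1
      · exact Or.inl ⟨ha, Or.inr ⟨b, hb, hab⟩⟩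
      · rcases hC hab with h | h
        · exact Or.inl ⟨ha, Or.inl h⟩
        · exact Or.inr ⟨hb, Or.inl h⟩
  · have hex : ∀ u ∈ C', ∃ v ∈ C, v = u ∨ (G.degree v = 1 ∧ G.Adj u v) := by
      intro u hu
      rw [hC', Finset.mem_filter] at hu
      by_cases huC : u ∈ C
      · exact ⟨u, huC, Or.inl rfl⟩
      · obtain ⟨x, hx, hux⟩ := hu.2.2.resolve_left huC
        exact ⟨x, (hC hux).resolve_left huC, Or.inr ⟨hx, hux⟩⟩
    choose! g hg1 hg2 using hex
    refine Finset.card_le_card_of_injOn g hg1 fun u hu w hw huw => ?_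
    have h1 := (Finset.mem_filter.1 hu).2.1
    have h2 := (Finset.mem_filter.1 hw).2.1
    rcases hg2 u hu with h3 | h3 <;> rcases hg2 w hw with h4 | h4
    · rw [← h3, ← h4, huw]
    · exact absurd (by rw [← h3, huw]; exact h4.1) h1
    · exact absurd (by rw [← h4, ← huw]; exact h3.1) h2
    · exact eq_of_degree_one h3.1 h3.2.symm (huw ▸ h4.2.symm)

theorem degree_eq_two_iff {G : SimpleGraph V} {b x : V} (h : G.degree b = 2) (hx : G.Adj b x) :
    ∃ z, z ≠ x ∧ G.Adj b z ∧ ∀ w, G.Adj b w → w = x ∨ w = z := by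
  rw [← SimpleGraph.card_neighborFinset_eq_degree, Finset.card_eq_two] at h
  obtain ⟨u, v, huv, h⟩ := h
  have hmem : ∀ w, G.Adj b w ↔ w = u ∨ w = v := by
    intro w
    rw [← SimpleGraph.mem_neighborFinset, h]
    simp
  rcases (hmem x).1 hx with rfl | rfl
  · exact ⟨v, huv.symm, (hmem v).2 (Or.inr rfl), fun w hw => (hmem w).1 hw⟩
  · exact ⟨u, huv, (hmem u).2 (Or.inl rfl), fun w hw => ((hmem w).1 hw).symm⟩

theorem adm_delete_vertex {G : SimpleGraph V} (hG : G.Connected) {C : Finset V}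
    (hC : IsCover G C) {x : V} (hx : G.degree x = 1) (hxC : x ∈ C) :
    ∃ r < rho G, Adm (Fintype.card V - 1) (C.card - 1) r := by
  obtain ⟨h1, h2⟩ := rho_delete_leaf hG hx
  refine ⟨_, h2, Adm.of_graph h1 (hC.induce _) (card_compl_singleton x) ?_ le_rfl⟩
  rw [Finset.card_subtype, ← Finset.card_erase_of_mem hxC]
  congr 1
  ext w
  simp [and_comm]

/-- Deleting the last two vertices of a pendant path. -/
theorem adm_delete_two {G : SimpleGraph V} (hG : G.Connected) {C : Finset V}
    (hC : IsCover G C) {x b : V} (hx : G.degree x = 1) (hxC : x ∉ C) (hxb : G.Adj x b)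
    (hb : G.degree b = 2) :
    ∃ r < rho G, Adm (Fintype.card V - 2) (C.card - 1) r := by
  obtain ⟨h1, h2⟩ := rho_delete_leaf hG hx
  have hbx : b ∈ ({x}ᶜ : Set V) := hxb.ne'
  have hbC : b ∈ C := (hC hxb).resolve_left hxC
  have hd : (G.induce ({x}ᶜ : Set V)).degree ⟨b, hbx⟩ = 1 := by
    rw [SimpleGraph.degree_eq_one_iff_existsUnique_adj]
    obtain ⟨z, hzx, hbz, hz⟩ := degree_eq_two_iff hb hxb.symm
    refine ⟨⟨z, hzx⟩, hbz, fun w hw => ?_⟩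
    exact Subtype.ext ((hz w hw).resolve_left w.2)
  obtain ⟨r, hr, hadm⟩ := adm_delete_vertex h1 (hC.induce _) hd (by simpa using hbC)
  have h3 : ∀ c ∈ C, c ∈ ({x}ᶜ : Set V) := fun c hc h => hxC (h ▸ hc)
  refine ⟨r, hr.trans h2, ?_⟩
  convert hadm using 1
  · rw [card_compl_singleton, Nat.sub_sub]
  · congr 1
    symm
    convert card_subtype_of_subset h3

/-! ### Structure of minimal graphs for n ≥ 2k + 3. -/

/-- The structure of a graph of minimum spectral radius among the graphs with a vertex cover of
given size. -/
structure IsGood (G : SimpleGraph V) (C : Finset V) : Prop where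
  tree : G.IsTree
  cover : IsCover G C
  leafless : ∀ x ∈ C, 2 ≤ G.degree x
  indep : ∀ a ∈ C, ∀ b ∈ C, ¬ G.Adj a b
  degree_le : ∀ x ∉ C, G.degree x ≤ 2

theorem isTree_of_minimal {G : SimpleGraph V} (hG : G.Connected) {C : Finset V}
    (hC : IsCover G C) (hmin : ∀ r, Adm (Fintype.card V) C.card r → rho G ≤ r) : G.IsTree := by
  obtain ⟨T, hT, hTt⟩ := hG.exists_isTree_le
  rcases hT.eq_or_lt with rfl | hlt
  · exact hTt
  · exact absurd (hmin _ (Adm.of_graph hTt.connected (hC.mono hT) rfl rfl le_rfl))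
      (not_le.2 (rho_strictMono hTt.connected hlt))

/-- This supplies the hypothesis of `rho_subdivide_le` at the lighter end of an edge. Consider a
violation with `y a` minimal. If `a` has degree at least three, its neighbours other than `b` weigh
too much for a violation. If it has degree two, its other neighbour `u` is lighter and the edge from
`u` to `a` violates the inequality too, unless `u` is a leaf, which `hpend` excludes. -/
theorem no_flat_edge {G : SimpleGraph V} {y : V → ℝ} (h0 : ∀ v, 0 < y v)
    (hy : ∀ v, nsum G y v = rho G * y v) (h2 : 2 ≤ rho G)
    (hpend : ∀ u a, G.degree u = 1 → G.Adj u a → 3 ≤ G.degree a) {a b : V} (hab : G.Adj a b)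
    (hd : 2 ≤ G.degree a) (hle : y a ≤ y b) : y a ^ 2 ≤ y b * (rho G * y a - y b) := by
  by_contra! hF
  set Z : Finset V := Finset.univ.filter fun a => 2 ≤ G.degree a ∧ ∃ b, G.Adj a b ∧ y a ≤ y b ∧
    y b * (rho G * y a - y b) < y a ^ 2 with hZ
  obtain ⟨a, ha, hmin⟩ := Finset.exists_min_image Z y
    ⟨a, Finset.mem_filter.2 ⟨Finset.mem_univ _, hd, b, hab, hle, hF⟩⟩
  rw [hZ, Finset.mem_filter] at ha
  obtain ⟨-, hd, b, hab, hle, hF⟩ := ha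
  have hadj : ∀ u, G.Adj a u → y a ≤ rho G * y u := by
    intro u hu
    rw [← hy]
    exact le_nsum (fun v => (h0 v).le) hu.symm
  have ha0 := h0 a
  have hb0 := h0 b
  have hd2 : G.degree a = 2 := by
    by_contra hne
    have hd3 : 2 < (G.neighborFinset a).card := by
      rw [SimpleGraph.card_neighborFinset_eq_degree]; omega
    have : 1 < ((G.neighborFinset a).erase b).card := by
      rw [Finset.card_erase_of_mem (by simpa using hab)]; omega
    obtain ⟨u, hu, w, hw, huw⟩ := Finset.one_lt_card.1 this
    simp only [Finset.mem_erase, SimpleGraph.mem_neighborFinset] at hu hw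
    have hs : y b + y u + y w ≤ rho G * y a := by
      rw [← hy]
      have := sum_le_nsum (G := G) (fun v => (h0 v).le) (u := a) (s := {b, u, w})
        (by simp [hab, hu, hw])
      rw [Finset.sum_insert (by simp [hu.1.symm, hw.1.symm]), Finset.sum_pair huw] at this
      linarith
    have h3 := hadj u hu.2
    have h4 := hadj w hw.2
    set s := rho G * y a - y b with hsd
    have h5 : 2 * y a ≤ rho G * s := by nlinarith
    have h6 : 2 * y a ≤ rho G * y b := by nlinarith
    -- Expanded, this product gives ρ² (y b) s ≥ (2ρ² - 4)(y a)², which is at least ρ² (y a)² since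
    -- ρ ≥ 2; this contradicts `hF`.
    have h7 : 0 ≤ (rho G * s - 2 * y a) * (rho G * y b - 2 * y a) :=
      mul_nonneg (by linarith) (by linarith)
    have h8 : s + y b = rho G * y a := by rw [hsd]; ring
    have h9 : rho G * s + rho G * y b = rho G * (rho G * y a) := by rw [← h8]; ring
    have h10 : (rho G * s - 2 * y a) * (rho G * y b - 2 * y a) =
        rho G ^ 2 * (y b * s) - 2 * rho G ^ 2 * y a ^ 2 + 4 * y a ^ 2 := by
      linear_combination (-2 * y a) * h9
    have h11 : rho G ^ 2 * (y b * s) < rho G ^ 2 * y a ^ 2 :=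
      mul_lt_mul_of_pos_left hF (by positivity)
    nlinarith [mul_pos ha0 ha0]
  obtain ⟨u, hub, hau, hall⟩ := degree_eq_two_iff hd2 hab
  have hsum : rho G * y a = y b + y u := by
    rw [← hy, nsum_eq_sum_filter]
    have : Finset.univ.filter (G.Adj a) = {b, u} := by
      ext w
      simp only [Finset.mem_filter, Finset.mem_univ, true_and, Finset.mem_insert,
        Finset.mem_singleton]
      constructor
      · exact hall w
      · rintro (rfl | rfl) <;> assumption
    rw [this, Finset.sum_pair hub.symm]
  rw [hsum] at hF
  have hF' : y b * y u < y a ^ 2 := by linarith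
  have hu0 := h0 u
  have hua : y u < y a := by nlinarith
  by_cases hdu : 2 ≤ G.degree u
  · have : u ∈ Z := by
      rw [hZ, Finset.mem_filter]
      refine ⟨Finset.mem_univ _, hdu, a, hau.symm, hua.le, ?_⟩
      have : rho G * y a * y u = (y b + y u) * y u := by rw [hsum]
      nlinarith
    exact absurd (hmin u this) (not_le.2 hua)
  · have h1 : G.degree u = 1 := by
      have : 0 < G.degree u := by
        rw [SimpleGraph.degree_pos_iff_exists_adj]; exact ⟨a, hau.symm⟩
      omega
    have := hpend u a h1 hau.symm
    omega

/-- Each forbidden feature admits a surgery that adds a vertex at fixed cover size without raising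
`rho`. A leaf can then be deleted, producing a graph with the original parameters and strictly
smaller `rho`. -/
theorem exists_isGood_of_minimal {G : SimpleGraph V} (hG : G.Connected) {C : Finset V}
    (hC : IsCover G C) (hp : 2 * C.card + 3 ≤ Fintype.card V)
    (hmin : ∀ r, Adm (Fintype.card V) C.card r → rho G ≤ r) :
    ∃ C' : Finset V, IsGood G C' ∧ C'.card = C.card ∧
      ∀ x b, G.degree x = 1 → G.Adj x b → 3 ≤ G.degree b := by
  have hT := isTree_of_minimal hG hC hmin
  have hne : C.card ≠ 0 := by
    intro h0
    have : Nontrivial V := Fintype.one_lt_card_iff_nontrivial.1 (by omega)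
    obtain ⟨a⟩ := hG.nonempty
    obtain ⟨b, hab⟩ := hG.preconnected.exists_adj_of_nontrivial a
    rw [Finset.card_eq_zero] at h0
    subst h0
    simpa using hC hab
  obtain ⟨C', hC', hcard, hleaf⟩ := exists_leafless_cover hG (by omega) hC
  have hcard' : C'.card = C.card := by
    by_contra hne
    obtain ⟨r, h1, h2⟩ := (Adm.of_graph hG hC' rfl rfl le_rfl).of_lt
      (lt_of_le_of_ne hcard hne) (by omega)
    exact absurd (hmin r h2) (not_le.2 h1)
  have hcontra : ∀ r, r ≤ rho G → ¬ Adm (Fintype.card V + 1) C.card r := by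
    intro r hr h
    obtain ⟨r', h1, h2⟩ := h.delete_leaf (by omega) (by omega)
    exact absurd (hmin r' h2) (not_le.2 (h1.trans_le hr))
  have hdeg : ∀ x, 1 ≤ G.degree x := one_le_degree hG (by omega)
  -- Removing a leaf and its neighbour of degree two gives order n - 2 and cover size k - 1 with
  -- strictly smaller `rho`, and expansion restores both parameters. The condition for expanding is
  -- again 2k + 3 ≤ n.
  have hpend : ∀ x b, G.degree x = 1 → G.Adj x b → 3 ≤ G.degree b := by
    intro x b hx hxb
    by_contra hb
    have hxC : x ∉ C' := fun h => hleaf x h hx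
    have hbC : b ∈ C' := (hC' hxb).resolve_left hxC
    have := hleaf b hbC
    have := hdeg b
    obtain ⟨r, h1, h2⟩ := adm_delete_two hG hC' hx hxC hxb (by omega)
    have h3 := h2.expand (by omega)
    rw [hcard', Nat.sub_add_cancel (by omega), Nat.sub_add_cancel (by omega)] at h3
    exact absurd (hmin r h3) (not_le.2 h1)
  obtain ⟨y, h0, hy⟩ := exists_perron hG
  have hl := le_card_leaves hT (by omega) hC'
  have h4 : 4 ≤ (Finset.univ.filter fun x => G.degree x = 1).card := by
    have : (C'ᶜ.filter fun x => G.degree x = 1).card ≤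
        (Finset.univ.filter fun x => G.degree x = 1).card :=
      Finset.card_le_card (Finset.filter_subset_filter _ (Finset.subset_univ _))
    omega
  have h2 := two_le_rho_of_leaves hT (by omega) h4
  have hl2 : ∀ x ∈ C', 2 ≤ G.degree x := by
    intro x hx
    have := hleaf x hx
    have := hdeg x
    omega
  refine ⟨C', ⟨hT, hC', hl2, ?_, ?_⟩, hcard', hpend⟩
  · have key : ∀ a ∈ C', ∀ b ∈ C', G.Adj a b → y a ≤ y b → False := by
      intro a ha b hb hab hle
      have h5 := no_flat_edge h0 hy h2 hpend hab (hl2 a ha) hle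
      have h6 := rho_subdivide_le hT h0 hy hab h5
      refine hcontra _ h6 (Adm.of_graph
        (graft_connected hG (by simpa using hab) (by simpa using hab.ne) (Or.inl rfl))
        (graft_cover hC' (by simpa using hb) ha) (by simp) (by simpa using hcard') le_rfl)
    intro a ha b hb hab
    rcases le_total (y a) (y b) with h | h
    · exact key a ha b hb hab h
    · exact key b hb a ha hab.symm h
  · intro x hx
    by_contra hd
    -- The lightest neighbour `c` is the one to be shared; `b` moves to the new vertex and `d` stays
    -- at `x`. Since `x` is uncovered, `b` and `c` are covered, and the new vertex need not be.
    obtain ⟨c, hc, hcmin⟩ := Finset.exists_min_image (G.neighborFinset x) y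
      (by rw [← Finset.card_pos, SimpleGraph.card_neighborFinset_eq_degree]; omega)
    have : 1 < ((G.neighborFinset x).erase c).card := by
      rw [Finset.card_erase_of_mem hc, SimpleGraph.card_neighborFinset_eq_degree]; omega
    obtain ⟨b, hb, d, hd, hbd⟩ := Finset.one_lt_card.1 this
    simp only [Finset.mem_erase, SimpleGraph.mem_neighborFinset] at hb hd hc hcmin
    have hxC : ∀ w, G.Adj x w → w ∈ C' := fun w hw => (hC' hw).resolve_left hx
    have h6 := rho_share_le hT h0 hy hc hb.2 hd.2 hb.1.symm hd.1.symm hbd (hcmin b hb.2)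
      (hcmin d hd.2)
    exact hcontra _ h6 (Adm.of_graph
      (graft_connected hG (by simpa using hb.2) (by simpa using hb.1.symm) (Or.inr hc))
      (graft_cover hC' (by simpa using hxC b hb.2) (hxC c hc)) (by simp)
      (by simpa using hcard') le_rfl)

/-! ### From vertex covers back to the independence number. -/

theorem IsCover.isIndepSet_compl {G : SimpleGraph V} {C : Finset V} (hC : IsCover G C) :
    G.IsIndepSet (Cᶜ : Finset V) := by
  intro a ha b hb _ hab
  rw [Finset.coe_compl, Set.mem_compl_iff, Finset.mem_coe] at ha hb
  exact (hC hab).elim ha hb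

theorem IsCover.le_indepNum {G : SimpleGraph V} {C : Finset V} (hC : IsCover G C) :
    Fintype.card V - C.card ≤ G.indepNum := by
  rw [← Finset.card_compl]
  exact hC.isIndepSet_compl.card_le_indepNum

theorem indepNum_le_of_forall {G : SimpleGraph V} {m : ℕ}
    (h : ∀ s : Finset V, G.IsIndepSet s → s.card ≤ m) : G.indepNum ≤ m := by
  obtain ⟨s, hs⟩ := G.exists_isNIndepSet_indepNum
  rw [← hs.card_eq]
  exact h s hs.isIndepSet

theorem exists_cover_of_indepNum (G : SimpleGraph V) :
    ∃ C : Finset V, IsCover G C ∧ C.card = Fintype.card V - G.indepNum := by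
  obtain ⟨s, hs⟩ := G.exists_isNIndepSet_indepNum
  refine ⟨sᶜ, fun a b hab => ?_, by rw [Finset.card_compl, hs.card_eq]⟩
  by_contra! h
  rw [Finset.mem_compl, Finset.mem_compl, not_not, not_not] at h
  exact hs.isIndepSet h.1 h.2 hab.ne hab

theorem indepNum_le_card (G : SimpleGraph V) : G.indepNum ≤ Fintype.card V :=
  indepNum_le_of_forall fun s _ => s.card_le_univ

/-- Let N be the set of neighbours of J ∩ C. Degrees are at least two in C and at most two outside,
so counting the edges between J ∩ C and N gives |J ∩ C| ≤ |N|. As N avoids both J and C, exchanging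
J ∩ C for N yields a subset of the complement of C at least as large as J. -/
theorem IsGood.indepNum {G : SimpleGraph V} {C : Finset V} (h : IsGood G C) :
    G.indepNum = Fintype.card V - C.card := by
  refine le_antisymm (indepNum_le_of_forall fun J hJ => ?_) h.cover.le_indepNum
  set N : Finset V := Finset.univ.filter fun x => ∃ a ∈ J ∩ C, G.Adj a x with hN
  have hNC : ∀ x ∈ N, x ∉ C := by
    intro x hx hxC
    obtain ⟨a, ha, hax⟩ := (Finset.mem_filter.1 hx).2
    exact h.indep a (Finset.mem_inter.1 ha).2 x hxC hax
  have h1 : (J ∩ C).card * 2 ≤ N.card * 2 := by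
    refine Finset.card_mul_le_card_mul G.Adj (fun a ha => ?_) (fun x hx => ?_)
    · refine (h.leafless a (Finset.mem_inter.1 ha).2).trans ?_
      rw [← G.card_neighborFinset_eq_degree]
      refine Finset.card_le_card fun x hx => ?_
      rw [G.mem_neighborFinset] at hx
      simp only [Finset.mem_bipartiteAbove, hN, Finset.mem_filter, Finset.mem_univ, true_and]
      exact ⟨⟨a, ha, hx⟩, hx⟩
    · refine le_trans ?_ (h.degree_le x (hNC x hx))
      rw [← G.card_neighborFinset_eq_degree]
      refine Finset.card_le_card fun a ha => ?_
      rw [Finset.mem_bipartiteBelow] at ha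
      exact (G.mem_neighborFinset _ _).2 ha.2.symm
  have h2 : J \ C ∪ N ⊆ Cᶜ := by
    intro x hx
    rw [Finset.mem_compl]
    rcases Finset.mem_union.1 hx with hx | hx
    · exact (Finset.mem_sdiff.1 hx).2
    · exact hNC x hx
  have h3 : Disjoint (J \ C) N := by
    rw [Finset.disjoint_left]
    intro x hx hxN
    obtain ⟨a, ha, hax⟩ := (Finset.mem_filter.1 hxN).2
    exact hJ (Finset.mem_inter.1 ha).1 (Finset.mem_sdiff.1 hx).1 hax.ne hax
  have h4 := Finset.card_le_card h2
  rw [Finset.card_union_of_disjoint h3, Finset.card_compl] at h4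
  have h5 := Finset.card_inter_add_card_sdiff J C
  omega

theorem indepNum_le_of_iso {G : SimpleGraph V} {H : SimpleGraph W} (φ : G ≃g H) :
    G.indepNum ≤ H.indepNum := by
  refine indepNum_le_of_forall fun s hs => ?_
  have : H.IsIndepSet (s.map φ.toEquiv.toEmbedding : Finset W) := by
    intro a ha b hb _ hab
    rw [Finset.mem_coe, Finset.mem_map] at ha hb
    obtain ⟨a, ha, rfl⟩ := ha
    obtain ⟨b, hb, rfl⟩ := hb
    have : G.Adj a b := φ.map_adj_iff.1 hab
    exact hs ha hb this.ne this
  simpa using this.card_le_indepNum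

theorem InClass.of_iso {n α : ℕ} {G : SimpleGraph V} {H : SimpleGraph W} (h : InClass n α G)
    (φ : G ≃g H) : InClass n α H :=
  ⟨φ.connected_iff.1 h.connected, by rw [← h.order, Fintype.card_congr φ.toEquiv],
    by rw [← h.indep]; exact le_antisymm (indepNum_le_of_iso φ.symm) (indepNum_le_of_iso φ)⟩

/-- The minimum is over all graphs of the class, on whatever vertex set. -/
theorem IsMinimizer.rho_le {n α : ℕ} {T : SimpleGraph V} (hT : IsMinimizer n α T)
    {H : SimpleGraph W} (h : InClass n α H) : rho T ≤ rho H := by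
  obtain ⟨e⟩ : Nonempty (W ≃ Fin n) := ⟨Fintype.equivFinOfCardEq h.order⟩
  let φ := SimpleGraph.Iso.map e H
  have h1 := h.of_iso φ
  exact (hT.le _ h1).trans (rho_le_of_iso h.connected φ.symm)

/-- Used with a spanning tree of `T`: once the tree is known to lie in the class, `T` itself is that
tree. -/
theorem IsMinimizer.eq_of_le {n α : ℕ} {T T₀ : SimpleGraph V} (hT : IsMinimizer n α T)
    (h : InClass n α T₀) (hle : T₀ ≤ T) : T₀ = T := by
  rcases hle.eq_or_lt with h1 | hlt
  · exact h1
  · exact absurd (hT.rho_le h) (not_le.2 (rho_strictMono h.connected hlt))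

theorem exists_minimal_cover {n k : ℕ} {r : ℝ} (h : Adm n k r) :
    ∃ (G : SimpleGraph (Fin n)) (C : Finset (Fin n)), G.Connected ∧ IsCover G C ∧ C.card = k ∧
      ∀ r, Adm n k r → rho G ≤ r := by
  set S : Set (SimpleGraph (Fin n)) :=
    {G | ∃ C : Finset (Fin n), G.Connected ∧ IsCover G C ∧ C.card = k} with hS
  obtain ⟨G, C, h1, h2, h3, -⟩ := h
  obtain ⟨M, ⟨C, h1, h2, h3⟩, hM⟩ :=
    Set.exists_min_image S rho (Set.toFinite S) ⟨G, C, h1, h2, h3⟩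
  refine ⟨M, C, h1, h2, h3, fun r hr => ?_⟩
  obtain ⟨H, C', h1, h2, h3, h4⟩ := hr
  exact (hM H ⟨C', h1, h2, h3⟩).trans h4

theorem InClass.exists_cover {n α : ℕ} {G : SimpleGraph V} (h : InClass n α G) :
    ∃ C : Finset V, IsCover G C ∧ C.card = n - α := by
  obtain ⟨C, h1, h2⟩ := exists_cover_of_indepNum G
  exact ⟨C, h1, by rw [h2, h.order, h.indep]⟩

theorem IsGood.inClass {n α : ℕ} {G : SimpleGraph V} {C : Finset V} (h : IsGood G C)
    (hn : Fintype.card V = n) (hα : α ≤ n) (hC : C.card = n - α) : InClass n α G :=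
  ⟨h.tree.connected, hn, by rw [h.indepNum, hn, hC]; omega⟩

/-- A minimal graph M for the cover problem has a good cover, so its independence number is exactly
α and it competes with T. Hence T is minimal for the cover problem too, and the structure theorem
applies to T itself. -/
theorem IsMinimizer.exists_isGood {n α : ℕ} {T : SimpleGraph V} (hT : IsMinimizer n α T)
    (hp : 2 * (n - α) + 3 ≤ n) :
    ∃ C : Finset V, IsGood T C ∧ C.card = n - α ∧
      ∀ x b, T.degree x = 1 → T.Adj x b → 3 ≤ T.degree b := by
  have hα : α ≤ n := by
    have := indepNum_le_card T
    rwa [hT.mem.indep, hT.mem.order] at this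
  obtain ⟨C, hC, hk⟩ := hT.mem.exists_cover
  obtain ⟨M, D, h1, h2, h3, h4⟩ := exists_minimal_cover
    (Adm.of_graph hT.mem.connected hC hT.mem.order hk le_rfl)
  obtain ⟨D', h5, h6, -⟩ := exists_isGood_of_minimal h1 h2 (by simpa [h3] using hp)
    (by simpa [h3] using h4)
  have h7 := hT.rho_le (h5.inClass (by simp) hα (h6.trans h3))
  have h8 := exists_isGood_of_minimal hT.mem.connected hC (by rwa [hk, hT.mem.order])
    (fun r hr => h7.trans (h4 r (by rwa [hT.mem.order, hk] at hr)))
  rwa [hk] at h8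

/-! ### Recognising paths; the graphs D_n and their invariants. -/

/-- A bijective homomorphism from a connected graph to a tree is an isomorphism. -/
theorem adj_iff_of_hom {G : SimpleGraph V} {H : SimpleGraph W} (hG : G.Connected)
    (hH : H.IsTree) (f : V ≃ W) (h : ∀ a b, G.Adj a b → H.Adj (f a) (f b)) (a b : V) :
    H.Adj (f a) (f b) ↔ G.Adj a b := by
  have h1 : (G.map f.toEmbedding).Connected := (SimpleGraph.Iso.map f G).connected_iff.1 hG
  have h2 : G.map f.toEmbedding ≤ H := by
    rintro _ _ ⟨-, a, b, hab, rfl, rfl⟩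
    exact h a b hab
  have h3 := (SimpleGraph.isTree_iff_minimal_connected.1 hH).2 h1 h2
  refine ⟨fun hab => ?_, h a b⟩
  obtain ⟨-, a', b', hab, ha, hb⟩ := h3 hab
  rw [← f.injective ha, ← f.injective hb]
  exact hab

def isoOfHom {G : SimpleGraph V} {H : SimpleGraph W} (hG : G.Connected)
    (hH : H.IsTree) (f : V ≃ W) (h : ∀ a b, G.Adj a b → H.Adj (f a) (f b)) : G ≃g H where
  toEquiv := f
  map_rel_iff' := fun {a b} => adj_iff_of_hom hG hH f h a b

theorem mem_of_closed {G : SimpleGraph V} (hG : G.Connected) {s : Set V} {u : V} (hu : u ∈ s)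
    (hs : ∀ a ∈ s, ∀ b, G.Adj a b → b ∈ s) (v : V) : v ∈ s := by
  obtain ⟨p⟩ := hG.preconnected u v
  induction p with
  | nil => exact hu
  | cons h _ ih => exact ih (hs _ hu _ h)

theorem eq_or_eq_of_degree_le_two {G : SimpleGraph V} {x a b c : V} (hx : G.degree x ≤ 2)
    (hab : a ≠ b) (ha : G.Adj x a) (hb : G.Adj x b) (hc : G.Adj x c) : c = a ∨ c = b := by
  by_contra! h
  have : ({a, b, c} : Finset V) ⊆ G.neighborFinset x := by
    intro z hz
    simp only [Finset.mem_insert, Finset.mem_singleton] at hz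
    rcases hz with rfl | rfl | rfl <;> simpa
  have := Finset.card_le_card this
  rw [G.card_neighborFinset_eq_degree, Finset.card_insert_of_notMem, Finset.card_pair h.2.symm]
    at this
  · omega
  · simp [hab, h.1.symm]

/-- A tree of maximum degree at most two is a path. -/
theorem nonempty_iso_pathGraph {G : SimpleGraph V} (hG : G.IsTree) (hd : ∀ v, G.degree v ≤ 2) :
    Nonempty (SimpleGraph.pathGraph (Fintype.card V) ≃g G) := by
  have := hG.connected.nonempty
  obtain ⟨u, v, p, hp, hmax⟩ := SimpleGraph.Walk.exists_isPath_forall_isPath_length_le_length G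
  -- A longest path is closed under adjacency: its ends cannot be extended, and its inner vertices
  -- have no neighbours to spare.
  have hcl : ∀ x ∈ {x | x ∈ p.support}, ∀ w, G.Adj x w → w ∈ {x | x ∈ p.support} := by
    intro x hx w hxw
    rw [Set.mem_ofPred_eq] at hx ⊢
    by_contra hw
    by_cases hxu : x = u
    · subst hxu
      have := hmax _ _ (p.cons hxw.symm) (hp.cons hw)
      rw [SimpleGraph.Walk.length_cons] at this
      omega
    by_cases hxv : x = v
    · subst hxv
      have := hmax _ _ (p.concat hxw) (hp.concat hw hxw)
      rw [SimpleGraph.Walk.length_concat] at this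
      omega
    obtain ⟨a, b, hab, ha, hb, hxa, hxb⟩ := path_interior hp hx hxu hxv
    rcases eq_or_eq_of_degree_le_two (hd x) hab hxa hxb hxw with rfl | rfl
    · exact hw ha
    · exact hw hb
  have hall : ∀ x, x ∈ p.support := mem_of_closed hG.connected (s := {x | x ∈ p.support})
    p.start_mem_support hcl
  have hbij : Function.Bijective fun i : Fin (p.length + 1) => p.getVert i := by
    constructor
    · intro i j hij
      exact Fin.ext (hp.getVert_injOn (by simp; omega) (by simp; omega) hij)
    · intro x
      obtain ⟨i, hi, hil⟩ := SimpleGraph.Walk.mem_support_iff_exists_getVert.1 (hall x)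
      exact ⟨⟨i, by omega⟩, hi⟩
  have hcard : Fintype.card V = p.length + 1 := by
    rw [← Fintype.card_fin (p.length + 1)]
    exact (Fintype.card_of_bijective hbij).symm
  rw [hcard]
  refine ⟨isoOfHom (SimpleGraph.pathGraph_connected _) hG (Equiv.ofBijective _ hbij) ?_⟩
  intro i j hij
  rw [SimpleGraph.pathGraph_adj] at hij
  simp only [Equiv.ofBijective_apply]
  rcases hij with h | h
  · rw [← h]; exact p.adj_getVert_succ (by omega)
  · rw [← h]; exact (p.adj_getVert_succ (by omega)).symm

theorem dGraph_adj {n : ℕ} (hn : 4 ≤ n) {i j : Fin n} : (dGraph n).Adj i j ↔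
    ((i.val + 1 = j.val ∧ j.val + 1 < n) ∨ (i.val = 1 ∧ j.val + 1 = n)) ∨
    ((j.val + 1 = i.val ∧ i.val + 1 < n) ∨ (j.val = 1 ∧ i.val + 1 = n)) := by
  rw [dGraph, SimpleGraph.fromRel_adj, ne_eq, Fin.ext_iff]
  omega

theorem dGraph_connected {n : ℕ} (hn : 4 ≤ n) : (dGraph n).Connected := by
  have : Nonempty (Fin n) := ⟨⟨0, by omega⟩⟩
  have key : ∀ m : ℕ, ∀ h : m + 1 < n, (dGraph n).Reachable ⟨0, by omega⟩ ⟨m, by omega⟩ := by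
    intro m
    induction m with
    | zero => intro h; exact SimpleGraph.Reachable.refl _
    | succ m ih =>
      intro h
      refine (ih (by omega)).trans (SimpleGraph.Adj.reachable ?_)
      exact (dGraph_adj hn).2 (Or.inl (Or.inl ⟨rfl, h⟩))
  have key' : ∀ i : Fin n, (dGraph n).Reachable ⟨0, by omega⟩ i := by
    intro i
    by_cases h : i.val + 1 < n
    · exact key i h
    · refine (key 1 (by omega)).trans (SimpleGraph.Adj.reachable ?_)
      exact (dGraph_adj hn).2 (Or.inl (Or.inr ⟨rfl, by omega⟩))
  exact ⟨fun i j => (key' i).symm.trans (key' j)⟩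

theorem card_le_of_injOn_lt {n m : ℕ} {s : Finset (Fin n)} (f : Fin n → ℕ)
    (hf : ∀ i, f i < m) (h : ∀ i ∈ s, ∀ j ∈ s, f i = f j → i = j) : s.card ≤ m := by
  have := Finset.card_le_card_of_injOn (t := Finset.range m) f (s := s)
    (fun i _ => by simpa using hf i) (fun i hi j hj => h i hi j hj)
  simpa using this

theorem card_filter_even (m : ℕ) :
    ((Finset.univ : Finset (Fin m)).filter fun i => i.val % 2 = 0).card = (m + 1) / 2 := by
  induction m with
  | zero => rfl
  | succ m ih =>
    have h : ((Finset.univ : Finset (Fin (m + 1))).filter fun i => i.val % 2 = 0).card =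
      ((Finset.univ : Finset (Fin m)).filter fun i => i.val % 2 = 0).card +
        if m % 2 = 0 then 1 else 0 := by
      rw [Finset.card_filter, Finset.card_filter, Fin.sum_univ_castSucc]
      simp
    rw [h, ih]
    split_ifs <;> omega

theorem indepNum_pathGraph (n : ℕ) : (SimpleGraph.pathGraph n).indepNum = (n + 1) / 2 := by
  refine le_antisymm (indepNum_le_of_forall fun s hs => ?_) ?_
  · refine card_le_of_injOn_lt (fun i => i.val / 2) (fun i => by omega) fun i hi j hj hij => ?_
    by_contra hne
    refine hs hi hj hne ?_
    rw [SimpleGraph.pathGraph_adj]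
    rw [Fin.ext_iff] at hne
    omega
  · rw [← card_filter_even]
    refine SimpleGraph.IsIndepSet.card_le_indepNum fun i hi j hj _ hij => ?_
    simp only [Finset.coe_filter, Set.mem_ofPred_eq] at hi hj
    rw [SimpleGraph.pathGraph_adj] at hij
    omega

theorem indepNum_dGraph {k : ℕ} (hk : 1 ≤ k) : (dGraph (2 * k + 2)).indepNum = k + 2 := by
  refine le_antisymm (indepNum_le_of_forall fun s hs => ?_) ?_
  -- The fibres of this map are k + 2 cliques: {0}, the edges {2j - 1, 2j}, and {2k + 1}.
  · refine card_le_of_injOn_lt (fun i => (i.val + 1) / 2) (fun i => by omega)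
      fun i hi j hj hij => ?_
    by_contra hne
    refine hs hi hj hne ?_
    rw [dGraph_adj (by omega)]
    rw [Fin.ext_iff] at hne
    have := i.isLt
    have := j.isLt
    omega
  · have h1 := card_filter_even (2 * k + 2)
    have h2 : (insert (Fin.last (2 * k + 1))
        ((Finset.univ : Finset (Fin (2 * k + 2))).filter fun i => i.val % 2 = 0)).card = k + 2 := by
      rw [Finset.card_insert_of_notMem, h1]
      · omega
      · simp
    rw [← h2]
    refine SimpleGraph.IsIndepSet.card_le_indepNum fun i hi j hj _ hij => ?_
    simp only [Finset.coe_insert, Finset.coe_filter, Set.mem_insert_iff, Set.mem_ofPred_eq,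
      Finset.mem_univ, true_and, Fin.ext_iff, Fin.val_last] at hi hj
    rw [dGraph_adj (by omega)] at hij
    omega

theorem dGraph_inClass {k : ℕ} (hk : 1 ≤ k) : InClass (2 * k + 2) (k + 2) (dGraph (2 * k + 2)) :=
  ⟨dGraph_connected (by omega), by simp, indepNum_dGraph hk⟩

theorem pathGraph_inClass {n : ℕ} (hn : 1 ≤ n) :
    InClass n ((n + 1) / 2) (SimpleGraph.pathGraph n) := by
  obtain ⟨m, rfl⟩ : ∃ m, n = m + 1 := ⟨n - 1, by omega⟩
  exact ⟨SimpleGraph.pathGraph_connected _, by simp, indepNum_pathGraph _⟩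

theorem nsum_le_sum {G : SimpleGraph V} {f : V → ℝ} (hf : ∀ v, 0 ≤ f v) {u : V} {s : Finset V}
    (hs : ∀ w, G.Adj u w → w ∈ s) : nsum G f u ≤ ∑ w ∈ s, f w := by
  rw [nsum_eq_sum_filter]
  exact Finset.sum_le_sum_of_subset_of_nonneg (fun w hw => hs w (by simpa using hw))
    fun w _ _ => hf w

theorem sum_insert_le' {f : V → ℝ} (hf : ∀ v, 0 ≤ f v) (a : V) (s : Finset V) :
    ∑ w ∈ insert a s, f w ≤ f a + ∑ w ∈ s, f w := by
  by_cases h : a ∈ s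
  · rw [Finset.insert_eq_of_mem h]; linarith [hf a]
  · rw [Finset.sum_insert h]

theorem nsum_le_one {G : SimpleGraph V} {f : V → ℝ} (hf : ∀ v, 0 ≤ f v) {u : V} (a : V)
    (hs : ∀ w, G.Adj u w → w = a) : nsum G f u ≤ f a := by
  simpa using nsum_le_sum hf (s := {a}) (by simpa using hs)

theorem nsum_le_two {G : SimpleGraph V} {f : V → ℝ} (hf : ∀ v, 0 ≤ f v) {u : V} (a b : V)
    (hs : ∀ w, G.Adj u w → w = a ∨ w = b) : nsum G f u ≤ f a + f b := by
  have h1 := nsum_le_sum hf (s := {a, b}) (by simpa using hs)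
  have h2 := sum_insert_le' hf a {b}
  rw [Finset.sum_singleton] at h2
  linarith

theorem nsum_le_three {G : SimpleGraph V} {f : V → ℝ} (hf : ∀ v, 0 ≤ f v) {u : V} (a b c : V)
    (hs : ∀ w, G.Adj u w → w = a ∨ w = b ∨ w = c) : nsum G f u ≤ f a + f b + f c := by
  have h1 := nsum_le_sum hf (s := {a, b, c}) (by simpa using hs)
  have h2 := sum_insert_le' hf a {b, c}
  have h3 := sum_insert_le' hf b {c}
  rw [Finset.sum_singleton] at h3
  linarith

/-- Weight 1 on the two leaves at the branching vertex and 2 elsewhere satisfies A f = 2 f except at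
the far end of the long leg, where the inequality is strict. -/
theorem rho_dGraph_lt {n : ℕ} (hn : 4 ≤ n) : rho (dGraph n) < 2 := by
  set f : Fin n → ℝ := fun i => if i.val = 0 ∨ i.val + 1 = n then 1 else 2 with hf
  have h0 : ∀ i, 0 < f i := by intro i; simp only [hf]; split_ifs <;> norm_num
  have h0' : ∀ i, 0 ≤ f i := fun i => (h0 i).le
  have h2 : ∀ i, f i ≤ 2 := by intro i; simp only [hf]; split_ifs <;> norm_num
  have f0 : f ⟨0, by omega⟩ = 1 := by simp [hf]
  have fl : f ⟨n - 1, by omega⟩ = 1 := by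
    simp only [hf]; rw [if_pos]; right; omega
  have hlast : nsum (dGraph n) f ⟨n - 2, by omega⟩ ≤ 2 := by
    refine (nsum_le_one h0' ⟨n - 3, by omega⟩ fun w hw => ?_).trans (h2 _)
    rw [dGraph_adj hn] at hw
    rw [Fin.ext_iff]
    have := w.isLt
    simp only at hw ⊢
    omega
  have flast : f ⟨n - 2, by omega⟩ = 2 := by
    simp only [hf]; rw [if_neg]; omega
  refine rho_lt_of_super (dGraph_connected hn) h0 (fun i => ?_) ⟨n - 2, by omega⟩ (by linarith)
  have hi := i.isLt
  by_cases hi0 : i.val = 0 ∨ i.val + 1 = n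
  · have : f i = 1 := by simp only [hf]; rw [if_pos hi0]
    rw [this]
    refine (nsum_le_one h0' ⟨1, by omega⟩ fun w hw => ?_).trans ((h2 _).trans (by norm_num))
    rw [dGraph_adj hn] at hw
    rw [Fin.ext_iff]
    have := w.isLt
    simp only at hw ⊢
    omega
  · have h3 : f i = 2 := by simp only [hf]; rw [if_neg hi0]
    rw [h3]
    by_cases hi1 : i.val = 1
    · refine (nsum_le_three h0' ⟨0, by omega⟩ ⟨n - 1, by omega⟩ ⟨2, by omega⟩
        fun w hw => ?_).trans (by have := h2 ⟨2, by omega⟩; linarith)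
      rw [dGraph_adj hn] at hw
      simp only [Fin.ext_iff]
      have := w.isLt
      omega
    · by_cases hi2 : i.val + 2 = n
      · have : i = ⟨n - 2, by omega⟩ := by rw [Fin.ext_iff]; simp only; omega
        rw [this]; linarith
      · refine (nsum_le_two h0' ⟨i.val - 1, by omega⟩ ⟨i.val + 1, by omega⟩
          fun w hw => ?_).trans
          (by have := h2 ⟨i.val - 1, by omega⟩; have := h2 ⟨i.val + 1, by omega⟩; linarith)
        rw [dGraph_adj hn] at hw
        simp only [Fin.ext_iff]
        have := w.isLt
        omega

theorem exists_adj_ne {G : SimpleGraph V} {x : V} (hx : 2 ≤ G.degree x) (a : V) :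
    ∃ b, b ≠ a ∧ G.Adj x b := by
  rw [← G.card_neighborFinset_eq_degree] at hx
  obtain ⟨b, hb, hba⟩ := Finset.exists_mem_ne (s := G.neighborFinset x) (by omega) a
  exact ⟨b, hba, (G.mem_neighborFinset _ _).1 hb⟩

/-! ### The case n = 2k + 2. -/

/-- If three paths, of which two have length at least three, emanate from a vertex, then the
spectral radius is at least two. -/
theorem two_le_rho_of_legs {G : SimpleGraph V} (hG : G.Connected) {w x₁ x₂ x₃ c₁ c₂ z₁ z₂ : V}
    (h12 : x₁ ≠ x₂) (h13 : x₁ ≠ x₃) (h23 : x₂ ≠ x₃) (h1 : G.Adj w x₁) (h2 : G.Adj w x₂)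
    (h3 : G.Adj w x₃) (hc1 : G.Adj x₁ c₁) (hc2 : G.Adj x₂ c₂) (hcw1 : c₁ ≠ w) (hcw2 : c₂ ≠ w)
    (hz1 : G.Adj c₁ z₁) (hz2 : G.Adj c₂ z₂) (hzx1 : z₁ ≠ x₁) (hzx2 : z₂ ≠ x₂) : 2 ≤ rho G := by
  -- The marks of the extended Dynkin diagram of type E₇. A vertex playing several roles receives
  -- its largest mark, so the legs need not be disjoint.
  set f : V → ℝ := fun v => if v = w then 4 else if v = x₁ ∨ v = x₂ then 3 else
    if v = c₁ ∨ v = c₂ ∨ v = x₃ then 2 else if v = z₁ ∨ v = z₂ then 1 else 0 with hf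
  have f0 : ∀ v, 0 ≤ f v := by intro v; simp only [hf]; split_ifs <;> norm_num
  have fw : f w = 4 := by simp [hf]
  have f3 : ∀ v, v = x₁ ∨ v = x₂ → 3 ≤ f v := by
    intro v hv; simp only [hf]; split_ifs <;> norm_num
  have f2 : ∀ v, v = c₁ ∨ v = c₂ ∨ v = x₃ → 2 ≤ f v := by
    intro v hv; simp only [hf]; split_ifs <;> norm_num
  have f1 : ∀ v, v = z₁ ∨ v = z₂ → 1 ≤ f v := by
    intro v hv; simp only [hf]; split_ifs <;> norm_num
  have add2 : ∀ u a b : V, a ≠ b → G.Adj u a → G.Adj u b → f a + f b ≤ nsum G f u := by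
    intro u a b hab ha hb
    rw [← Finset.sum_pair hab]
    exact sum_le_nsum f0 (by simp [ha, hb])
  refine le_rho_of_sub hG f0 w (by rw [fw]; norm_num) fun v => ?_
  by_cases hvw : v = w
  · subst hvw
    have : f x₁ + (f x₂ + f x₃) ≤ nsum G f v := by
      rw [← Finset.sum_pair h23, ← Finset.sum_insert (by simp [h12, h13])]
      exact sum_le_nsum f0 (by simp [h1, h2, h3])
    have := f3 x₁ (by simp)
    have := f3 x₂ (by simp)
    have := f2 x₃ (by simp)
    linarith
  by_cases hvx : v = x₁ ∨ v = x₂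
  · have hv : f v = 3 := by simp only [hf]; rw [if_neg hvw, if_pos hvx]
    rcases hvx with rfl | rfl
    · have := add2 v w c₁ hcw1.symm h1.symm hc1
      have := f2 c₁ (by simp)
      linarith
    · have := add2 v w c₂ hcw2.symm h2.symm hc2
      have := f2 c₂ (by simp)
      linarith
  by_cases hvc : v = c₁ ∨ v = c₂ ∨ v = x₃
  · have hv : f v = 2 := by simp only [hf]; rw [if_neg hvw, if_neg hvx, if_pos hvc]
    rcases hvc with rfl | rfl | rfl
    · have := add2 v z₁ x₁ hzx1 hz1 hc1.symm
      have := f1 z₁ (by simp)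
      have := f3 x₁ (by simp)
      linarith
    · have := add2 v z₂ x₂ hzx2 hz2 hc2.symm
      have := f1 z₂ (by simp)
      have := f3 x₂ (by simp)
      linarith
    · have := le_nsum f0 h3.symm
      linarith
  by_cases hvz : v = z₁ ∨ v = z₂
  · have hv : f v = 1 := by
      simp only [hf]; rw [if_neg hvw, if_neg hvx, if_neg hvc, if_pos hvz]
    rcases hvz with rfl | rfl
    · have := le_nsum f0 hz1.symm
      have := f2 c₁ (by simp)
      linarith
    · have := le_nsum f0 hz2.symm
      have := f2 c₂ (by simp)
      linarith
  · have hv : f v = 0 := by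
      simp only [hf]; rw [if_neg hvw, if_neg hvx, if_neg hvc, if_neg hvz]
    rw [hv, mul_zero]
    exact nsum_nonneg f0 v

/-- A neighbour of `w` that is not a leaf starts a leg of length three: it lies outside `C`, its
other neighbour lies in `C`, and that one has degree at least two. Two such legs and a third
neighbour would force `rho` ≥ 2. -/
theorem IsGood.exists_leaves {G : SimpleGraph V} {C : Finset V} (h : IsGood G C) (hr : rho G < 2)
    {w : V} (hw : 3 ≤ G.degree w) :
    ∃ a b, a ≠ b ∧ G.Adj w a ∧ G.Adj w b ∧ G.degree a = 1 ∧ G.degree b = 1 := by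
  have hwC : w ∈ C := by
    by_contra hwC
    have := h.degree_le w hwC
    omega
  by_contra! hcon
  set A := (G.neighborFinset w).filter fun x => G.degree x = 1 with hA
  set B := (G.neighborFinset w).filter fun x => ¬ G.degree x = 1 with hB
  have hAB : A.card + B.card = G.degree w := by
    rw [← G.card_neighborFinset_eq_degree]
    exact Finset.card_filter_add_card_filter_not _
  have hA1 : A.card ≤ 1 := by
    rw [Finset.card_le_one]
    intro a ha b hb
    by_contra hab
    simp only [hA, Finset.mem_filter, SimpleGraph.mem_neighborFinset] at ha hb
    exact hcon a b hab ha.1 hb.1 ha.2 hb.2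
  obtain ⟨x₁, hx1, x₂, hx2, h12⟩ := Finset.one_lt_card.1 (show 1 < B.card by omega)
  simp only [hB, Finset.mem_filter, SimpleGraph.mem_neighborFinset] at hx1 hx2
  obtain ⟨x₃, hx3⟩ : (G.neighborFinset w \ {x₁, x₂}).Nonempty := by
    rw [← Finset.card_pos]
    have := Finset.le_card_sdiff {x₁, x₂} (G.neighborFinset w)
    have := Finset.card_le_two (a := x₁) (b := x₂)
    rw [G.card_neighborFinset_eq_degree] at *
    omega
  simp only [Finset.mem_sdiff, SimpleGraph.mem_neighborFinset, Finset.mem_insert,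
    Finset.mem_singleton, not_or] at hx3
  have key : ∀ x, G.Adj w x → G.degree x ≠ 1 →
      ∃ c z, G.Adj x c ∧ c ≠ w ∧ G.Adj c z ∧ z ≠ x := by
    intro x hx hd
    have h1 := one_le_degree h.tree.connected (G.degree_lt_card_verts w |>.trans_le' (by omega)) x
    obtain ⟨c, hcw, hxc⟩ := exists_adj_ne (show 2 ≤ G.degree x by omega) w
    have hxC : x ∉ C := fun hxC => h.indep w hwC x hxC hx
    have hcC : c ∈ C := (h.cover hxc).resolve_left hxC
    obtain ⟨z, hzx, hcz⟩ := exists_adj_ne (h.leafless c hcC) x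
    exact ⟨c, z, hxc, hcw, hcz, hzx⟩
  obtain ⟨c₁, z₁, h1, h2, h3, h4⟩ := key x₁ hx1.1 hx1.2
  obtain ⟨c₂, z₂, h5, h6, h7, h8⟩ := key x₂ hx2.1 hx2.2
  exact absurd hr (not_lt.2 (two_le_rho_of_legs h.tree.connected h12 (Ne.symm hx3.2.1)
    (Ne.symm hx3.2.2) hx1.1 hx2.1 hx3.1 h1 h5 h2 h6 h3 h7 h4 h8))

theorem degree_induce_le {G : SimpleGraph V} {s : Set V} [Fintype s] {v : s} {t : Finset V}
    (h : ∀ u ∈ s, G.Adj v u → u ∈ t) : (G.induce s).degree v ≤ t.card := by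
  rw [← (G.induce s).card_neighborFinset_eq_degree,
    ← Finset.card_map (Function.Embedding.subtype (· ∈ s))]
  refine Finset.card_le_card fun u hu => ?_
  rw [Finset.mem_map] at hu
  obtain ⟨u, hu, rfl⟩ := hu
  rw [SimpleGraph.mem_neighborFinset] at hu
  exact h u u.2 hu

/-- A tree with exactly one branching vertex, which has degree three and is adjacent to two
leaves. -/
theorem nonempty_iso_dGraph {G : SimpleGraph V} (hG : G.IsTree) {w a b : V}
    (hw : G.degree w = 3) (hd : ∀ v, v ≠ w → G.degree v ≤ 2) (hab : a ≠ b) (hwa : G.Adj w a)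
    (hwb : G.Adj w b) (ha : G.degree a = 1) (hb : G.degree b = 1) :
    Nonempty (dGraph (Fintype.card V) ≃g G) := by
  have hV : 4 ≤ Fintype.card V := by have := G.degree_lt_card_verts w; omega
  have hc := (rho_delete_leaf hG.connected ha).1
  have ht : (G.induce ({a}ᶜ : Set V)).IsTree := ⟨hc, hG.isAcyclic.induce _⟩
  -- Without the leaf `a` the tree is a path, with `b` at an end and `w` next to it; `a` is put back
  -- as the last vertex.
  obtain ⟨φ⟩ := nonempty_iso_pathGraph ht (fun v => by
    by_cases hv : v.1 = w
    · have : (G.induce ({a}ᶜ : Set V)).degree v ≤ ((G.neighborFinset w).erase a).card := by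
        refine degree_induce_le fun u hu hvu => ?_
        rw [Finset.mem_erase, SimpleGraph.mem_neighborFinset, ← hv]
        exact ⟨hu, hvu⟩
      rw [Finset.card_erase_of_mem (by simpa using hwa), G.card_neighborFinset_eq_degree, hw]
        at this
      exact this
    · refine (degree_induce_le (t := G.neighborFinset v) fun u hu hvu => by simpa using hvu).trans ?_
      rw [G.card_neighborFinset_eq_degree]
      exact hd v hv)
  rw [card_compl_singleton] at φ
  generalize Fintype.card V = n at hV φ
  have hba : b ∈ ({a}ᶜ : Set V) := hab.symm
  have hwa' : w ∈ ({a}ᶜ : Set V) := hwa.ne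
  obtain ⟨ψ, hψ⟩ : ∃ ψ : SimpleGraph.pathGraph (n - 1) ≃g G.induce ({a}ᶜ : Set V),
      (ψ.symm ⟨b, hba⟩).val = 0 := by
    have hor : (φ.symm ⟨b, hba⟩).val = 0 ∨ (φ.symm ⟨b, hba⟩).val + 1 = n - 1 := by
      by_contra! hcon
      set i := φ.symm ⟨b, hba⟩ with hi
      have hφi : φ i = ⟨b, hba⟩ := by simp [hi]
      have hin := i.isLt
      have h1 : (SimpleGraph.pathGraph (n - 1)).Adj i ⟨i.val - 1, by omega⟩ := by
        rw [SimpleGraph.pathGraph_adj]; right; show i.val - 1 + 1 = _; omega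
      have h2 : (SimpleGraph.pathGraph (n - 1)).Adj i ⟨i.val + 1, by omega⟩ := by
        rw [SimpleGraph.pathGraph_adj]; left; rfl
      have h3 := φ.map_adj_iff.2 h1
      have h4 := φ.map_adj_iff.2 h2
      rw [hφi] at h3 h4
      have h5 := eq_of_degree_one hb h3 h4
      have h6 := φ.injective (Subtype.ext h5)
      rw [Fin.ext_iff] at h6
      simp only at h6
      omega
    rcases hor with h | h
    · exact ⟨φ, h⟩
    · let r : SimpleGraph.pathGraph (n - 1) ≃g SimpleGraph.pathGraph (n - 1) :=
        { toEquiv := Fin.revPerm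
          map_rel_iff' := fun {i j} => by
            simp only [Fin.revPerm_apply, SimpleGraph.pathGraph_adj, Fin.val_rev]
            omega }
      refine ⟨r.trans φ, ?_⟩
      show (Fin.rev (φ.symm ⟨b, hba⟩)).val = 0
      rw [Fin.val_rev]
      omega
  have hw1 : (ψ.symm ⟨w, hwa'⟩).val = 1 := by
    have : (SimpleGraph.pathGraph (n - 1)).Adj (ψ.symm ⟨w, hwa'⟩) (ψ.symm ⟨b, hba⟩) :=
      ψ.symm.map_adj_iff.2 hwb
    rw [SimpleGraph.pathGraph_adj, hψ] at this
    omega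
  have hψw : ∀ h : 1 < n - 1, (ψ ⟨1, h⟩ : V) = w := by
    intro h
    have : (⟨1, h⟩ : Fin (n - 1)) = ψ.symm ⟨w, hwa'⟩ := Fin.ext hw1.symm
    rw [this]
    simp
  let f : Fin n → V := fun i => if h : i.val < n - 1 then ψ ⟨i.val, h⟩ else a
  have hf : Function.Bijective f := by
    constructor
    · intro i j hij
      by_cases hi : i.val < n - 1 <;> by_cases hj : j.val < n - 1 <;>
        simp only [f, hi, hj, dite_true, dite_false] at hij
      · have := ψ.injective (Subtype.ext hij)
        rw [Fin.ext_iff] at this ⊢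
        exact this
      · exact absurd hij (ψ _).2
      · exact absurd hij.symm (ψ _).2
      · rw [Fin.ext_iff]; omega
    · intro v
      by_cases hv : v = a
      · exact ⟨⟨n - 1, by omega⟩, by simp [f, hv]⟩
      · refine ⟨⟨(ψ.symm ⟨v, hv⟩).val, by omega⟩, ?_⟩
        simp [f]
  refine ⟨isoOfHom (dGraph_connected hV) hG (Equiv.ofBijective f hf) fun i j hij => ?_⟩
  have key : ∀ i j : Fin n, ((i.val + 1 = j.val ∧ j.val + 1 < n) ∨ (i.val = 1 ∧ j.val + 1 = n)) →
      G.Adj (f i) (f j) := by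
    rintro i j (⟨h1, h2⟩ | ⟨h1, h2⟩)
    · have hi : i.val < n - 1 := by omega
      have hj : j.val < n - 1 := by omega
      simp only [f, hi, hj, dite_true]
      have : (G.induce ({a}ᶜ : Set V)).Adj (ψ ⟨i, hi⟩) (ψ ⟨j, hj⟩) :=
        ψ.map_adj_iff.2 (by rw [SimpleGraph.pathGraph_adj]; exact Or.inl h1)
      exact this
    · have hi : i.val < n - 1 := by omega
      have hj : ¬ j.val < n - 1 := by omega
      have h3 : f i = w := by
        rw [← hψw (by omega)]
        simp only [f, h1]
        rw [dif_pos (by omega)]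
      rw [h3]
      simpa only [f, hj, dite_false] using hwa
  simp only [Equiv.ofBijective_apply]
  rcases (dGraph_adj hV).1 hij with h | h
  · exact key i j h
  · exact (key j i h).symm

theorem IsMinimizer.exists_iso_dGraph {k : ℕ} (hk : 1 ≤ k) {T : SimpleGraph V}
    (hT : IsMinimizer (2 * k + 2) (k + 2) T) :
    ∃ C : Finset V, IsGood T C ∧ C.card = k ∧ Nonempty (dGraph (2 * k + 2) ≃g T) := by
  have hn := hT.mem.order
  have hr : rho T < 2 := (hT.rho_le (dGraph_inClass hk)).trans_lt (rho_dGraph_lt (by omega))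
  obtain ⟨C, hC, hCk⟩ := hT.mem.exists_cover
  replace hCk : C.card = k := by omega
  obtain ⟨T₀, hle, hT₀⟩ := hT.mem.connected.exists_isTree_le
  have hC₀ := hC.mono hle
  have hr₀ : rho T₀ < 2 := (rho_mono hT₀.connected hle).trans_lt hr
  have hl := le_card_leaves hT₀ (by omega) hC₀
  have hl4 : ¬ 4 ≤ (Finset.univ.filter fun x => T₀.degree x = 1).card := fun h4 =>
    absurd hr₀ (not_lt.2 (two_le_rho_of_leaves hT₀ (by omega) h4))
  have hsub : (Cᶜ.filter fun x => T₀.degree x = 1) ⊆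
      Finset.univ.filter fun x => T₀.degree x = 1 :=
    Finset.filter_subset_filter _ (Finset.subset_univ _)
  have heq := Finset.eq_of_subset_of_card_le hsub (by omega)
  have hl3 : (Finset.univ.filter fun x => T₀.degree x = 1).card = 3 := by
    rw [heq] at hl; omega
  have hone := one_le_degree hT₀.connected (by omega)
  have hCc : Cᶜ.card = k + 2 := by rw [Finset.card_compl]; omega
  -- The last sum collects the excess degrees; degrees are positive, so its subtraction is not
  -- truncated. With exactly three leaves, all outside the cover, the bound n - 1 on the degree sum
  -- leaves room neither for an excess nor for an edge inside the cover.
  have hsum : ∑ x ∈ Cᶜ, T₀.degree x + 3 = 2 * (k + 2) +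
      ∑ x ∈ Cᶜ, (T₀.degree x + (if T₀.degree x = 1 then 1 else 0) - 2) := by
    rw [← hl3, ← heq, Finset.card_filter, ← Finset.sum_add_distrib, ← hCc, mul_comm,
      ← smul_eq_mul, ← Finset.sum_const, ← Finset.sum_add_distrib]
    refine Finset.sum_congr rfl fun x _ => ?_
    have := hone x
    split_ifs <;> omega
  have hgood : IsGood T₀ C := by
    refine ⟨hT₀, hC₀, fun x hx => ?_, fun a ha b hb hab => ?_, fun x hx => ?_⟩
    · by_contra! hlt
      have : x ∈ Cᶜ.filter fun x => T₀.degree x = 1 := by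
        rw [heq, Finset.mem_filter]
        have := hone x
        exact ⟨Finset.mem_univ _, by omega⟩
      exact (Finset.mem_compl.1 (Finset.mem_filter.1 this).1) hx
    · have := sum_degree_compl_cover_lt hT₀ hC₀ hab ha hb
      omega
    · have h1 := sum_degree_compl_cover_le hT₀ hC₀
      have h2 : T₀.degree x + (if T₀.degree x = 1 then 1 else 0) - 2 ≤
          ∑ x ∈ Cᶜ, (T₀.degree x + (if T₀.degree x = 1 then 1 else 0) - 2) :=
        Finset.single_le_sum (f := fun x => T₀.degree x + (if T₀.degree x = 1 then 1 else 0) - 2)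
          (fun _ _ => Nat.zero_le _) (Finset.mem_compl.2 hx)
      split_ifs at h2 <;> omega
  obtain rfl := hT.eq_of_le (hgood.inClass hn (by omega) (by omega)) hle
  refine ⟨C, hgood, hCk, ?_⟩
  have hs := sum_degree_tree hT₀
  -- Over all vertices the total excess is -2 + 3 = 1, so one vertex has degree three and no other
  -- exceeds two.
  have hs' : ∑ x, ((T₀.degree x : ℤ) + (if T₀.degree x = 1 then 1 else 0) - 2) = 1 := by
    rw [Finset.sum_sub_distrib, Finset.sum_add_distrib, hs, Finset.sum_boole, hl3,
      Finset.sum_const, Finset.card_univ, hn]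
    push_cast
    ring
  have hnn : ∀ x, 0 ≤ ((T₀.degree x : ℤ) + (if T₀.degree x = 1 then 1 else 0) - 2) := by
    intro x
    have := hone x
    split_ifs <;> omega
  obtain ⟨w, -, hw⟩ : ∃ w ∈ Finset.univ,
      0 < ((T₀.degree w : ℤ) + (if T₀.degree w = 1 then 1 else 0) - 2) :=
    Finset.exists_lt_of_sum_lt (f := fun _ => 0) (by rw [hs']; simp)
  have hw3 : 3 ≤ T₀.degree w := by split_ifs at hw <;> omega
  have hws : ((T₀.degree w : ℤ) + (if T₀.degree w = 1 then 1 else 0) - 2) ≤ 1 := by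
    refine le_trans ?_ hs'.le
    exact Finset.single_le_sum (f := fun x => (T₀.degree x : ℤ) +
      (if T₀.degree x = 1 then 1 else 0) - 2) (fun x _ => hnn x) (Finset.mem_univ w)
  obtain ⟨a, b, hab, hwa, hwb, ha, hb⟩ := hgood.exists_leaves hr hw3
  rw [← hn]
  refine nonempty_iso_dGraph hT₀ ?_ (fun v hv => ?_) hab hwa hwb ha hb
  · split_ifs at hws <;> omega
  · have h2 : ((T₀.degree v : ℤ) + (if T₀.degree v = 1 then 1 else 0) - 2) +
      ((T₀.degree w : ℤ) + (if T₀.degree w = 1 then 1 else 0) - 2) ≤ 1 := by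
      refine le_trans ?_ hs'.le
      rw [← Finset.sum_pair (f := fun x => (T₀.degree x : ℤ) +
        (if T₀.degree x = 1 then 1 else 0) - 2) hv]
      exact Finset.sum_le_sum_of_subset_of_nonneg (Finset.subset_univ _) fun x _ _ => hnn x
    split_ifs at h2 hw <;> omega

/-! ### The case n ≤ 2k + 1: the path has the smallest spectral radius. -/

/-- Chebyshev polynomials of the second kind, evaluated at `r / 2`, with the index shifted by
one. -/
def cheb (r : ℝ) : ℕ → ℝ
  | 0 => 0
  | 1 => 1
  | j + 2 => r * cheb r (j + 1) - cheb r j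

theorem cheb_add_two (r : ℝ) (j : ℕ) : cheb r (j + 2) = r * cheb r (j + 1) - cheb r j := by
  rw [cheb]

theorem cheb_add (r : ℝ) (a b : ℕ) :
    cheb r (a + b + 1) = cheb r (a + 1) * cheb r (b + 1) - cheb r a * cheb r b := by
  induction a generalizing b with
  | zero => simp [cheb]
  | succ a ih =>
    have h := ih (b + 1)
    rw [show a + 1 + b + 1 = a + (b + 1) + 1 by ring, h, cheb_add_two, cheb_add_two]
    ring

theorem cheb_sq (r : ℝ) (a : ℕ) : cheb r (a + 1) ^ 2 - cheb r a * cheb r (a + 2) = 1 := by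
  induction a with
  | zero => simp [cheb]
  | succ a ih =>
    rw [cheb_add_two r (a + 1), cheb_add_two]
    rw [cheb_add_two] at ih
    linarith

/-- By `cheb_sq` the sequence is log-concave while it stays positive, so the inequality `h` descends
from `a` to every smaller index. By `cheb_add` each instance is the positivity of one further term.
-/
theorem cheb_pos_of_lt {r : ℝ} {a b : ℕ} (ha : ∀ j, 1 ≤ j → j ≤ a + 1 → 0 < cheb r j)
    (hb : ∀ j, 1 ≤ j → j ≤ b + 1 → 0 < cheb r j)
    (h : cheb r a * cheb r b < cheb r (a + 1) * cheb r (b + 1)) (j : ℕ) (h1 : 1 ≤ j)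
    (hj : j ≤ a + b + 1) : 0 < cheb r j := by
  have key : ∀ i ≤ a, cheb r (a - i) * cheb r b < cheb r (a - i + 1) * cheb r (b + 1) := by
    intro i hi
    induction i with
    | zero => exact h
    | succ i ih =>
      have ih := ih (by omega)
      obtain ⟨c, hc⟩ : ∃ c, a - i = c + 1 := ⟨a - i - 1, by omega⟩
      rw [show a - (i + 1) = c by omega]
      rw [hc] at ih
      have h2 := cheb_sq r c
      have hc1 := ha (c + 1) (by omega) (by omega)
      have hb1 := hb (b + 1) (by omega) le_rfl
      have hc0 : 0 ≤ cheb r c := by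
        rcases Nat.eq_zero_or_pos c with rfl | hpos
        · simp [cheb]
        · exact (ha c hpos (by omega)).le
      have h3 : cheb r c * (cheb r (c + 1) * cheb r b) ≤
          cheb r c * (cheb r (c + 2) * cheb r (b + 1)) := mul_le_mul_of_nonneg_left ih.le hc0
      have h4 : cheb r (c + 1) * (cheb r c * cheb r b) <
          cheb r (c + 1) * (cheb r (c + 1) * cheb r (b + 1)) := by
        have : cheb r c * cheb r (c + 2) * cheb r (b + 1) <
            cheb r (c + 1) ^ 2 * cheb r (b + 1) :=
          mul_lt_mul_of_pos_right (by linarith) hb1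
        linarith
      exact lt_of_mul_lt_mul_left h4 hc1.le
  by_cases hjb : j ≤ b + 1
  · exact hb j h1 hjb
  · have h2 := key (a - (j - b - 1)) (by omega)
    rw [show a - (a - (j - b - 1)) = j - b - 1 by omega] at h2
    have h3 := cheb_add r (j - b - 1) b
    rw [show j - b - 1 + b + 1 = j by omega] at h3
    rw [h3]
    linarith

/-- The sum of `y` over the neighbours in `s`. -/
noncomputable def psum (G : SimpleGraph V) (y : V → ℝ) (s : Finset V) (u : V) : ℝ :=
  ∑ x ∈ s, if G.Adj u x then y x else 0

theorem psum_union {G : SimpleGraph V} {y : V → ℝ} {s t : Finset V} (h : Disjoint s t) (u : V) :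
    psum G y (s ∪ t) u = psum G y s u + psum G y t u := Finset.sum_union h

theorem sum_le_psum {G : SimpleGraph V} {y : V → ℝ} (hy : ∀ v, 0 < y v) {s t : Finset V} {u : V}
    (h : ∀ x ∈ t, x ∈ s ∧ G.Adj u x) : ∑ x ∈ t, y x ≤ psum G y s u := by
  rw [psum, ← Finset.sum_filter]
  exact Finset.sum_le_sum_of_subset_of_nonneg (fun x hx => by simpa using h x hx)
    fun w _ _ => (hy w).le

theorem psum_mono {G : SimpleGraph V} {y : V → ℝ} (hy : ∀ v, 0 < y v) {s t : Finset V} {u : V}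
    (h : s ⊆ t) : psum G y s u ≤ psum G y t u :=
  Finset.sum_le_sum_of_subset_of_nonneg h fun w _ _ => by split_ifs <;> simp [(hy w).le]

/-- A connected set `s` of vertices with root `v`, and a weight `y` that is superharmonic on
`s` off the root. -/
structure IsBranch (G : SimpleGraph V) (y : V → ℝ) (r : ℝ) (s : Finset V) (v : V) : Prop where
  mem : v ∈ s
  joined : ∀ u ∈ s, Relation.ReflTransGen (fun a b => b ∈ s ∧ G.Adj a b) v u
  super : ∀ u ∈ s, u ≠ v → psum G y s u ≤ r * y u

theorem IsBranch.exists_adj {G : SimpleGraph V} {y : V → ℝ} {r : ℝ} {s : Finset V} {v : V}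
    (h : IsBranch G y r s v) (hs : 2 ≤ s.card) : ∃ u ∈ s, G.Adj v u := by
  obtain ⟨u, hu, huv⟩ := Finset.exists_mem_ne (s := s) (by omega) v
  rcases (h.joined u hu).cases_head with h1 | ⟨c, hc, -⟩
  · exact absurd h1.symm huv
  · exact ⟨c, hc.1, hc.2⟩

/-- `B` is the part of `s` reachable from `u` without passing through `v`, and `A` is the rest.
Passing to a subset only removes neighbours, so superharmonicity persists; at `u` the lost neighbour
`v` leaves a slack of at least `y v`. -/
theorem IsBranch.split {G : SimpleGraph V} {y : V → ℝ} {r : ℝ} {s : Finset V} {v u : V}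
    (hy : ∀ v, 0 < y v) (h : IsBranch G y r s v) (hu : u ∈ s) (hvu : G.Adj v u) :
    ∃ A B, Disjoint A B ∧ A ∪ B = s ∧ IsBranch G y r A v ∧ IsBranch G y r B u ∧
      y v ≤ r * y u - psum G y B u := by
  set R : V → V → Prop := fun a b => (b ∈ s ∧ b ≠ v) ∧ G.Adj a b with hR
  set B := s.filter fun x => x ≠ v ∧ Relation.ReflTransGen R u x with hB
  have hBs : B ⊆ s := Finset.filter_subset _ _
  have hvB : v ∉ B := by simp [hB]
  have huB : u ∈ B := by simp [hB, hu, hvu.ne', Relation.ReflTransGen.refl]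
  refine ⟨s \ B, B, Finset.sdiff_disjoint, Finset.sdiff_union_of_subset hBs,
    ⟨by simp [h.mem, hvB], ?_, ?_⟩, ⟨huB, ?_, ?_⟩, ?_⟩
  · have key : ∀ x, Relation.ReflTransGen (fun a b => b ∈ s ∧ G.Adj a b) v x →
        x ∈ B ∨ Relation.ReflTransGen (fun a b => b ∈ s \ B ∧ G.Adj a b) v x := by
      intro x hx
      induction hx with
      | refl => exact Or.inr Relation.ReflTransGen.refl
      | tail hab hbc ih =>
        rename_i b c
        by_cases hcB : c ∈ B
        · exact Or.inl hcB
        refine Or.inr ?_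
        by_cases hcv : c = v
        · rw [hcv]
        rcases ih with ih | ih
        · refine absurd ?_ hcB
          rw [hB, Finset.mem_filter] at ih ⊢
          exact ⟨hbc.1, hcv, ih.2.2.tail ⟨⟨hbc.1, hcv⟩, hbc.2⟩⟩
        · exact ih.tail ⟨Finset.mem_sdiff.2 ⟨hbc.1, hcB⟩, hbc.2⟩
    intro x hx
    rw [Finset.mem_sdiff] at hx
    exact (key x (h.joined x hx.1)).resolve_left hx.2
  · intro x hx hxv
    exact (psum_mono hy Finset.sdiff_subset).trans (h.super x (Finset.mem_sdiff.1 hx).1 hxv)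
  · intro x hx
    have hx' := (Finset.mem_filter.1 hx).2.2
    clear hx
    induction hx' with
    | refl => exact Relation.ReflTransGen.refl
    | tail hab hbc ih =>
      refine ih.tail ⟨?_, hbc.2⟩
      rw [hB, Finset.mem_filter]
      exact ⟨hbc.1.1, hbc.1.2, hab.tail hbc⟩
  · intro x hx hxu
    exact (psum_mono hy hBs).trans (h.super x (hBs hx) (by rintro rfl; exact hvB hx))
  · have h1 := h.super u hu hvu.ne'
    have h2 : psum G y (s \ B) u + psum G y B u = psum G y s u := by
      rw [← psum_union Finset.sdiff_disjoint, Finset.sdiff_union_of_subset hBs]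
    have h3 : y v ≤ psum G y (s \ B) u := by
      simpa using sum_le_psum (G := G) hy (s := s \ B) (t := {v}) (u := u)
        (by simp [h.mem, hvB, hvu.symm])
    linarith

/-- Arithmetic of joining two branches along an edge: `p` and `q` are the slacks at the roots, `e`
is the slack at the first root after joining, and the `S` are Chebyshev values. By `cheb_add` the
bracket is the Chebyshev value for the joined branch. -/
theorem branch_combine {p q e t yv yu Sa Sa1 Sb Sb1 : ℝ} (ht : yu ≤ t) (hSa : 0 < Sa)
    (hSb1 : 0 < Sb1) (hSb : 0 ≤ Sb) (hq : yv ≤ q) (hp : p = e + t) (h1 : p * Sa ≤ yv * Sa1)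
    (h2 : q * Sb ≤ yu * Sb1) : e * (Sa * Sb1) ≤ yv * (Sa1 * Sb1 - Sa * Sb) ∧
      (p * Sa < yv * Sa1 ∨ yu < t → e * (Sa * Sb1) < yv * (Sa1 * Sb1 - Sa * Sb)) := by
  have h3 : yv * Sb ≤ yu * Sb1 := (mul_le_mul_of_nonneg_right hq hSb).trans h2
  have h4 : yv * Sb * Sa ≤ yu * Sb1 * Sa := mul_le_mul_of_nonneg_right h3 hSa.le
  have h5 : yu * (Sb1 * Sa) ≤ t * (Sb1 * Sa) := mul_le_mul_of_nonneg_right ht (by positivity)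
  have h6 : p * Sa * Sb1 ≤ yv * Sa1 * Sb1 := mul_le_mul_of_nonneg_right h1 hSb1.le
  subst hp
  refine ⟨by linarith, fun h => ?_⟩
  rcases h with h | h
  · have : (e + t) * Sa * Sb1 < yv * Sa1 * Sb1 := mul_lt_mul_of_pos_right h hSb1
    linarith
  · have : yu * (Sb1 * Sa) < t * (Sb1 * Sa) := mul_lt_mul_of_pos_right h (by positivity)
    linarith

/-- Among branches of order m, the path hung by an end has the largest root slack relative to `y v`,
namely `cheb r (m + 1) / cheb r m`. The proof splits along an edge at the root; a root with two
neighbours in `s` makes the comparison strict. -/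
theorem IsBranch.cheb_pos {G : SimpleGraph V} {y : V → ℝ} {r : ℝ} (hy : ∀ v, 0 < y v) (m : ℕ) :
    ∀ (s : Finset V) (v : V), s.card = m → IsBranch G y r s v → psum G y s v < r * y v →
      (∀ j, 1 ≤ j → j ≤ m + 1 → 0 < cheb r j) ∧
      (r * y v - psum G y s v) * cheb r m ≤ y v * cheb r (m + 1) ∧
      ((∃ a ∈ s, ∃ b ∈ s, a ≠ b ∧ G.Adj v a ∧ G.Adj v b) →
        (r * y v - psum G y s v) * cheb r m < y v * cheb r (m + 1)) := by
  induction m using Nat.strong_induction_on with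
  | _ m ih =>
  intro s v hm h he
  by_cases h2 : 2 ≤ s.card
  · obtain ⟨u, hu, hvu⟩ := h.exists_adj h2
    obtain ⟨A, B, hdis, hAB, hA, hB, hq⟩ := h.split hy hu hvu
    have hcard : A.card + B.card = m := by
      rw [← hm, ← hAB, Finset.card_union_of_disjoint hdis]
    have hApos : 0 < A.card := Finset.card_pos.2 ⟨v, hA.mem⟩
    have hBpos : 0 < B.card := Finset.card_pos.2 ⟨u, hB.mem⟩
    have hps : psum G y s v = psum G y A v + psum G y B v := by rw [← hAB, psum_union hdis]
    have ht : y u ≤ psum G y B v := by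
      simpa using sum_le_psum (G := G) hy (s := B) (t := {u}) (u := v) (by simp [hB.mem, hvu])
    have hyv := hy v
    have hyu := hy u
    obtain ⟨hA1, hA2, hA3⟩ := ih A.card (by omega) A v rfl hA (by linarith)
    obtain ⟨hB1, hB2, -⟩ := ih B.card (by omega) B u rfl hB (by linarith)
    have hSa := hA1 A.card (by omega) (by omega)
    have hSb1 := hB1 (B.card + 1) (by omega) le_rfl
    have hSb := hB1 B.card (by omega) (by omega)
    obtain ⟨hc1, hc2⟩ := branch_combine (e := r * y v - psum G y s v) ht hSa hSb1 hSb.le hq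
      (by rw [hps]; ring) hA2 hB2
    set e := r * y v - psum G y s v with he'
    have hepos : 0 < e := by linarith
    have hD : 0 < cheb r (A.card + 1) * cheb r (B.card + 1) -
        cheb r A.card * cheb r B.card := by
      have : 0 < e * (cheb r A.card * cheb r (B.card + 1)) := by positivity
      exact pos_of_mul_pos_right (this.trans_le hc1) hyv.le
    have hpos := cheb_pos_of_lt hA1 hB1 (by linarith)
    rw [hcard] at hpos
    rw [← cheb_add, hcard] at hc1 hc2
    obtain ⟨a, ha⟩ : ∃ a, A.card = a + 1 := ⟨A.card - 1, by omega⟩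
    have hadd := cheb_add r a B.card
    rw [show a + B.card + 1 = m by omega] at hadd
    have hSa0 : 0 ≤ cheb r a := by
      rcases Nat.eq_zero_or_pos a with rfl | ha0
      · simp [cheb]
      · exact (hA1 a ha0 (by omega)).le
    rw [ha] at hc1 hc2
    have hle : e * cheb r m ≤ e * (cheb r (a + 1) * cheb r (B.card + 1)) := by
      refine mul_le_mul_of_nonneg_left ?_ hepos.le
      rw [hadd]
      linarith [mul_nonneg hSa0 hSb.le]
    refine ⟨hpos, hle.trans hc1, ?_⟩
    rintro ⟨x, hx, z, hz, hxz, hvx, hvz⟩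
    -- If `A` is just the root, both neighbours lie in `B`, so the weight received from `B` exceeds
    -- `y u`. Otherwise the term dropped in `hle` is positive.
    rcases Nat.eq_zero_or_pos a with rfl | ha0
    · have hAv : A = {v} := by
        obtain ⟨w, hw⟩ := Finset.card_eq_one.1 ha
        have := hA.mem
        rw [hw, Finset.mem_singleton] at this
        rw [hw, this]
      have hmem : ∀ x ∈ s, G.Adj v x → x ∈ B := by
        intro x hx hvx
        rw [← hAB, hAv] at hx
        simpa [hvx.ne'] using hx
      refine hle.trans_lt (hc2 (Or.inr ?_))
      have h3 : y x + y z ≤ psum G y B v := by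
        rw [← Finset.sum_pair hxz]
        refine sum_le_psum hy fun w hw => ?_
        rw [Finset.mem_insert, Finset.mem_singleton] at hw
        rcases hw with rfl | rfl
        · exact ⟨hmem _ hx hvx, hvx⟩
        · exact ⟨hmem _ hz hvz, hvz⟩
      by_cases hux : u = x
      · rw [hux]; linarith [hy z]
      · have h4 : y u + y x ≤ psum G y B v := by
          rw [← Finset.sum_pair hux]
          refine sum_le_psum hy fun w hw => ?_
          rw [Finset.mem_insert, Finset.mem_singleton] at hw
          rcases hw with rfl | rfl
          · exact ⟨hB.mem, hvu⟩
          · exact ⟨hmem _ hx hvx, hvx⟩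
        linarith [hy x]
    · refine lt_of_lt_of_le ?_ hc1
      refine mul_lt_mul_of_pos_left ?_ hepos
      rw [hadd]
      linarith [mul_pos (hA1 a ha0 (by omega)) hSb]
  · have hs1 : s = {v} := by
      refine (Finset.eq_of_subset_of_card_le (by simpa using h.mem) ?_).symm
      rw [Finset.card_singleton]; omega
    have hm1 : m = 1 := by rw [← hm, hs1, Finset.card_singleton]
    subst hm1
    have hps : psum G y s v = 0 := by simp [psum, hs1]
    rw [hps] at he ⊢
    have hr : 0 < r := pos_of_mul_pos_left he (hy v).le
    have hc2 : cheb r 2 = r := by simp [cheb]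
    refine ⟨fun j h1 h2 => ?_, ?_, ?_⟩
    · obtain rfl | rfl : j = 1 ∨ j = 2 := by omega
      · simp [cheb]
      · rw [hc2]; exact hr
    · simp [cheb, mul_comm]
    · rintro ⟨a, ha, b, hb, -, hva, -⟩
      rw [hs1, Finset.mem_singleton] at ha
      exact absurd ha hva.ne'

/-- The Chebyshev values satisfy the eigenvalue recursion along the path; only the last vertex has
slack, equal to `cheb r (n + 1)`. -/
theorem rho_pathGraph_lt {r : ℝ} {n : ℕ} (hn : 1 ≤ n)
    (h : ∀ j, 1 ≤ j → j ≤ n + 1 → 0 < cheb r j) : rho (SimpleGraph.pathGraph n) < r := by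
  obtain ⟨m, rfl⟩ : ∃ m, n = m + 1 := ⟨n - 1, by omega⟩
  set f : Fin (m + 1) → ℝ := fun i => cheb r (i.val + 1) with hf
  have h0 : ∀ i, 0 < f i := fun i => h _ (by omega) (by omega)
  have h0' : ∀ i, 0 ≤ f i := fun i => (h0 i).le
  have key : ∀ i : Fin (m + 1), nsum (SimpleGraph.pathGraph (m + 1)) f i ≤
      r * f i - if i.val = m then cheb r (m + 2) else 0 := by
    intro i
    have hrec := cheb_add_two r i.val
    by_cases hm : i.val = m
    · rw [if_pos hm]
      have hfi : r * f i - cheb r (m + 2) = cheb r i.val := by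
        simp only [hf]; rw [hm] at hrec ⊢; linarith
      rw [hfi]
      by_cases hi : i.val = 0
      · rw [hi]
        refine (nsum_le_sum h0' (s := ∅) fun w hw => ?_).trans (by simp [cheb])
        rw [SimpleGraph.pathGraph_adj] at hw
        omega
      · refine (nsum_le_one h0' ⟨i.val - 1, by omega⟩ fun w hw => ?_).trans ?_
        · rw [SimpleGraph.pathGraph_adj] at hw
          rw [Fin.ext_iff]; simp only; omega
        · simp only [hf]
          rw [show i.val - 1 + 1 = i.val by omega]
    · rw [if_neg hm, sub_zero]
      by_cases hi : i.val = 0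
      · refine (nsum_le_one h0' ⟨i.val + 1, by omega⟩ fun w hw => ?_).trans ?_
        · rw [SimpleGraph.pathGraph_adj] at hw
          rw [Fin.ext_iff]; simp only; omega
        · simp only [hf, hi]
          simp [cheb]
      · refine (nsum_le_two h0' ⟨i.val - 1, by omega⟩ ⟨i.val + 1, by omega⟩ fun w hw => ?_).trans ?_
        · rw [SimpleGraph.pathGraph_adj] at hw
          simp only [Fin.ext_iff]; omega
        · simp only [hf]
          rw [show i.val - 1 + 1 = i.val by omega]
          have : cheb r (i.val + 1 + 1) = cheb r (i.val + 2) := rfl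
          linarith
  have hlast := h (m + 2) (by omega) (by omega)
  refine rho_lt_of_super (SimpleGraph.pathGraph_connected m) h0 (fun i => (key i).trans ?_)
    (Fin.last m) ((key _).trans_lt ?_)
  · split_ifs <;> linarith
  · rw [if_pos (Fin.val_last m)]; linarith

/-- The path has smaller spectral radius than any other tree of the same order. -/
theorem rho_pathGraph_lt_of_degree {G : SimpleGraph V} (hG : G.Connected) {w : V}
    (hw : 3 ≤ G.degree w) : rho (SimpleGraph.pathGraph (Fintype.card V)) < rho G := by
  obtain ⟨y, h0, hy⟩ := exists_perron hG
  have hps : ∀ v, psum G y Finset.univ v = rho G * y v := hy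
  have hb : IsBranch G y (rho G) Finset.univ w := by
    refine ⟨Finset.mem_univ _, fun u _ => ?_, fun u _ _ => (hps u).le⟩
    exact mem_of_closed hG (s := {u | Relation.ReflTransGen
      (fun a b => b ∈ Finset.univ ∧ G.Adj a b) w u}) Relation.ReflTransGen.refl
      (fun a ha b hab => Relation.ReflTransGen.tail ha ⟨Finset.mem_univ _, hab⟩) u
  rw [← G.card_neighborFinset_eq_degree] at hw
  obtain ⟨x₁, x₂, x₃, hx1, hx2, hx3, h12, h13, h23⟩ := Finset.two_lt_card_iff.1 hw
  rw [SimpleGraph.mem_neighborFinset] at hx1 hx2 hx3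
  -- Rooted at `w`, the whole graph is a branch of slack zero. Splitting it along one edge, with
  -- strictness from the two other neighbours of `w`, makes the Chebyshev values at `rho G` positive
  -- up to index n + 1.
  obtain ⟨A, B, hdis, hAB, hA, hB, hq⟩ := hb.split h0 (Finset.mem_univ x₁) hx1
  have hcard : A.card + B.card = Fintype.card V := by
    rw [← Finset.card_univ, ← hAB, Finset.card_union_of_disjoint hdis]
  have hApos : 0 < A.card := Finset.card_pos.2 ⟨w, hA.mem⟩
  have hBpos : 0 < B.card := Finset.card_pos.2 ⟨x₁, hB.mem⟩
  have hpsw : rho G * y w = psum G y A w + psum G y B w := by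
    rw [← hps, ← hAB, psum_union hdis]
  have ht : ∀ x ∈ B, x ≠ x₁ → G.Adj w x → y x₁ < psum G y B w := by
    intro x hx hne hwx
    have : y x₁ + y x ≤ psum G y B w := by
      rw [← Finset.sum_pair hne.symm]
      refine sum_le_psum h0 fun z hz => ?_
      rw [Finset.mem_insert, Finset.mem_singleton] at hz
      rcases hz with rfl | rfl
      · exact ⟨hB.mem, hx1⟩
      · exact ⟨hx, hwx⟩
    linarith [h0 x]
  have ht1 : y x₁ ≤ psum G y B w := by
    simpa using sum_le_psum (G := G) h0 (s := B) (t := {x₁}) (u := w) (by simp [hB.mem, hx1])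
  have hyw := h0 w
  have hyu := h0 x₁
  obtain ⟨hA1, hA2, hA3⟩ := IsBranch.cheb_pos h0 A.card A w rfl hA (by linarith)
  obtain ⟨hB1, hB2, -⟩ := IsBranch.cheb_pos h0 B.card B x₁ rfl hB (by linarith)
  have hSb := hB1 B.card (by omega) (by omega)
  obtain ⟨-, hc⟩ := branch_combine (e := 0) ht1 (hA1 A.card (by omega) (by omega))
    (hB1 (B.card + 1) (by omega) le_rfl) hSb.le hq (by rw [hpsw]; ring) hA2 hB2
  have hmem : ∀ x, x ∈ A ∨ x ∈ B := fun x => by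
    rw [← Finset.mem_union, hAB]; exact Finset.mem_univ x
  have hstrict := hc (by
    rcases hmem x₂ with h2 | h2
    · rcases hmem x₃ with h3 | h3
      · exact Or.inl (hA3 ⟨x₂, h2, x₃, h3, h23, hx2, hx3⟩)
      · exact Or.inr (ht x₃ h3 h13.symm hx3)
    · exact Or.inr (ht x₂ h2 h12.symm hx2))
  rw [zero_mul] at hstrict
  have hD := pos_of_mul_pos_right hstrict hyw.le
  have hpos := cheb_pos_of_lt hA1 hB1 (by linarith)
  rw [hcard] at hpos
  exact rho_pathGraph_lt (by omega) hpos

theorem IsMinimizer.isTree_and_iso_pathGraph {n : ℕ} (hn : 1 ≤ n) {T : SimpleGraph V}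
    (hT : IsMinimizer n ((n + 1) / 2) T) :
    T.IsTree ∧ Nonempty (SimpleGraph.pathGraph n ≃g T) := by
  have hr := hT.rho_le (pathGraph_inClass hn)
  obtain ⟨T₀, hle, hT₀⟩ := hT.mem.connected.exists_isTree_le
  have hd : ∀ v, T₀.degree v ≤ 2 := by
    intro v
    by_contra! hv
    have h1 := rho_pathGraph_lt_of_degree hT₀.connected hv
    have h2 := rho_mono hT₀.connected hle
    rw [hT.mem.order] at h1
    linarith
  obtain ⟨φ⟩ := nonempty_iso_pathGraph hT₀ hd
  rw [hT.mem.order] at φ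
  obtain rfl := hT.eq_of_le ((pathGraph_inClass hn).of_iso φ) hle
  exact ⟨hT₀, ⟨φ⟩⟩

/-! ### Diametral paths, depth and parents. -/

theorem dist_swap (G : SimpleGraph V) (u v : V) : G.dist u v = G.dist v u :=
  SimpleGraph.dist_comm

/-- In a tree, the neighbour that is closer to a given vertex is unique. -/
theorem eq_of_closer {G : SimpleGraph V} (hG : G.IsTree) {a v u w : V} (hu : G.Adj v u)
    (hw : G.Adj v w) (hu' : G.dist a v = G.dist a u + 1) (hw' : G.dist a v = G.dist a w + 1) :
    u = w := by
  obtain ⟨p, hp, hpl⟩ := hG.connected.exists_path_of_dist u a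
  obtain ⟨q, hq, hql⟩ := hG.connected.exists_path_of_dist w a
  rw [dist_swap] at hpl hql
  have h1 : (p.cons hu).IsPath := SimpleGraph.Walk.isPath_of_length_eq_dist _ (by
    rw [SimpleGraph.Walk.length_cons, hpl, dist_swap G v, hu'])
  have h2 : (q.cons hw).IsPath := SimpleGraph.Walk.isPath_of_length_eq_dist _ (by
    rw [SimpleGraph.Walk.length_cons, hql, dist_swap G v, hw'])
  have h3 := (hG.existsUnique_path v a).unique h1 h2
  injection h3

theorem exists_closer {G : SimpleGraph V} (hG : G.Connected) {a v : V} (h : v ≠ a) :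
    ∃ u, G.Adj v u ∧ G.dist a v = G.dist a u + 1 := by
  obtain ⟨p, hp⟩ := hG.exists_walk_length_eq_dist v a
  cases p with
  | nil => exact absurd rfl h
  | cons hadj q =>
    rename_i u
    refine ⟨u, hadj, ?_⟩
    rw [SimpleGraph.Walk.length_cons] at hp
    have h1 := G.dist_le q
    have h2 := hG.dist_triangle (u := a) (v := u) (w := v)
    rw [SimpleGraph.dist_eq_one_iff_adj.2 hadj.symm] at h2
    rw [dist_swap G v] at hp
    rw [dist_swap G u] at h1
    omega

theorem dist_iso_le {G : SimpleGraph V} {H : SimpleGraph W} (hG : G.Connected) (φ : G ≃g H)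
    (u v : V) : H.dist (φ u) (φ v) ≤ G.dist u v := by
  obtain ⟨p, hp⟩ := hG.exists_walk_length_eq_dist u v
  have := H.dist_le (p.map φ.toHom)
  rw [SimpleGraph.Walk.length_map, hp] at this
  exact this

theorem dist_iso {G : SimpleGraph V} {H : SimpleGraph W} (hG : G.Connected) (φ : G ≃g H)
    (u v : V) : H.dist (φ u) (φ v) = G.dist u v := by
  refine le_antisymm (dist_iso_le hG φ u v) ?_
  simpa using dist_iso_le (φ.connected_iff.1 hG) φ.symm (φ u) (φ v)

/-- A diametral pair `a`, `b` of a tree with a bipartition `C`, `Cᶜ` in which every vertex of `Cᶜ`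
has degree two. -/
structure IsFrame (G : SimpleGraph V) (C : Finset V) (a b : V) : Prop where
  tree : G.IsTree
  cover : IsCover G C
  indep : ∀ a ∈ C, ∀ b ∈ C, ¬ G.Adj a b
  degree_eq : ∀ v ∉ C, G.degree v = 2
  dist_le : ∀ u v, G.dist u v ≤ G.dist a b

namespace IsFrame

variable {G : SimpleGraph V} {C : Finset V} {a b : V}

theorem symm (h : IsFrame G C a b) : IsFrame G C b a :=
  ⟨h.tree, h.cover, h.indep, h.degree_eq, by rw [dist_swap G b a]; exact h.dist_le⟩

/-- If `a` had degree two, both neighbours would be nearer to `b` by the maximality of `G.dist a b`,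
but the nearer neighbour in a tree is unique. -/
theorem left_mem (h : IsFrame G C a b) : a ∈ C := by
  by_contra ha
  obtain ⟨u, w, huw, hu⟩ : ∃ u w, u ≠ w ∧ G.neighborFinset a = {u, w} :=
    Finset.card_eq_two.1 (h.degree_eq a ha)
  have hau : G.Adj a u := by rw [← G.mem_neighborFinset, hu]; simp
  have haw : G.Adj a w := by rw [← G.mem_neighborFinset, hu]; simp
  have h1 := h.tree.dist_eq_dist_add_one_of_adj b hau
  have h2 := h.tree.dist_eq_dist_add_one_of_adj b haw
  have h3 := h.dist_le b u
  have h4 := h.dist_le b w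
  rw [dist_swap G a b] at h3 h4
  exact huw (eq_of_closer (a := b) h.tree hau haw (by omega) (by omega))

theorem right_mem (h : IsFrame G C a b) : b ∈ C := h.symm.left_mem

theorem mem_iff_not_mem_of_adj (h : IsFrame G C a b) {u v : V} (huv : G.Adj u v) :
    u ∈ C ↔ v ∉ C :=
  ⟨fun hu hv => h.indep u hu v hv huv, fun hv => (h.cover huv).resolve_right hv⟩

theorem even_dist_iff (h : IsFrame G C a b) (v : V) : Even (G.dist a v) ↔ v ∈ C := by
  have := mem_of_closed h.tree.connected (s := {v | Even (G.dist a v) ↔ v ∈ C}) (u := a)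
    (by simp [h.left_mem]) (fun u hu w huw => by
      have hu : Even (G.dist a u) ↔ u ∈ C := hu
      show Even (G.dist a w) ↔ w ∈ C
      have h1 := h.mem_iff_not_mem_of_adj huw
      rcases h.tree.dist_eq_dist_add_one_of_adj a huw with h2 | h2
      · rw [h2, Nat.even_add_one, h1] at hu
        tauto
      · rw [h2, Nat.even_add_one, hu, h1]
        tauto)
  exact this v

theorem even_dist (h : IsFrame G C a b) : Even (G.dist a b) :=
  (h.even_dist_iff b).2 h.right_mem

theorem dist_add (h : IsFrame G C a b) (v : V) :
    G.dist a b ≤ G.dist a v + G.dist b v ∧ G.dist a v ≤ G.dist a b ∧ G.dist b v ≤ G.dist a b ∧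
      G.dist a v % 2 = G.dist b v % 2 := by
  refine ⟨?_, h.dist_le _ _, h.dist_le _ _, ?_⟩
  · have := h.tree.connected.dist_triangle (u := a) (v := v) (w := b)
    rwa [dist_swap G v b] at this
  · have h1 := h.even_dist_iff v
    have h2 := h.symm.even_dist_iff v
    rw [Nat.even_iff] at h1 h2
    by_cases hv : v ∈ C
    · rw [h1.2 hv, h2.2 hv]
    · have h3 : ¬ G.dist a v % 2 = 0 := fun h => hv (h1.1 h)
      have h4 : ¬ G.dist b v % 2 = 0 := fun h => hv (h2.1 h)
      omega

/-- The vertices of the path from `a` to `b`. -/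
theorem eq_getVert (h : IsFrame G C a b) {p : G.Walk a b} (hp : p.IsPath) {v : V}
    (hv : G.dist a v + G.dist b v = G.dist a b) : v = p.getVert (G.dist a v) := by
  obtain ⟨q, hq⟩ := h.tree.connected.exists_walk_length_eq_dist a v
  obtain ⟨r, hr⟩ := h.tree.connected.exists_walk_length_eq_dist v b
  have h1 : (q.append r).IsPath := SimpleGraph.Walk.isPath_of_length_eq_dist _ (by
    rw [SimpleGraph.Walk.length_append, hq, hr, dist_swap G v b, hv])
  have h2 := (h.tree.existsUnique_path a b).unique hp h1
  rw [h2, SimpleGraph.Walk.getVert_append, hq]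
  simp

theorem length_eq (h : IsFrame G C a b) {p : G.Walk a b} (hp : p.IsPath) :
    p.length = G.dist a b := by
  obtain ⟨q, hq, hql⟩ := h.tree.connected.exists_path_of_dist a b
  rw [(h.tree.existsUnique_path a b).unique hp hq, hql]

theorem dist_getVert (h : IsFrame G C a b) {p : G.Walk a b} (hp : p.IsPath) {i : ℕ}
    (hi : i ≤ G.dist a b) :
    G.dist a (p.getVert i) = i ∧ G.dist b (p.getVert i) = G.dist a b - i := by
  have h1 := G.dist_le (p.take i)
  have h2 := G.dist_le (p.drop i)
  rw [SimpleGraph.Walk.take_length, h.length_eq hp] at h1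
  rw [SimpleGraph.Walk.drop_length, h.length_eq hp, dist_swap] at h2
  have h3 := (h.dist_add (p.getVert i)).1
  omega

/-- A neighbour of `v` which is closer to `a` is closer to `b` unless `v` is on the path from `a`
to `b`. -/
theorem closer_right (h : IsFrame G C a b) {v u : V} (hvu : G.Adj v u)
    (hu : G.dist a v = G.dist a u + 1) (hv : G.dist a v + G.dist b v ≠ G.dist a b) :
    G.dist b v = G.dist b u + 1 := by
  by_contra hne
  have h1 := (h.tree.dist_eq_dist_add_one_of_adj b hvu).resolve_left hne
  clear hne
  apply hv
  clear hv
  -- Once a step towards `a` leads away from `b`, so does every later one, since the unique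
  -- neighbour of `u` nearer to `b` is `v`. On reaching `a` this puts `v` on the path.
  obtain ⟨n, hn⟩ : ∃ n, G.dist a v = n := ⟨_, rfl⟩
  induction n generalizing v u with
  | zero => omega
  | succ n ih =>
    by_cases hua : u = a
    · subst hua
      rw [dist_swap G b u, SimpleGraph.dist_self] at *
      have := SimpleGraph.dist_self (G := G) (v := u)
      omega
    · obtain ⟨w, huw, hw⟩ := exists_closer h.tree.connected hua
      have h2 : G.dist b w = G.dist b u + 1 := by
        rcases h.tree.dist_eq_dist_add_one_of_adj b huw with h3 | h3
        · have := eq_of_closer h.tree huw hvu.symm h3 h1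
          subst this
          omega
        · exact h3
      have := ih huw hw h2 (by omega)
      omega

theorem closer_left (h : IsFrame G C a b) {v u : V} (hvu : G.Adj v u)
    (hu : G.dist b v = G.dist b u + 1) (hv : G.dist a v + G.dist b v ≠ G.dist a b) :
    G.dist a v = G.dist a u + 1 :=
  h.symm.closer_right hvu hu (by rwa [add_comm, dist_swap G b a])

/-- The distance of a vertex from the path. -/
noncomputable def depth (G : SimpleGraph V) (a b v : V) : ℕ :=
  (G.dist a v + G.dist b v - G.dist a b) / 2

/-- The halving is exact: the two distances have the same parity and `G.dist a b` is even. -/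
theorem depth_spec (h : IsFrame G C a b) (v : V) :
    G.dist a v + G.dist b v = G.dist a b + 2 * depth G a b v := by
  have h1 := h.dist_add v
  have h2 := Nat.even_iff.1 h.even_dist
  unfold depth
  omega

theorem exists_parent (h : IsFrame G C a b) {v : V} (hv : 0 < depth G a b v) :
    ∃ u, G.Adj v u ∧ G.dist a v = G.dist a u + 1 ∧ depth G a b v = depth G a b u + 1 := by
  have h1 := h.depth_spec v
  have hva : v ≠ a := by
    rintro rfl
    rw [SimpleGraph.dist_self, dist_swap] at h1
    omega
  obtain ⟨u, hvu, hu⟩ := exists_closer h.tree.connected hva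
  have h2 := h.closer_right hvu hu (by omega)
  have h3 := h.depth_spec u
  exact ⟨u, hvu, hu, by omega⟩

/-- The neighbour in the direction of the path. -/
noncomputable def parent (h : IsFrame G C a b) (v : V) : V :=
  if hv : 0 < depth G a b v then (h.exists_parent hv).choose else v

theorem parent_spec (h : IsFrame G C a b) {v : V} (hv : 0 < depth G a b v) :
    G.Adj v (h.parent v) ∧ G.dist a v = G.dist a (h.parent v) + 1 ∧
      depth G a b v = depth G a b (h.parent v) + 1 := by
  rw [parent, dif_pos hv]
  exact (h.exists_parent hv).choose_spec

theorem eq_parent (h : IsFrame G C a b) {v u : V} (hvu : G.Adj v u)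
    (hu : depth G a b v = depth G a b u + 1) : u = h.parent v := by
  obtain ⟨h1, h2, h3⟩ := h.parent_spec (v := v) (by omega)
  refine eq_of_closer h.tree hvu h1 ?_ h2
  have h4 := h.depth_spec u
  have h5 := h.depth_spec v
  have h6 := h.tree.dist_eq_dist_add_one_of_adj a hvu
  have h7 := h.tree.dist_eq_dist_add_one_of_adj b hvu
  omega

/-- A neighbour of a vertex off the path is either its parent, or it is deeper. -/
theorem depth_of_adj (h : IsFrame G C a b) {v u : V} (hv : 0 < depth G a b v) (hvu : G.Adj v u)
    (hu : u ≠ h.parent v) : depth G a b u = depth G a b v + 1 := by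
  have h4 := h.depth_spec u
  have h5 := h.depth_spec v
  have h6 := h.tree.dist_eq_dist_add_one_of_adj a hvu
  have h7 := h.tree.dist_eq_dist_add_one_of_adj b hvu
  rcases h6 with h6 | h6
  · have := h.closer_right hvu h6 (by omega)
    exact absurd (h.eq_parent hvu (by omega)) hu
  · rcases h7 with h7 | h7
    · have := h.closer_left hvu h7 (by omega)
      omega
    · omega

theorem depth_mod_two (h : IsFrame G C a b) {v : V} (hv : 0 < depth G a b v) :
    v ∈ C ↔ h.parent v ∉ C := h.mem_iff_not_mem_of_adj (h.parent_spec hv).1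

/-- On the path, a vertex outside `C` has all its neighbours on the path. -/
theorem depth_eq_zero_of_adj (h : IsFrame G C a b) {v u : V} (hv : depth G a b v = 0)
    (hvC : v ∉ C) (hvu : G.Adj v u) : depth G a b u = 0 := by
  have hva : v ≠ a := by rintro rfl; exact hvC h.left_mem
  have hvb : v ≠ b := by rintro rfl; exact hvC h.right_mem
  obtain ⟨x, hvx, hx⟩ := exists_closer h.tree.connected hva
  obtain ⟨z, hvz, hz⟩ := exists_closer h.tree.connected hvb
  have h1 := h.depth_spec v
  have h2 := h.depth_spec x
  have h3 := h.depth_spec z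
  have h4 := h.tree.dist_eq_dist_add_one_of_adj b hvx
  have h5 := h.tree.dist_eq_dist_add_one_of_adj a hvz
  have hxz : x ≠ z := by rintro rfl; omega
  rcases eq_or_eq_of_degree_le_two (h.degree_eq v hvC).le hxz hvx hvz hvu with rfl | rfl <;> omega

/-- A path vertex outside `C` spends both its edges on the path, so vertices of depth one hang on
`C`. From there membership alternates with depth. -/
theorem mem_iff_even_depth (h : IsFrame G C a b) {v : V} (hv : 0 < depth G a b v) :
    v ∈ C ↔ Even (depth G a b v) := by
  obtain ⟨n, hn⟩ : ∃ n, depth G a b v = n + 1 := ⟨depth G a b v - 1, by omega⟩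
  induction n generalizing v with
  | zero =>
    obtain ⟨h1, h2, h3⟩ := h.parent_spec hv
    have h4 : h.parent v ∈ C := by
      by_contra hC
      have := h.depth_eq_zero_of_adj (by omega) hC h1.symm
      omega
    rw [h.depth_mod_two hv, hn]
    simp [h4]
  | succ n ih =>
    obtain ⟨h1, h2, h3⟩ := h.parent_spec hv
    rw [h.depth_mod_two hv, ih (by omega) (by omega), h3, Nat.even_add_one]

/-- Together with `parent_inj` this gives each vertex outside `C` and off the path exactly one
child. These pairs are the edges x y of the layers. -/
theorem exists_child (h : IsFrame G C a b) {x : V} (hx : 0 < depth G a b x) (hxC : x ∉ C) :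
    ∃ v ∈ C, 0 < depth G a b v ∧ h.parent v = x := by
  obtain ⟨u, hu, hxu⟩ := exists_adj_ne (h.degree_eq x hxC).ge (h.parent x)
  have h1 := h.depth_of_adj hx hxu hu
  exact ⟨u, (h.cover hxu).resolve_left hxC, by omega, (h.eq_parent hxu.symm h1).symm⟩

theorem parent_inj (h : IsFrame G C a b) {u v : V} (hu : u ∈ C) (hu0 : 0 < depth G a b u)
    (hv0 : 0 < depth G a b v) (huv : h.parent u = h.parent v) : u = v := by
  obtain ⟨h1, h2, h3⟩ := h.parent_spec hu0
  obtain ⟨h4, h5, h6⟩ := h.parent_spec hv0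
  rw [← huv] at h4 h5 h6
  have hx : h.parent u ∉ C := (h.depth_mod_two hu0).1 hu
  have heu := (h.mem_iff_even_depth hu0).1 hu
  have hx0 : 0 < depth G a b (h.parent u) := by
    by_contra h0
    rw [show depth G a b u = 1 by omega] at heu
    exact absurd heu (by decide)
  obtain ⟨h7, h8, h9⟩ := h.parent_spec hx0
  by_contra hne
  rcases eq_or_eq_of_degree_le_two (h.degree_eq _ hx).le hne h1.symm h4.symm h7 with h10 | h10
  · rw [h10] at h9; omega
  · rw [h10] at h9; omega

/-- In `depth_spec` both distances are at most `G.dist a b`. This yields h ≤ ⌊d/4⌋ and keeps the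
first layer away from the ends of the path. -/
theorem depth_bounds (h : IsFrame G C a b) (v : V) : 2 * depth G a b v ≤ G.dist a b ∧
    2 * depth G a b v ≤ G.dist a v ∧ G.dist a v ≤ G.dist a b := by
  have h1 := h.depth_spec v
  have h2 := h.dist_add v
  omega

end IsFrame

theorem exists_isFrame {G : SimpleGraph V} {C : Finset V} (hG : G.IsTree) (hC : IsCover G C)
    (hi : ∀ a ∈ C, ∀ b ∈ C, ¬ G.Adj a b) (hd : ∀ v ∉ C, G.degree v = 2) :
    ∃ a b, IsFrame G C a b := by
  have := hG.connected.nonempty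
  obtain ⟨a, b, hab⟩ := G.exists_dist_eq_diam
  refine ⟨a, b, hG, hC, hi, hd, fun u v => ?_⟩
  rw [hab]
  exact SimpleGraph.dist_le_diam (SimpleGraph.connected_iff_ediam_ne_top.1 hG.connected)

theorem diam_eq {G : SimpleGraph V} (hG : G.Connected) {a b : V}
    (h : ∀ u v, G.dist u v ≤ G.dist a b) : G.diam = G.dist a b := by
  have := hG.nonempty
  obtain ⟨u, v, huv⟩ := G.exists_dist_eq_diam
  refine le_antisymm (huv ▸ h u v) ?_
  exact SimpleGraph.dist_le_diam (SimpleGraph.connected_iff_ediam_ne_top.1 hG)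

/-! ### The layers of a frame and the isomorphism with a main tree. -/

namespace MainTreeData

theorem rel_ne (D : MainTreeData) {x y : D.Vertex} (h : D.rel x y) : x ≠ y := by
  rintro rfl
  rcases x with i | x | x
  · exact absurd h (Nat.succ_ne_self _)
  · exact h
  · exact h

theorem adj_of_rel (D : MainTreeData) {x y : D.Vertex} (h : D.rel x y) : D.graph.Adj x y :=
  (SimpleGraph.fromRel_adj _ _ _).2 ⟨D.rel_ne h, Or.inl h⟩

theorem two_mul_succ_lt (D : MainTreeData) {s : ℕ} (hs : s = 0) (t : Fin (D.size s)) :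
    2 * (t.val + 1) < D.d + 1 := by
  subst hs
  have : t.val < D.d / 2 - 1 := t.isLt.trans_eq D.size_zero
  omega

theorem connected (D : MainTreeData) : D.graph.Connected := by
  have hA : ∀ i (hi : i < D.d + 1), D.graph.Reachable (.inl 0) (.inl ⟨i, hi⟩) := by
    intro i
    induction i with
    | zero => intro _; exact SimpleGraph.Reachable.refl _
    | succ i ih =>
      intro hi
      exact (ih (by omega)).trans (D.adj_of_rel (x := .inl ⟨i, by omega⟩)
        (y := .inl ⟨i + 1, hi⟩) rfl).reachable
  have hxy : ∀ s j, D.graph.Adj (.inr (.inl ⟨s, j⟩)) (.inr (.inr ⟨s, j⟩)) := fun s j =>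
    D.adj_of_rel (Or.inl ⟨rfl, rfl⟩)
  have hB : ∀ s (hs : s < D.h) j, D.graph.Reachable (.inl 0) (.inr (.inl ⟨⟨s, hs⟩, j⟩)) := by
    intro s
    induction s with
    | zero =>
      intro hs j
      refine (hA _ (D.two_mul_succ_lt rfl (D.σ 0 hs j))).trans (D.adj_of_rel
        (x := .inr (.inl ⟨⟨0, hs⟩, j⟩)) (y := .inl _) ⟨rfl, rfl⟩).symm.reachable
    | succ s ih =>
      intro hs j
      refine ((ih (by omega) (D.σ (s + 1) hs j)).trans (hxy _ _).reachable).trans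
        (D.adj_of_rel (x := .inr (.inl ⟨⟨s + 1, hs⟩, j⟩)) (y := .inr (.inr _))
          (Or.inr ⟨rfl, rfl⟩)).symm.reachable
  have hall : ∀ x, D.graph.Reachable (.inl 0) x := by
    rintro (i | ⟨s, j⟩ | ⟨s, j⟩)
    · exact hA i i.isLt
    · exact hB s s.isLt j
    · exact (hB s s.isLt j).trans (hxy s j).reachable
  have : Nonempty D.Vertex := ⟨.inl 0⟩
  exact ⟨fun x y => (hall x).symm.trans (hall y)⟩

theorem mem_V₁_iff (D : MainTreeData) (x : D.Vertex) : x ∈ D.V₁ ↔ x ∉ D.V₂ := by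
  rcases x with i | x | x
  · exact Nat.not_even_iff_odd.symm
  · exact ⟨fun _ h => h, fun _ => trivial⟩
  · exact ⟨fun h => h.elim, fun h => h trivial⟩

end MainTreeData

namespace IsFrame

variable {G : SimpleGraph V} {C : Finset V} {a b : V}

theorem grandparent_spec (h : IsFrame G C a b) {v : V} (hv : v ∈ C) (h0 : 0 < depth G a b v) :
    0 < depth G a b (h.parent v) ∧ h.parent v ∉ C ∧ h.parent (h.parent v) ∈ C ∧
      G.Adj (h.parent v) (h.parent (h.parent v)) ∧
      depth G a b v = depth G a b (h.parent (h.parent v)) + 2 ∧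
      G.dist a v = G.dist a (h.parent (h.parent v)) + 2 := by
  obtain ⟨h1, h2, h3⟩ := h.parent_spec h0
  have hx : h.parent v ∉ C := (h.depth_mod_two h0).1 hv
  have hev := (h.mem_iff_even_depth h0).1 hv
  have hx0 : 0 < depth G a b (h.parent v) := by
    by_contra hx0
    rw [show depth G a b v = 1 by omega] at hev
    exact absurd hev (by decide)
  obtain ⟨h4, h5, h6⟩ := h.parent_spec hx0
  exact ⟨hx0, hx, (h.mem_iff_not_mem_of_adj h4.symm).2 hx, h4, by omega, by omega⟩

/-- The vertices of `C` in the `s`-th layer. -/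
noncomputable def layer (G : SimpleGraph V) (C : Finset V) (a b : V) (s : ℕ) : Finset V :=
  C.filter fun v => depth G a b v = 2 * s

theorem mem_layer {s : ℕ} {v : V} : v ∈ layer G C a b s ↔ v ∈ C ∧ depth G a b v = 2 * s :=
  Finset.mem_filter

theorem grandparent_mem (h : IsFrame G C a b) {s : ℕ} {v : V}
    (hv : v ∈ layer G C a b (s + 1)) : h.parent (h.parent v) ∈ layer G C a b s := by
  rw [mem_layer] at hv ⊢
  obtain ⟨-, -, h1, -, h2, -⟩ := h.grandparent_spec hv.1 (by omega)
  exact ⟨h1, by omega⟩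

/-- The value at zero is |M_0|, the number of even inner path vertices; the two ends of the path
also belong to `C` but are not counted. -/
noncomputable def layerSize (G : SimpleGraph V) (C : Finset V) (a b : V) : ℕ → ℕ
  | 0 => G.dist a b / 2 - 1
  | s + 1 => (layer G C a b (s + 1)).card

noncomputable def layerEquiv (G : SimpleGraph V) (C : Finset V) (a b : V) (s : ℕ) :
    Fin (layerSize G C a b (s + 1)) ≃ {v // v ∈ layer G C a b (s + 1)} :=
  (layer G C a b (s + 1)).equivFin.symm

theorem foot_spec (h : IsFrame G C a b) {v : V} (hv : v ∈ layer G C a b 1) :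
    depth G a b (h.parent (h.parent v)) = 0 ∧
      G.dist a (h.parent (h.parent v)) % 2 = 0 ∧ 2 ≤ G.dist a (h.parent (h.parent v)) ∧
      G.dist a (h.parent (h.parent v)) + 2 ≤ G.dist a b := by
  rw [mem_layer] at hv
  obtain ⟨-, -, h1, -, h2, h3⟩ := h.grandparent_spec hv.1 (by omega)
  have h4 := h.depth_bounds v
  exact ⟨by omega, Nat.even_iff.1 ((h.even_dist_iff _).2 h1), by omega, by omega⟩

/-- For the first layer the foot v_{2i} on the path corresponds to the edge of M_0 with index i - 1,
which explains the half distance minus one. -/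
noncomputable def attach (h : IsFrame G C a b) :
    ∀ s, Fin (layerSize G C a b (s + 1)) → Fin (layerSize G C a b s)
  | 0, j => ⟨G.dist a (h.parent (h.parent (layerEquiv G C a b 0 j).1)) / 2 - 1, by
      have := h.foot_spec (layerEquiv G C a b 0 j).2
      rw [layerSize]
      omega⟩
  | s + 1, j => (layerEquiv G C a b s).symm
      ⟨h.parent (h.parent (layerEquiv G C a b (s + 1) j).1),
        h.grandparent_mem (layerEquiv G C a b (s + 1) j).2⟩

theorem layerEquiv_attach (h : IsFrame G C a b) (s : ℕ) (j) :
    (layerEquiv G C a b s (h.attach (s + 1) j)).1 =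
      h.parent (h.parent (layerEquiv G C a b (s + 1) j).1) := by
  show (layerEquiv G C a b s ((layerEquiv G C a b s).symm ⟨_, _⟩)).1 = _
  rw [Equiv.apply_symm_apply]

noncomputable def height (G : SimpleGraph V) (C : Finset V) (a b : V) : ℕ :=
  C.sup fun v => depth G a b v / 2

/-- Repeated grandparents of a deepest vertex of `C` visit every lower layer. -/
theorem layer_nonempty (h : IsFrame G C a b) {s : ℕ} (h1 : 1 ≤ s) (hs : s ≤ height G C a b) :
    (layer G C a b s).Nonempty := by
  obtain ⟨v, hv, hvH⟩ := C.exists_mem_eq_sup ⟨a, h.left_mem⟩ fun v => depth G a b v / 2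
  have hH : height G C a b = depth G a b v / 2 := hvH
  have hv0 : 0 < depth G a b v := by omega
  have hev := Nat.even_iff.1 ((h.mem_iff_even_depth hv0).1 hv)
  have htop : (layer G C a b (height G C a b)).Nonempty :=
    ⟨v, mem_layer.2 ⟨hv, by omega⟩⟩
  induction hs using Nat.decreasingInduction with
  | self => exact htop
  | of_succ s hs ih =>
    obtain ⟨w, hw⟩ := ih (by omega)
    exact ⟨_, h.grandparent_mem hw⟩

/-- The parameters of the main tree. -/
noncomputable def data (h : IsFrame G C a b) : MainTreeData where
  d := G.dist a b
  h := height G C a b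
  size := layerSize G C a b
  even_d := h.even_dist
  size_zero := rfl
  size_pos := by
    intro s h1 hs
    obtain ⟨t, rfl⟩ : ∃ t, s = t + 1 := ⟨s - 1, by omega⟩
    exact Finset.card_pos.2 (h.layer_nonempty h1 hs)
  σ := fun s _ j => h.attach s j

noncomputable def path (h : IsFrame G C a b) : G.Walk a b :=
  (h.tree.connected.exists_path_of_dist a b).choose

theorem isPath_path (h : IsFrame G C a b) : h.path.IsPath :=
  (h.tree.connected.exists_path_of_dist a b).choose_spec.1

theorem length_path (h : IsFrame G C a b) : h.path.length = G.dist a b :=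
  (h.tree.connected.exists_path_of_dist a b).choose_spec.2

noncomputable def toVertex (h : IsFrame G C a b) : h.data.Vertex → V
  | .inl i => h.path.getVert i.val
  | .inr (.inl ⟨s, j⟩) => h.parent (layerEquiv G C a b s.val j).1
  | .inr (.inr ⟨s, j⟩) => (layerEquiv G C a b s.val j).1

theorem layerEquiv_spec {s : ℕ} (j : Fin (layerSize G C a b (s + 1))) :
    (layerEquiv G C a b s j).1 ∈ C ∧ depth G a b (layerEquiv G C a b s j).1 = 2 * (s + 1) :=
  mem_layer.1 (layerEquiv G C a b s j).2

theorem depth_getVert (h : IsFrame G C a b) {i : ℕ} (hi : i < G.dist a b + 1) :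
    depth G a b (h.path.getVert i) = 0 := by
  have h1 := h.dist_getVert h.isPath_path (i := i) (by omega)
  have h2 := h.depth_spec (h.path.getVert i)
  omega

theorem eq_getVert_of_depth (h : IsFrame G C a b) {v : V} (hv : depth G a b v = 0) :
    v = h.path.getVert (G.dist a v) :=
  h.eq_getVert h.isPath_path (by have := h.depth_spec v; omega)

theorem adj_of_rel (h : IsFrame G C a b) {x y : h.data.Vertex} (hxy : h.data.rel x y) :
    G.Adj (h.toVertex x) (h.toVertex y) := by
  rcases x with i | ⟨s, j⟩ | ⟨s, j⟩ <;> rcases y with i' | ⟨s', j'⟩ | ⟨s', j'⟩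
  · have hii : i.val + 1 = i'.val := hxy
    have := i'.isLt
    show G.Adj (h.path.getVert i.val) (h.path.getVert i'.val)
    rw [← hii]
    refine h.path.adj_getVert_succ ?_
    rw [h.length_path]
    have : i'.val < G.dist a b + 1 := i'.isLt
    omega
  · exact hxy.elim
  · exact hxy.elim
  · obtain ⟨s, hs⟩ := s
    obtain ⟨hs0, hi⟩ : s = 0 ∧ i'.val = 2 * ((h.attach s j).val + 1) := hxy
    subst hs0
    show G.Adj (h.parent (layerEquiv G C a b 0 j).1) (h.path.getVert i'.val)
    obtain ⟨hvC, hvd⟩ := layerEquiv_spec (G := G) (C := C) (a := a) (b := b) (s := 0) j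
    obtain ⟨-, -, -, h1, -⟩ := h.grandparent_spec hvC (by omega)
    have h2 := h.foot_spec (layerEquiv G C a b 0 j).2
    have h3 : i'.val = G.dist a (h.parent (h.parent (layerEquiv G C a b 0 j).1)) := by
      rw [hi]
      show 2 * (G.dist a (h.parent (h.parent (layerEquiv G C a b 0 j).1)) / 2 - 1 + 1) = _
      omega
    rw [h3, ← h.eq_getVert_of_depth h2.1]
    exact h1
  · exact hxy.elim
  · obtain ⟨s, hs⟩ := s
    obtain ⟨s', hs'⟩ := s'
    obtain ⟨hvC, hvd⟩ := layerEquiv_spec (G := G) (C := C) (a := a) (b := b) (s := s) j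
    have hv0 : 0 < depth G a b (layerEquiv G C a b s j).1 := by omega
    have hxy : (s = s' ∧ j.val = j'.val) ∨ (s = s' + 1 ∧ (h.attach s j).val = j'.val) := hxy
    show G.Adj (h.parent (layerEquiv G C a b s j).1) (layerEquiv G C a b s' j').1
    rcases hxy with ⟨h1, h2⟩ | ⟨h1, h2⟩
    · subst h1
      obtain rfl : j = j' := Fin.ext h2
      exact (h.parent_spec hv0).1.symm
    · subst h1
      obtain rfl : h.attach (s' + 1) j = j' := Fin.ext h2
      have h3 := (h.grandparent_spec hvC hv0).2.2.2.1
      have h4 := h.layerEquiv_attach s' j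
      exact h4 ▸ h3
  · exact hxy.elim
  · exact hxy.elim
  · exact hxy.elim

theorem depth_toVertex (h : IsFrame G C a b) (x : h.data.Vertex) :
    depth G a b (h.toVertex x) = match x with
      | .inl _ => 0
      | .inr (.inl ⟨s, _⟩) => 2 * s.val + 1
      | .inr (.inr ⟨s, _⟩) => 2 * s.val + 2 := by
  rcases x with i | ⟨s, j⟩ | ⟨s, j⟩
  · exact h.depth_getVert i.isLt
  · obtain ⟨hvC, hvd⟩ := layerEquiv_spec (G := G) (C := C) (a := a) (b := b) j
    have := (h.parent_spec (v := (layerEquiv G C a b s.val j).1) (by omega)).2.2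
    show depth G a b (h.parent (layerEquiv G C a b s.val j).1) = 2 * s.val + 1
    omega
  · exact (layerEquiv_spec (G := G) (C := C) (a := a) (b := b) j).2

theorem toVertex_mem_iff (h : IsFrame G C a b) (x : h.data.Vertex) :
    h.toVertex x ∈ C ↔ x ∈ h.data.V₂ := by
  rcases x with i | ⟨s, j⟩ | ⟨s, j⟩
  · have hi : i.val < G.dist a b + 1 := i.isLt
    have := (h.dist_getVert h.isPath_path (i := i.val) (by omega)).1
    show h.path.getVert i.val ∈ C ↔ Even i.val
    rw [← h.even_dist_iff, this]
  · obtain ⟨hvC, hvd⟩ := layerEquiv_spec (G := G) (C := C) (a := a) (b := b) j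
    exact ⟨fun hx => (h.grandparent_spec hvC (by omega)).2.1 hx, fun hx => hx.elim⟩
  · exact ⟨fun _ => trivial, fun _ => (layerEquiv_spec (G := G) (C := C) (a := a) (b := b) j).1⟩

theorem toVertex_injective (h : IsFrame G C a b) : Function.Injective h.toVertex := by
  intro x y hxy
  have hd : depth G a b (h.toVertex x) = depth G a b (h.toVertex y) := by rw [hxy]
  rw [h.depth_toVertex, h.depth_toVertex] at hd
  rcases x with i | ⟨⟨s, hs⟩, j⟩ | ⟨⟨s, hs⟩, j⟩ <;>
    rcases y with i' | ⟨⟨s', hs'⟩, j'⟩ | ⟨⟨s', hs'⟩, j'⟩ <;> simp only at hd <;>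
    try (exfalso; omega)
  · have hi : i.val < G.dist a b + 1 := i.isLt
    have hi' : i'.val < G.dist a b + 1 := i'.isLt
    have h1 := (h.dist_getVert h.isPath_path (i := i.val) (by omega)).1
    have h2 := (h.dist_getVert h.isPath_path (i := i'.val) (by omega)).1
    have h3 : h.path.getVert i.val = h.path.getVert i'.val := hxy
    rw [h3, h2] at h1
    rw [Fin.ext h1.symm]
  · obtain rfl : s = s' := by omega
    obtain ⟨h1, h2⟩ := layerEquiv_spec (G := G) (C := C) (a := a) (b := b) j
    obtain ⟨h3, h4⟩ := layerEquiv_spec (G := G) (C := C) (a := a) (b := b) j'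
    have h5 := h.parent_inj h1 (by omega) (by omega) hxy
    rw [(layerEquiv G C a b s).injective (Subtype.ext h5)]
  · obtain rfl : s = s' := by omega
    have h5 : (layerEquiv G C a b s j).1 = (layerEquiv G C a b s j').1 := hxy
    rw [(layerEquiv G C a b s).injective (Subtype.ext h5)]

theorem toVertex_surjective (h : IsFrame G C a b) : Function.Surjective h.toVertex := by
  have key : ∀ v ∈ C, 0 < depth G a b v → ∃ s j, h.toVertex (.inr (.inr ⟨s, j⟩)) = v := by
    intro v hv h0
    have hev := Nat.even_iff.1 ((h.mem_iff_even_depth h0).1 hv)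
    have hle : depth G a b v / 2 ≤ height G C a b :=
      Finset.le_sup (f := fun v => depth G a b v / 2) hv
    have hmem : v ∈ layer G C a b (depth G a b v / 2 - 1 + 1) := mem_layer.2 ⟨hv, by omega⟩
    refine ⟨⟨depth G a b v / 2 - 1, (by omega : _ < height G C a b)⟩,
      (layerEquiv G C a b _).symm ⟨v, hmem⟩, ?_⟩
    show ((layerEquiv G C a b _) ((layerEquiv G C a b _).symm ⟨v, hmem⟩)).1 = v
    rw [Equiv.apply_symm_apply]
  intro v
  rcases Nat.eq_zero_or_pos (depth G a b v) with h0 | h0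
  · refine ⟨.inl ⟨G.dist a v, ?_⟩, (h.eq_getVert_of_depth h0).symm⟩
    have := (h.dist_add v).2.1
    exact Nat.lt_succ_of_le this
  · by_cases hv : v ∈ C
    · obtain ⟨s, j, hsj⟩ := key v hv h0
      exact ⟨_, hsj⟩
    · obtain ⟨u, huC, hu0, huv⟩ := h.exists_child h0 hv
      obtain ⟨s, j, hsj⟩ := key u huC hu0
      refine ⟨.inr (.inl ⟨s, j⟩), ?_⟩
      rw [← huv, ← hsj]
      rfl

/-- The image of a connected graph under a bijective homomorphism is a connected spanning subgraph
of the tree, hence all of it. Only preservation of edges has to be checked. -/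
noncomputable def iso (h : IsFrame G C a b) : h.data.graph ≃g G :=
  isoOfHom h.data.connected h.tree
    (Equiv.ofBijective _ ⟨h.toVertex_injective, h.toVertex_surjective⟩) fun x y hxy => by
    show G.Adj (h.toVertex x) (h.toVertex y)
    rcases ((SimpleGraph.fromRel_adj _ _ _).1 hxy).2 with h1 | h1
    · exact h.adj_of_rel h1
    · exact (h.adj_of_rel h1).symm

theorem iso_mem_iff (h : IsFrame G C a b) (x : h.data.Vertex) :
    h.iso x ∈ C ↔ x ∈ h.data.V₂ := h.toVertex_mem_iff x

theorem iso_pathStart (h : IsFrame G C a b) : h.iso h.data.pathStart = a :=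
  h.path.getVert_zero

theorem iso_pathEnd (h : IsFrame G C a b) : h.iso h.data.pathEnd = b := by
  have := h.path.getVert_length
  rwa [h.length_path] at this

theorem height_le (h : IsFrame G C a b) : height G C a b ≤ G.dist a b / 4 := by
  refine Finset.sup_le fun v _ => ?_
  have := (h.depth_bounds v).1
  omega

theorem diam_data (h : IsFrame G C a b) : h.data.graph.diam = h.data.d := by
  have key : ∀ x y, h.data.graph.dist x y = G.dist (h.iso x) (h.iso y) := fun x y =>
    (dist_iso h.data.connected h.iso x y).symm
  have h1 : h.data.graph.dist h.data.pathStart h.data.pathEnd = h.data.d := by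
    rw [key, h.iso_pathStart, h.iso_pathEnd]
    rfl
  rw [← h1]
  refine diam_eq h.data.connected fun u v => ?_
  rw [h1, key]
  exact h.dist_le _ _

theorem card_depth_zero (h : IsFrame G C a b) :
    (C.filter fun v => depth G a b v / 2 = 0).card = G.dist a b / 2 + 1 := by
  have hev := Nat.even_iff.1 h.even_dist
  have h1 := card_filter_even (G.dist a b + 1)
  rw [show (G.dist a b + 1 + 1) / 2 = G.dist a b / 2 + 1 by omega] at h1
  rw [← h1]
  symm
  refine Finset.card_bij (fun i _ => h.path.getVert i.val) (fun i hi => ?_) (fun i hi j hj hij => ?_)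
    (fun v hv => ?_)
  · have := (h.dist_getVert h.isPath_path (i := i.val) (by omega)).1
    rw [Finset.mem_filter, ← h.even_dist_iff, this, h.depth_getVert i.isLt]
    exact ⟨Nat.even_iff.2 (Finset.mem_filter.1 hi).2, rfl⟩
  · have h1 := (h.dist_getVert h.isPath_path (i := i.val) (by omega)).1
    have h2 := (h.dist_getVert h.isPath_path (i := j.val) (by omega)).1
    rw [hij, h2] at h1
    exact Fin.ext h1.symm
  · obtain ⟨hvC, hv0⟩ := Finset.mem_filter.1 hv
    have hvd : depth G a b v = 0 := by
      by_contra hne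
      have := Nat.even_iff.1 ((h.mem_iff_even_depth (by omega)).1 hvC)
      omega
    have hle := (h.dist_add v).2.1
    refine ⟨⟨G.dist a v, by omega⟩, ?_, (h.eq_getVert_of_depth hvd).symm⟩
    exact Finset.mem_filter.2 ⟨Finset.mem_univ _, Nat.even_iff.1 ((h.even_dist_iff v).2 hvC)⟩

theorem sum_size (h : IsFrame G C a b) :
    ∑ s ∈ Finset.Icc 1 h.data.h, h.data.size s + (h.data.d / 2 + 1) = C.card := by
  have h1 := Finset.card_eq_sum_card_fiberwise (s := C) (f := fun v => depth G a b v / 2)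
    (t := Finset.range (height G C a b + 1)) (fun v hv => by
      have : depth G a b v / 2 ≤ height G C a b :=
        Finset.le_sup (f := fun v => depth G a b v / 2) hv
      simp only [Finset.coe_range, Set.mem_Iio]
      omega)
  rw [h1, Finset.sum_range_succ', h.card_depth_zero]
  congr 1
  refine Finset.sum_nbij' (· - 1) (· + 1) (fun s hs => ?_) (fun s hs => ?_) (fun s hs => ?_)
    (fun s hs => ?_) (fun s hs => ?_)
  · rw [Finset.mem_Icc] at hs
    have : s ≤ height G C a b := hs.2
    rw [Finset.mem_range]
    omega
  · rw [Finset.mem_range] at hs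
    exact Finset.mem_Icc.2 ⟨by omega, hs⟩
  · rw [Finset.mem_Icc] at hs
    omega
  · omega
  · rw [Finset.mem_Icc] at hs
    obtain ⟨t, rfl⟩ : ∃ t, s = t + 1 := ⟨s - 1, by omega⟩
    show (layer G C a b (t + 1)).card = _
    congr 1
    ext v
    rw [mem_layer, Finset.mem_filter, Nat.add_sub_cancel]
    refine and_congr_right fun hv => ?_
    constructor
    · omega
    · intro h2
      have := Nat.even_iff.1 ((h.mem_iff_even_depth (v := v) (by omega)).1 hv)
      omega

end IsFrame

/-! ### Degrees, cardinalities and the constraints on the parameters. -/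

theorem deg_eq_degree (G : SimpleGraph V) (v : V) : deg G v = G.degree v := by
  rw [deg, ← G.card_neighborSet_eq_degree, Set.ncard_eq_toFinset_card', Set.toFinset_card]

theorem deg_iso {V W : Type*} {G : SimpleGraph V} {H : SimpleGraph W} (φ : G ≃g H) (v : V) :
    deg H (φ v) = deg G v := by
  unfold deg
  have : H.neighborSet (φ v) = φ '' G.neighborSet v := by
    ext w
    obtain ⟨u, rfl⟩ := φ.surjective w
    rw [SimpleGraph.mem_neighborSet, φ.map_adj_iff, φ.injective.mem_set_image,
      SimpleGraph.mem_neighborSet]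
  rw [this, Set.ncard_image_of_injective _ φ.injective]

namespace IsFrame

variable {G : SimpleGraph V} {C : Finset V} {a b : V}

theorem eq_of_adj_left (h : IsFrame G C a b) {u w : V} (hu : G.Adj a u) (hw : G.Adj a w) :
    u = w := by
  have h1 := h.tree.dist_eq_dist_add_one_of_adj b hu
  have h2 := h.tree.dist_eq_dist_add_one_of_adj b hw
  have h3 := h.dist_le b u
  have h4 := h.dist_le b w
  rw [dist_swap G a b] at h3 h4
  exact eq_of_closer (a := b) h.tree hu hw (by omega) (by omega)

/-- Every edge has exactly one end outside `C`, where all degrees are two, so twice the size of the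
complement is the number of edges. -/
theorem card_compl (h : IsFrame G C a b) : Cᶜ.card + 1 = C.card := by
  have h1 := sum_degree_compl_cover h.cover
  have h2 : (Cᶜ.biUnion fun x => G.incidenceFinset x) = G.edgeFinset := by
    ext e
    rw [Finset.mem_biUnion]
    constructor
    · rintro ⟨x, -, hx⟩
      exact G.incidenceFinset_subset x hx
    · induction e with
      | _ u v =>
      intro he
      have huv : G.Adj u v := by simpa using he
      by_cases hu : u ∈ C
      · refine ⟨v, Finset.mem_compl.2 fun hv => h.indep u hu v hv huv, ?_⟩
        rw [SimpleGraph.mem_incidenceFinset]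
        exact ⟨huv, Sym2.mem_mk_right u v⟩
      · refine ⟨u, Finset.mem_compl.2 hu, ?_⟩
        rw [SimpleGraph.mem_incidenceFinset]
        exact ⟨huv, Sym2.mem_mk_left u v⟩
  rw [h2, Finset.sum_congr rfl fun x hx => h.degree_eq x (Finset.mem_compl.1 hx),
    Finset.sum_const, smul_eq_mul] at h1
  have h3 := h.tree.card_edgeFinset
  have h4 := Finset.card_add_card_compl C
  omega

theorem two_mul_card (h : IsFrame G C a b) : 2 * C.card = Nat.card V + 1 := by
  have h1 := h.card_compl
  have h2 := Finset.card_add_card_compl C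
  rw [Nat.card_eq_fintype_card]
  omega

theorem V₁_eq (h : IsFrame G C a b) : h.data.V₁ = h.iso ⁻¹' (Cᶜ : Finset V) := by
  ext x
  rw [h.data.mem_V₁_iff, ← h.iso_mem_iff]
  simp

theorem V₂_eq (h : IsFrame G C a b) : h.data.V₂ = h.iso ⁻¹' C := by
  ext x
  rw [← h.iso_mem_iff]
  simp

theorem ncard_V₁ (h : IsFrame G C a b) : h.data.V₁.ncard + 1 = C.card := by
  rw [h.V₁_eq, ← h.card_compl, ← Set.ncard_coe_finset]
  congr 1
  exact Set.ncard_preimage_of_injective_subset_range h.iso.injective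
    fun x _ => h.iso.surjective x

theorem ncard_V₂ (h : IsFrame G C a b) : h.data.V₂.ncard = C.card := by
  rw [h.V₂_eq, ← Set.ncard_coe_finset]
  exact Set.ncard_preimage_of_injective_subset_range h.iso.injective
    fun x _ => h.iso.surjective x

theorem isBipartiteWith (h : IsFrame G C a b) :
    h.data.graph.IsBipartiteWith h.data.V₁ h.data.V₂ := by
  constructor
  · rw [Set.disjoint_left]
    exact fun x hx => (h.data.mem_V₁_iff x).1 hx
  · intro x y hxy
    have h1 := h.mem_iff_not_mem_of_adj (h.iso.map_adj_iff.2 hxy)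
    rw [h.iso_mem_iff, h.iso_mem_iff] at h1
    rw [h.data.mem_V₁_iff, h.data.mem_V₁_iff]
    tauto

theorem deg_V₁ (h : IsFrame G C a b) {x : h.data.Vertex} (hx : x ∈ h.data.V₁) :
    deg h.data.graph x = 2 := by
  rw [← deg_iso h.iso, deg_eq_degree]
  refine h.degree_eq _ ?_
  rw [h.iso_mem_iff]
  exact (h.data.mem_V₁_iff x).1 hx

theorem data_mem_mainTrees (h : IsFrame G C a b) {n α : ℕ} (hn : 2 ≤ n) (hα : α ≤ n)
    (hC : C.card = n - α) : h.data ∈ mainTrees n α := by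
  have h1 := h.sum_size
  have h2 : h.data.h ≤ ∑ s ∈ Finset.Icc 1 h.data.h, h.data.size s := by
    have := Finset.card_nsmul_le_sum (Finset.Icc 1 h.data.h) h.data.size 1
      (fun s hs => h.data.size_pos s (Finset.mem_Icc.1 hs).1 (Finset.mem_Icc.1 hs).2)
    simpa using this
  have h3 : h.data.h ≤ h.data.d / 4 := h.height_le
  have h4 := Nat.even_iff.1 h.data.even_d
  have h5 : h.data.h = 0 → ∑ s ∈ Finset.Icc 1 h.data.h, h.data.size s = 0 := by
    intro h0; rw [h0]; rfl
  -- A nonempty layer forces d ≥ 4 and hence n - α ≥ 4, so for α ≥ n - 2 there are no layers.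
  -- Without layers d / 2 + 1 = n - α.
  refine ⟨h.diam_data, fun hα => ?_, fun hα => ?_, ?_, ?_⟩
  · by_cases h0 : h.data.h = 0
    · have := h5 h0; omega
    · omega
  · by_cases h0 : h.data.h = 0
    · have := h5 h0; omega
    · omega
  · rw [le_min_iff]; omega
  · omega

end IsFrame

/-! ### Removing the leaf set and attaching it again. -/

/-- A tree whose vertices outside the independent cover `C` are the leaves in `L` and vertices of
degree two. -/
structure IsSkeleton (T : SimpleGraph V) (L : Set V) (C : Finset V) : Prop where
  tree : T.IsTree
  cover : IsCover T C
  indep : ∀ a ∈ C, ∀ b ∈ C, ¬ T.Adj a b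
  nonempty : C.Nonempty
  not_mem : ∀ v ∈ L, v ∉ C
  leaf : ∀ v ∈ L, T.degree v = 1
  degree_eq : ∀ v ∉ C, v ∉ L → T.degree v = 2

namespace IsSkeleton

variable {T : SimpleGraph V} {L : Set V} {C : Finset V}

theorem mem_compl (h : IsSkeleton T L C) {v : V} (hv : v ∈ C) : v ∈ Lᶜ :=
  fun hL => h.not_mem v hL hv

/-- An inner vertex of a path has two neighbours, so paths between vertices outside `L` avoid `L`.
-/
theorem connected_induce (h : IsSkeleton T L C) : (T.induce Lᶜ).Connected := by
  have hne : Nonempty (Lᶜ : Set V) := by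
    obtain ⟨c, hc⟩ := h.nonempty
    exact ⟨⟨c, h.mem_compl hc⟩⟩
  refine ⟨fun u v => ?_⟩
  obtain ⟨p, hp⟩ := h.tree.connected.exists_isPath u.1 v.1
  have hsup : ∀ x ∈ p.support, x ∈ Lᶜ := by
    intro x hx
    by_cases h1 : x = u.1
    · exact h1 ▸ u.2
    by_cases h2 : x = v.1
    · exact h2 ▸ v.2
    intro hxL
    obtain ⟨a, b, hab, -, -, ha, hb⟩ := path_interior hp hx h1 h2
    exact hab (eq_of_degree_one (h.leaf x hxL) ha hb)
  exact ⟨p.induce _ hsup⟩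

theorem isTree_induce (h : IsSkeleton T L C) : (T.induce Lᶜ).IsTree :=
  ⟨h.connected_induce, h.tree.isAcyclic.induce _⟩

theorem exists_isFrame (h : IsSkeleton T L C) :
    ∃ a b, IsFrame (T.induce Lᶜ) (C.subtype (· ∈ Lᶜ)) a b := by
  refine MinimizerGraph.exists_isFrame h.isTree_induce (by convert h.cover.induce Lᶜ) (fun a ha b hb hab => ?_)
    (fun v hv => ?_)
  · rw [Finset.mem_subtype] at ha hb
    exact h.indep _ ha _ hb hab
  · rw [Finset.mem_subtype] at hv
    rw [← h.degree_eq v hv v.2, ← SimpleGraph.card_neighborFinset_eq_degree,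
      ← SimpleGraph.card_neighborFinset_eq_degree,
      ← Finset.card_map (Function.Embedding.subtype (· ∈ Lᶜ))]
    congr 1
    ext u
    rw [Finset.mem_map, SimpleGraph.mem_neighborFinset]
    constructor
    · rintro ⟨u, hu, rfl⟩
      have hvu : (T.induce Lᶜ).Adj v u := (SimpleGraph.mem_neighborFinset _ _ _).1 hu
      exact hvu
    · intro hu
      exact ⟨⟨u, h.mem_compl ((h.cover hu).resolve_left hv)⟩,
        (SimpleGraph.mem_neighborFinset _ _ _).2 hu, rfl⟩

theorem card_subtype (h : IsSkeleton T L C) : (C.subtype (· ∈ Lᶜ)).card = C.card :=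
  card_subtype_of_subset fun _ hc => h.mem_compl hc

section attach

variable {X : Type*} {H : SimpleGraph X} {A : Set X}

/-- The leaves at a vertex. -/
noncomputable def leavesAt (T : SimpleGraph V) (L : Set V) (c : V) : Finset V :=
  Finset.univ.filter fun v => v ∈ L ∧ T.Adj c v

theorem mem_leavesAt {c v : V} : v ∈ leavesAt T L c ↔ v ∈ L ∧ T.Adj c v := by
  simp [leavesAt]

noncomputable def unattach (φ : H ≃g T.induce Lᶜ) (A : Set X) :
    X ⊕ (Σ u : A, Fin (leavesAt T L (φ u.1).1).card) → V
  | .inl x => (φ x).1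
  | .inr ⟨u, j⟩ => ((leavesAt T L (φ u.1).1).equivFin.symm j).1

theorem unattach_inr (φ : H ≃g T.induce Lᶜ) (p : Σ u : A, Fin (leavesAt T L (φ u.1).1).card) :
    unattach φ A (.inr p) ∈ L ∧ T.Adj (φ p.1.1).1 (unattach φ A (.inr p)) :=
  mem_leavesAt.1 ((leavesAt T L (φ p.1.1).1).equivFin.symm p.2).2

theorem unattach_bijective (h : IsSkeleton T L C) (φ : H ≃g T.induce Lᶜ)
    (hA : ∀ x, (φ x).1 ∈ C ↔ x ∈ A) : Function.Bijective (unattach φ A) := by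
  constructor
  · rintro (x | p) (y | q) hxy
    · rw [φ.injective (Subtype.ext hxy)]
    · exact absurd (show (φ x).1 ∈ L from (show (φ x).1 = _ from hxy) ▸ (unattach_inr φ q).1) (φ x).2
    · exact absurd (show (φ y).1 ∈ L from (show _ = (φ y).1 from hxy) ▸ (unattach_inr φ p).1) (φ y).2
    · obtain ⟨h1, h2⟩ := unattach_inr φ p
      obtain ⟨h3, h4⟩ := unattach_inr φ q
      rw [← hxy] at h4
      have h5 := eq_of_degree_one (h.leaf _ h1) h2.symm h4.symm
      obtain ⟨u, i⟩ := p
      obtain ⟨w, j⟩ := q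
      obtain rfl : u = w := Subtype.ext (φ.injective (Subtype.ext h5))
      have h6 := (leavesAt T L (φ u.1).1).equivFin.symm.injective (Subtype.ext hxy)
      rw [h6]
  · intro v
    by_cases hv : v ∈ L
    · obtain ⟨c, hc, -⟩ := SimpleGraph.degree_eq_one_iff_existsUnique_adj.1 (h.leaf v hv)
      have hcC : c ∈ C := (h.cover hc).resolve_left (h.not_mem v hv)
      obtain ⟨x, hx⟩ := φ.surjective ⟨c, h.mem_compl hcC⟩
      have hxA : x ∈ A := by rw [← hA, hx]; exact hcC
      have hmem : v ∈ leavesAt T L (φ x).1 := by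
        rw [mem_leavesAt, hx]
        exact ⟨hv, hc.symm⟩
      refine ⟨.inr ⟨⟨x, hxA⟩, (leavesAt T L (φ x).1).equivFin ⟨v, hmem⟩⟩, ?_⟩
      show ((leavesAt T L (φ x).1).equivFin.symm
        ((leavesAt T L (φ x).1).equivFin ⟨v, hmem⟩)).1 = v
      rw [Equiv.symm_apply_apply]
    · obtain ⟨x, hx⟩ := φ.surjective ⟨v, hv⟩
      exact ⟨.inl x, congrArg Subtype.val hx⟩

theorem unattach_adj (h : IsSkeleton T L C) (φ : H ≃g T.induce Lᶜ)
    (x y : X ⊕ (Σ u : A, Fin (leavesAt T L (φ u.1).1).card)) :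
    T.Adj (unattach φ A x) (unattach φ A y) ↔ (attachPendants H A
      fun u => (leavesAt T L (φ u.1).1).card).Adj x y := by
  have key : ∀ (x : X) (p : Σ u : A, Fin (leavesAt T L (φ u.1).1).card),
      T.Adj (unattach φ A (.inl x)) (unattach φ A (.inr p)) ↔ x = p.1.1 := by
    intro x p
    obtain ⟨h1, h2⟩ := unattach_inr φ p
    constructor
    · intro h3
      have := eq_of_degree_one (h.leaf _ h1) h2.symm h3.symm
      exact φ.injective (Subtype.ext this.symm)
    · rintro rfl
      exact h2
  unfold attachPendants
  rw [SimpleGraph.fromRel_adj]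
  rcases x with x | p <;> rcases y with y | q
  · have : T.Adj (unattach φ A (.inl x)) (unattach φ A (.inl y)) ↔ H.Adj x y :=
      φ.map_adj_iff (v := x) (w := y)
    rw [this]
    refine ⟨fun hxy => ⟨fun he => hxy.ne (Sum.inl.inj he), Or.inl hxy⟩, fun hxy => ?_⟩
    exact hxy.2.elim id fun h => h.symm
  · rw [key]
    exact ⟨fun hx => ⟨by simp, Or.inl hx⟩, fun hx => hx.2.elim id fun h => h.elim⟩
  · rw [T.adj_comm, key]
    exact ⟨fun hx => ⟨by simp, Or.inr hx⟩, fun hx => hx.2.elim (fun h => h.elim) id⟩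
  · refine ⟨fun hpq => ?_, fun hpq => (hpq.2.elim id id).elim⟩
    rcases h.cover hpq with h1 | h1
    · exact absurd h1 (h.not_mem _ (unattach_inr φ p).1)
    · exact absurd h1 (h.not_mem _ (unattach_inr φ q).1)

noncomputable def attachIso (h : IsSkeleton T L C) (φ : H ≃g T.induce Lᶜ)
    (hA : ∀ x, (φ x).1 ∈ C ↔ x ∈ A) :
    attachPendants H A (fun u => (leavesAt T L (φ u.1).1).card) ≃g T where
  toEquiv := Equiv.ofBijective _ (h.unattach_bijective φ hA)
  map_rel_iff' := fun {x y} => h.unattach_adj φ x y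

theorem attachIso_symm_image (h : IsSkeleton T L C) (φ : H ≃g T.induce Lᶜ)
    (hA : ∀ x, (φ x).1 ∈ C ↔ x ∈ A) : (h.attachIso φ hA).symm '' L = Set.range Sum.inr := by
  have h1 : ∀ x, h.attachIso φ hA x ∈ L ↔ x ∈ Set.range Sum.inr := by
    rintro (x | p)
    · exact ⟨fun hx => absurd hx (φ x).2, fun hx => by simp at hx⟩
    · exact ⟨fun _ => ⟨p, rfl⟩, fun _ => (unattach_inr φ p).1⟩
  ext x
  rw [← h1]
  constructor
  · rintro ⟨v, hv, rfl⟩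
    simpa using hv
  · intro hx
    exact ⟨_, hx, by simp⟩

end attach

end IsSkeleton

theorem finsum_eq_ncard {X : Type*} [Finite X] {L : Set V} {A : Set X} (l : A → ℕ)
    (φ : V ≃ X ⊕ (Σ u : A, Fin (l u))) (h : φ '' L = Set.range Sum.inr) :
    ∑ᶠ u, l u = L.ncard := by
  have : Fintype A := Fintype.ofFinite _
  rw [← Set.ncard_image_of_injective L φ.injective, h, finsum_eq_sum_of_fintype,
    ← Nat.card_coe_set_eq, Nat.card_congr (Equiv.ofInjective _ Sum.inr_injective).symm,
    Nat.card_eq_fintype_card, Fintype.card_sigma]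
  simp

/-- All assertions of the theorem but the one on control vertices; instead of that one, the ends
of the path have at most one neighbour outside `L`. -/
theorem IsSkeleton.exists_mainTree {T : SimpleGraph V} {L : Set V} {C : Finset V}
    (h : IsSkeleton T L C) {n α : ℕ} (hn : 2 ≤ n) (hV : Fintype.card V = n) (hα : α ≤ n)
    (hC : C.card = n - α) (P : V → Prop)
    (hP : ∀ c ∈ C, (∀ u w, T.Adj c u → T.Adj c w → u ∉ L → w ∉ L → u = w) → P c) :
    ∃ D ∈ mainTrees n α, ∃ l : D.V₂ → ℕ, ∃ φ : T ≃g attachPendants D.graph D.V₂ l,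
        φ '' L = Set.range Sum.inr ∧
        (∑ᶠ u : D.V₂, l u) = L.ncard ∧
        (L.ncard : ℤ) = 2 * α - n + 1 ∧
        D.graph.IsTree ∧
        D.graph.IsBipartiteWith D.V₁ D.V₂ ∧
        D.V₁ ∪ D.V₂ = Set.univ ∧
        (D.V₂.ncard : ℤ) = n - α ∧
        (D.V₁.ncard : ℤ) = n - α - 1 ∧
        (∀ x ∈ D.V₁, deg D.graph x = 2) ∧
        P (φ.symm (Sum.inl D.pathStart)) ∧ P (φ.symm (Sum.inl D.pathEnd)) := by
  obtain ⟨a, b, hF⟩ := h.exists_isFrame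
  have hCS := h.card_subtype
  have hA : ∀ x, (hF.iso x).1 ∈ C ↔ x ∈ hF.data.V₂ := by
    intro x
    rw [← hF.iso_mem_iff, Finset.mem_subtype]
  have him := h.attachIso_symm_image hF.iso hA
  have hLc : L.ncard + (Lᶜ).ncard = n := by
    rw [Set.ncard_add_ncard_compl, Nat.card_eq_fintype_card, hV]
  have hcard : (Lᶜ).ncard = 2 * C.card - 1 := by
    have h1 := hF.two_mul_card
    rw [Nat.card_coe_set_eq] at h1
    omega
  have hpos := h.nonempty.card_pos
  -- An end of a diametral path has at most one neighbour in T - L; this is the only fact about the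
  -- ends that `P` requires.
  have hend : ∀ c : (Lᶜ : Set V), c ∈ C.subtype (· ∈ Lᶜ) →
      (∀ u w, (T.induce Lᶜ).Adj c u → (T.induce Lᶜ).Adj c w → u = w) → P c.1 := by
    intro c hc huw
    refine hP c (Finset.mem_subtype.1 hc) fun u w hu hw huL hwL => ?_
    exact congrArg Subtype.val (huw ⟨u, huL⟩ ⟨w, hwL⟩ hu hw)
  refine ⟨hF.data, hF.data_mem_mainTrees hn hα (hCS.trans hC), _,
    (h.attachIso hF.iso hA).symm, him, finsum_eq_ncard _ (h.attachIso hF.iso hA).symm.toEquiv him,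
    by omega, hF.iso.isTree_iff.2 hF.tree, hF.isBipartiteWith, ?_, ?_, ?_,
    fun x hx => hF.deg_V₁ hx, ?_, ?_⟩
  · ext x
    simp only [Set.mem_union, Set.mem_univ, iff_true, hF.data.mem_V₁_iff]
    tauto
  · rw [hF.ncard_V₂]; omega
  · have := hF.ncard_V₁; omega
  · show P (hF.iso hF.data.pathStart).1
    rw [hF.iso_pathStart]
    exact hend a hF.left_mem fun u w hu hw => hF.eq_of_adj_left hu hw
  · show P (hF.iso hF.data.pathEnd).1
    rw [hF.iso_pathEnd]
    exact hend b hF.right_mem fun u w hu hw => hF.symm.eq_of_adj_left hu hw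

/-! ### Control vertices in the three cases. -/

theorem deg_pathGraph {n : ℕ} (hn : 2 ≤ n) (i : Fin n) :
    deg (SimpleGraph.pathGraph n) i = if i.val = 0 ∨ i.val + 1 = n then 1 else 2 := by
  have hi := i.isLt
  unfold deg
  split_ifs with h
  · rw [Set.ncard_eq_one]
    rcases h with h | h
    · refine ⟨⟨1, by omega⟩, ?_⟩
      ext j
      rw [SimpleGraph.mem_neighborSet, SimpleGraph.pathGraph_adj, Set.mem_singleton_iff, Fin.ext_iff]
      simp only
      omega
    · refine ⟨⟨n - 2, by omega⟩, ?_⟩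
      ext j
      rw [SimpleGraph.mem_neighborSet, SimpleGraph.pathGraph_adj, Set.mem_singleton_iff, Fin.ext_iff]
      have := j.isLt
      simp only
      omega
  · rw [Set.ncard_eq_two]
    refine ⟨⟨i.val - 1, by omega⟩, ⟨i.val + 1, by omega⟩, ?_, ?_⟩
    · rw [ne_eq, Fin.ext_iff]
      simp only
      omega
    · ext j
      rw [SimpleGraph.mem_neighborSet, SimpleGraph.pathGraph_adj, Set.mem_insert_iff,
        Set.mem_singleton_iff, Fin.ext_iff, Fin.ext_iff]
      simp only
      omega

theorem card_eq_of_iso {n : ℕ} {H : SimpleGraph (Fin n)} {T : SimpleGraph V} (φ : H ≃g T) :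
    Fintype.card V = n := by
  rw [← Fintype.card_congr φ.toEquiv, Fintype.card_fin]

theorem not_iso_pathGraph {T : SimpleGraph V} {w : V} (hw : 3 ≤ deg T w) (m : ℕ) :
    ¬ Nonempty (SimpleGraph.pathGraph m ≃g T) := by
  rintro ⟨φ⟩
  have h1 := deg_iso φ (φ.symm w)
  rw [RelIso.apply_symm_apply] at h1
  by_cases hm : 2 ≤ m
  · rw [deg_pathGraph hm] at h1
    split_ifs at h1 <;> omega
  · have h2 := card_eq_of_iso φ
    have h3 := T.degree_lt_card_verts w
    rw [← deg_eq_degree] at h3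
    omega

theorem isLeafSet_eq {T : SimpleGraph V} {L : Set V} (hL : IsLeafSet T L) {w : V}
    (hw : 3 ≤ deg T w) : L = {v | deg T v = 1} := by
  rcases hL with ⟨⟨t, -, ht⟩, -⟩ | ⟨-, hL⟩
  · exact absurd ht (not_iso_pathGraph hw _)
  · exact hL

theorem IsGood.isSkeleton {T : SimpleGraph V} {C : Finset V} (h : IsGood T C)
    (hV : 2 ≤ Fintype.card V) (hC : C.Nonempty) : IsSkeleton T {v | deg T v = 1} C := by
  refine ⟨h.tree, h.cover, h.indep, hC, fun v hv hvC => ?_, fun v hv => ?_, fun v hvC hv => ?_⟩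
  · have h1 : deg T v = 1 := hv
    have := h.leafless v hvC
    rw [deg_eq_degree] at h1
    omega
  · rw [← deg_eq_degree]; exact hv
  · have h1 : ¬ deg T v = 1 := hv
    rw [deg_eq_degree] at h1
    have := h.degree_le v hvC
    have := one_le_degree h.tree.connected hV v
    omega

/-- A vertex with at most one neighbour outside `L` has a neighbour in `L`. -/
theorem exists_adj_mem {T : SimpleGraph V} {L : Set V} {c : V} (hc : 2 ≤ T.degree c)
    (h : ∀ u w, T.Adj c u → T.Adj c w → u ∉ L → w ∉ L → u = w) : ∃ x ∈ L, T.Adj c x := by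
  by_contra! hcon
  obtain ⟨u, -, hu⟩ := exists_adj_ne hc c
  obtain ⟨w, hwu, hw⟩ := exists_adj_ne hc u
  exact hwu (h w u hw hu (fun h => hcon w h hw) (fun h => hcon u h hu))

theorem iso_of_supp_eq_singleton {X : Type*} {H : SimpleGraph X} {c : H.ConnectedComponent} {x : X}
    (hc : c.supp = {x}) : Nonempty (SimpleGraph.pathGraph 1 ≃g c.toSimpleGraph) := by
  have hx : x ∈ c.supp := by rw [hc]; rfl
  have huniq : ∀ y : c, y = ⟨x, hx⟩ := by
    rintro ⟨y, hy⟩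
    have : y ∈ c.supp := hy
    rw [hc] at this
    exact Subtype.ext this
  refine ⟨⟨⟨fun _ => ⟨x, hx⟩, fun _ => 0, fun i => (Subsingleton.elim _ _), fun y => (huniq y).symm⟩,
    fun {i j} => ?_⟩⟩
  obtain rfl : i = j := Subsingleton.elim _ _
  exact ⟨fun h => (h.ne rfl).elim, fun h => (h.ne rfl).elim⟩

/-- Each leaf at `c` is by itself a component of T - c, and a single vertex is a path. -/
theorem card_leaves_le_numPathComponents (T : SimpleGraph V) (c : V) :
    ((T.neighborFinset c).filter fun x => T.degree x = 1).card ≤ numPathComponents T c := by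
  set s := (T.neighborFinset c).filter fun x => T.degree x = 1 with hs
  have hmem : ∀ x ∈ s, T.Adj c x ∧ T.degree x = 1 := by
    intro x hx
    rw [hs, Finset.mem_filter, SimpleGraph.mem_neighborFinset] at hx
    exact hx
  have hx' : ∀ x ∈ s, x ∈ ({c}ᶜ : Set V) := fun x hx => (hmem x hx).1.ne'
  let f : s → (T.induce ({c}ᶜ : Set V)).ConnectedComponent := fun x =>
    (T.induce ({c}ᶜ : Set V)).connectedComponentMk ⟨x.1, hx' x.1 x.2⟩
  have hsupp : ∀ x : s, (f x).supp = {⟨x.1, hx' x.1 x.2⟩} := by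
    intro x
    ext y
    rw [SimpleGraph.ConnectedComponent.mem_supp_iff, Set.mem_singleton_iff]
    constructor
    · intro hy
      obtain ⟨p⟩ := (SimpleGraph.ConnectedComponent.exact hy).symm
      cases p with
      | nil => rfl
      | @cons _ z _ hadj _ =>
        have h1 : T.Adj x.1 z.1 := hadj
        exact absurd (eq_of_degree_one (hmem x.1 x.2).2 h1 (hmem x.1 x.2).1.symm) z.2
    · rintro rfl
      rfl
  have hinj : Function.Injective f := by
    intro x y hxy
    have h1 := hsupp x
    rw [hxy, hsupp y, Set.singleton_eq_singleton_iff] at h1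
    exact Subtype.ext (congrArg Subtype.val h1).symm
  have h2 : (Set.range f).ncard = s.card := by
    rw [← Nat.card_coe_set_eq, Nat.card_congr (Equiv.ofInjective f hinj).symm]
    simp
  rw [← h2, numPathComponents]
  refine Set.ncard_le_ncard ?_ (Set.toFinite _)
  rintro _ ⟨x, rfl⟩
  exact ⟨1, iso_of_supp_eq_singleton (hsupp x)⟩

theorem isControlVertex_of_leaves {T : SimpleGraph V} {L : Set V}
    (hL : L = {v | deg T v = 1}) (hD : ¬ ∃ m : ℕ, 4 ≤ m ∧ Nonempty (dGraph m ≃g T)) {c : V}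
    (hc : 3 ≤ T.degree c)
    (h : ∀ u w, T.Adj c u → T.Adj c w → u ∉ L → w ∉ L → u = w) : IsControlVertex T L c := by
  refine Or.inr (Or.inr ⟨?_, hD, by rwa [deg_eq_degree], ?_⟩)
  · rintro ⟨m, hm⟩
    exact not_iso_pathGraph (by rwa [deg_eq_degree]) m hm
  · rw [deg_eq_degree]
    refine le_trans ?_ (Nat.add_le_add_right (card_leaves_le_numPathComponents T c) 1)
    rw [← T.card_neighborFinset_eq_degree,
      ← Finset.card_filter_add_card_filter_not (s := T.neighborFinset c) (fun x => T.degree x = 1)]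
    refine Nat.add_le_add_left (Finset.card_le_one.2 fun u hu w hw => ?_) _
    rw [Finset.mem_filter, SimpleGraph.mem_neighborFinset] at hu hw
    refine h u w hu.1 hw.1 ?_ ?_
    · rw [hL, Set.mem_ofPred_eq, deg_eq_degree]; exact hu.2
    · rw [hL, Set.mem_ofPred_eq, deg_eq_degree]; exact hw.2

/-- The leaf count forces four leaves and so `rho` ≥ 2, whereas D_m has `rho` < 2. -/
theorem not_iso_dGraph {T : SimpleGraph V} (hT : T.IsTree) {C : Finset V} (hC : IsCover T C)
    (hV : 2 * C.card + 3 ≤ Fintype.card V) :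
    ¬ ∃ m : ℕ, 4 ≤ m ∧ Nonempty (dGraph m ≃g T) := by
  rintro ⟨m, hm, ⟨φ⟩⟩
  have h1 := le_card_leaves hT (by omega) hC
  have h2 : (Cᶜ.filter fun x => T.degree x = 1).card ≤
      (Finset.univ.filter fun x => T.degree x = 1).card :=
    Finset.card_le_card (Finset.filter_subset_filter _ (Finset.subset_univ _))
  have h3 := two_le_rho_of_leaves hT (by omega) (by omega)
  have h4 := rho_dGraph_lt hm
  have h5 := rho_le_of_iso (dGraph_connected hm) φ.symm
  linarith

/-- The leaves of D_n are 0, n - 2 and n - 1; their neighbours 1 and n - 3 are its control vertices.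
-/
theorem isControlVertex_of_dGraph {n : ℕ} (hn : 4 ≤ n) {T : SimpleGraph V} {L : Set V}
    (φ : dGraph n ≃g T) {c x : V} (hx : T.degree x = 1) (hcx : T.Adj c x) :
    IsControlVertex T L c := by
  refine Or.inr (Or.inl ⟨n, φ, φ.symm c, hn, by simp, ?_⟩)
  have hadj : (dGraph n).Adj (φ.symm c) (φ.symm x) := φ.symm.map_adj_iff.2 hcx
  set i := φ.symm c with hi
  set j := φ.symm x with hj
  have hxj : x = φ j := by simp [hj]
  have hjlt := j.isLt
  have hilt := i.isLt
  have key : ¬ (1 ≤ j.val ∧ j.val + 2 < n) := by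
    rintro ⟨h1, h2⟩
    have h3 : (dGraph n).Adj j ⟨j.val - 1, by omega⟩ := by
      rw [dGraph_adj hn]; right; left; exact ⟨by simp only; omega, by omega⟩
    have h4 : (dGraph n).Adj j ⟨j.val + 1, by omega⟩ := by
      rw [dGraph_adj hn]; left; left; exact ⟨rfl, h2⟩
    have h5 := φ.map_adj_iff.2 h3
    have h6 := φ.map_adj_iff.2 h4
    rw [← hxj] at h5 h6
    have h7 := φ.injective (eq_of_degree_one hx h5 h6)
    rw [Fin.ext_iff] at h7
    simp only at h7
    omega
  rw [dGraph_adj hn] at hadj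
  omega

theorem three_le_deg_of_dGraph {n : ℕ} (hn : 4 ≤ n) {T : SimpleGraph V} (φ : dGraph n ≃g T) :
    3 ≤ deg T (φ ⟨1, by omega⟩) := by
  rw [deg_iso, deg]
  have h1 : ({⟨0, by omega⟩, ⟨2, by omega⟩, ⟨n - 1, by omega⟩} : Finset (Fin n)).card = 3 := by
    rw [Finset.card_eq_three]
    refine ⟨_, _, _, ?_, ?_, ?_, rfl⟩ <;> rw [ne_eq, Fin.ext_iff] <;> simp only <;> omega
  rw [← h1, ← Set.ncard_coe_finset]
  refine Set.ncard_le_ncard ?_ (Set.toFinite _)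
  intro j hj
  simp only [Finset.coe_insert, Finset.coe_singleton, Set.mem_insert_iff,
    Set.mem_singleton_iff] at hj
  rw [SimpleGraph.mem_neighborSet, dGraph_adj hn]
  rcases hj with rfl | rfl | rfl
  · right; left; exact ⟨rfl, by simp only; omega⟩
  · left; left; exact ⟨rfl, by simp only; omega⟩
  · left; right; exact ⟨rfl, by simp only; omega⟩

/-- The odd vertices of a path. -/
noncomputable def oddVertices {n : ℕ} {T : SimpleGraph V} (φ : SimpleGraph.pathGraph n ≃g T) :
    Finset V :=
  Finset.univ.filter fun v => (φ.symm v).val % 2 = 1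

theorem mem_oddVertices {n : ℕ} {T : SimpleGraph V} {φ : SimpleGraph.pathGraph n ≃g T} {v : V} :
    v ∈ oddVertices φ ↔ (φ.symm v).val % 2 = 1 := by
  simp [oddVertices]

theorem card_oddVertices {n : ℕ} {T : SimpleGraph V} (φ : SimpleGraph.pathGraph n ≃g T) :
    (oddVertices φ).card + (n + 1) / 2 = n := by
  have h1 := card_filter_even n
  have h2 : (oddVertices φ).card =
      ((Finset.univ : Finset (Fin n)).filter fun i => ¬ i.val % 2 = 0).card := by
    refine Finset.card_bij (fun v _ => φ.symm v) (fun v hv => ?_)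
      (fun u _ v _ huv => φ.symm.injective huv) (fun i hi => ⟨φ i, ?_, by simp⟩)
    · rw [mem_oddVertices] at hv
      rw [Finset.mem_filter]
      exact ⟨Finset.mem_univ _, by omega⟩
    · rw [Finset.mem_filter] at hi
      rw [mem_oddVertices, RelIso.symm_apply_apply]
      omega
  have h3 := Finset.card_filter_add_card_filter_not (s := (Finset.univ : Finset (Fin n)))
    (fun i => i.val % 2 = 0)
  rw [Finset.card_univ, Fintype.card_fin] at h3
  omega

/-- Labels start at 0, at an end in `L`. For even n the last vertex is odd, so it stays in the cover
although it has degree one. -/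
theorem isSkeleton_of_pathGraph {n : ℕ} (hn : 2 ≤ n) {T : SimpleGraph V} {L : Set V}
    (hT : T.IsTree) (φ : SimpleGraph.pathGraph n ≃g T)
    (hL : ∀ v, v ∈ L ↔ (φ.symm v).val = 0 ∨ ((φ.symm v).val + 1 = n ∧ n % 2 = 1)) :
    IsSkeleton T L (oddVertices φ) := by
  have hadj : ∀ {u v}, T.Adj u v → (φ.symm u).val + 1 = (φ.symm v).val ∨
      (φ.symm v).val + 1 = (φ.symm u).val := by
    intro u v huv
    rw [← SimpleGraph.pathGraph_adj]
    exact φ.symm.map_adj_iff.2 huv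
  have hdeg : ∀ v, T.degree v =
      if (φ.symm v).val = 0 ∨ (φ.symm v).val + 1 = n then 1 else 2 := by
    intro v
    rw [← deg_pathGraph hn, deg_iso, deg_eq_degree]
  refine ⟨hT, fun u v huv => ?_, fun u hu v hv huv => ?_, ⟨φ ⟨1, by omega⟩, ?_⟩,
    fun v hv hvC => ?_, fun v hv => ?_, fun v hvC hv => ?_⟩
  · have := hadj huv
    rw [mem_oddVertices, mem_oddVertices]
    omega
  · have := hadj huv
    rw [mem_oddVertices] at hu hv
    omega
  · rw [mem_oddVertices, RelIso.symm_apply_apply]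
    rfl
  · rw [hL] at hv
    rw [mem_oddVertices] at hvC
    omega
  · rw [hL] at hv
    rw [hdeg, if_pos]
    omega
  · rw [hL] at hv
    rw [mem_oddVertices] at hvC
    have := (φ.symm v).isLt
    rw [hdeg, if_neg]
    omega

theorem isControlVertex_of_pathGraph {n : ℕ} (hn : 2 ≤ n) {T : SimpleGraph V} {L : Set V}
    (φ : SimpleGraph.pathGraph n ≃g T)
    (hL : ∀ v, v ∈ L ↔ (φ.symm v).val = 0 ∨ ((φ.symm v).val + 1 = n ∧ n % 2 = 1)) {c : V}
    (hc : c ∈ oddVertices φ)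
    (h : ∀ u w, T.Adj c u → T.Adj c w → u ∉ L → w ∉ L → u = w) : IsControlVertex T L c := by
  obtain ⟨i, rfl⟩ := φ.surjective c
  refine Or.inl ⟨n, φ, ⟨0, by omega⟩, i, rfl, ?_, rfl, ?_⟩
  · rw [hL, RelIso.symm_apply_apply]
    exact Or.inl rfl
  rw [mem_oddVertices, RelIso.symm_apply_apply] at hc
  have hilt := i.isLt
  by_contra! hcon
  have h1 : T.Adj (φ i) (φ ⟨i.val - 1, by omega⟩) := by
    rw [φ.map_adj_iff, SimpleGraph.pathGraph_adj]
    simp only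
    omega
  have h2 : T.Adj (φ i) (φ ⟨i.val + 1, by omega⟩) := by
    rw [φ.map_adj_iff, SimpleGraph.pathGraph_adj]
    exact Or.inl rfl
  have h3 := φ.injective (h _ _ h1 h2 (by
      rw [hL, RelIso.symm_apply_apply]
      simp only
      omega) (by
      rw [hL, RelIso.symm_apply_apply]
      simp only
      omega))
  rw [Fin.ext_iff] at h3
  simp only at h3
  omega

def pathGraphRev (n : ℕ) : SimpleGraph.pathGraph n ≃g SimpleGraph.pathGraph n where
  toEquiv := Fin.revPerm
  map_rel_iff' := fun {i j} => by
    simp only [Fin.revPerm_apply, SimpleGraph.pathGraph_adj, Fin.val_rev]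
    omega

/-- The path can be labelled so that `L` is given by its even end vertices. -/
theorem IsLeafSet.exists_iso {n : ℕ} (hn : 2 ≤ n) {T : SimpleGraph V} {L : Set V}
    (hL : IsLeafSet T L) (φ : SimpleGraph.pathGraph n ≃g T) :
    ∃ φ : SimpleGraph.pathGraph n ≃g T,
      ∀ v, v ∈ L ↔ (φ.symm v).val = 0 ∨ ((φ.symm v).val + 1 = n ∧ n % 2 = 1) := by
  have hdeg : ∀ v, deg T v = 1 ↔ (φ.symm v).val = 0 ∨ (φ.symm v).val + 1 = n := by
    intro v
    have := deg_iso φ (φ.symm v)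
    rw [RelIso.apply_symm_apply, deg_pathGraph hn] at this
    rw [this]
    split_ifs with h <;> simp [h]
  have hV := card_eq_of_iso φ
  rcases hL with ⟨⟨t, ht, ⟨χ⟩⟩, u, hu, rfl⟩ | ⟨hne, rfl⟩
  · have hnt : n = 2 * t := by rw [← hV, card_eq_of_iso χ]
    rw [hdeg] at hu
    have key : ∀ ψ : SimpleGraph.pathGraph n ≃g T, (ψ.symm u).val = 0 →
        ∀ v, v ∈ ({u} : Set V) ↔ (ψ.symm v).val = 0 ∨ ((ψ.symm v).val + 1 = n ∧ n % 2 = 1) := by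
      intro ψ hψ v
      rw [Set.mem_singleton_iff, ← ψ.symm.injective.eq_iff, Fin.ext_iff, hψ]
      omega
    rcases hu with hu | hu
    · exact ⟨φ, key φ hu⟩
    · refine ⟨(pathGraphRev n).trans φ, key _ ?_⟩
      show (Fin.rev (φ.symm u)).val = 0
      rw [Fin.val_rev]
      omega
  · refine ⟨φ, fun v => ?_⟩
    rw [Set.mem_ofPred_eq, hdeg]
    have hodd : n % 2 = 1 := by
      by_contra hev
      obtain ⟨t, rfl⟩ : ∃ t, n = 2 * t := ⟨n / 2, by omega⟩
      exact hne ⟨t, by omega, ⟨φ⟩⟩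
    simp [hodd]

/-! ### Assembling the cases. -/

theorem IsMinimizer.exists_skeleton {n α : ℕ} (hn : 2 ≤ n) (hα : n ≤ 2 * α)
    {T : SimpleGraph V} (hT : IsMinimizer n α T) {L : Set V} (hL : IsLeafSet T L) :
    ∃ C : Finset V, IsSkeleton T L C ∧ C.card = n - α ∧
      ∀ c ∈ C, (∀ u w, T.Adj c u → T.Adj c w → u ∉ L → w ∉ L → u = w) →
        IsControlVertex T L c := by
  have hV := hT.mem.order
  obtain ⟨C₀, hC₀, hk₀⟩ := hT.mem.exists_cover
  have hpos : 0 < n - α := by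
    rw [← hk₀, Finset.card_pos]
    have : Nontrivial V := Fintype.one_lt_card_iff_nontrivial.1 (by omega)
    obtain ⟨v⟩ := hT.mem.connected.nonempty
    obtain ⟨w, hvw⟩ := hT.mem.connected.preconnected.exists_adj_of_nontrivial v
    rcases hC₀ hvw with h | h
    · exact ⟨v, h⟩
    · exact ⟨w, h⟩
  -- With k = n - α the hypothesis gives n ≥ 2k. The ranges n ≥ 2k + 3, n = 2k + 2 and n ≤ 2k + 1
  -- lead to the general structure, to D_n and to the path.
  by_cases h3 : 2 * (n - α) + 3 ≤ n
  · obtain ⟨C, hC, hk, hleaf⟩ := hT.exists_isGood h3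
    have hne : C.Nonempty := Finset.card_pos.1 (by omega)
    obtain ⟨x, hxC, hx⟩ := exists_leaf hC.tree (by omega) hC.cover (by omega)
    obtain ⟨b, hxb, -⟩ := SimpleGraph.degree_eq_one_iff_existsUnique_adj.1 hx
    have hLeq := isLeafSet_eq hL (w := b) (by rw [deg_eq_degree]; exact hleaf x b hx hxb)
    refine ⟨C, hLeq ▸ hC.isSkeleton (by omega) hne, hk, fun c hc huw => ?_⟩
    obtain ⟨x, hxL, hcx⟩ := exists_adj_mem (hC.leafless c hc) huw
    rw [hLeq, Set.mem_ofPred_eq, deg_eq_degree] at hxL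
    exact isControlVertex_of_leaves hLeq (not_iso_dGraph hC.tree hC.cover (by omega))
      (hleaf x c hxL hcx.symm) huw
  by_cases h2 : n = 2 * (n - α) + 2
  · obtain ⟨k, hk⟩ : ∃ k, k = n - α := ⟨_, rfl⟩
    obtain rfl : n = 2 * k + 2 := by omega
    obtain rfl : α = k + 2 := by omega
    obtain ⟨C, hC, hCk, ⟨φ⟩⟩ := hT.exists_iso_dGraph (by omega)
    have hne : C.Nonempty := Finset.card_pos.1 (by omega)
    have hLeq := isLeafSet_eq hL (three_le_deg_of_dGraph (by omega) φ)
    refine ⟨C, hLeq ▸ hC.isSkeleton (by omega) hne, by omega, fun c hc huw => ?_⟩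
    obtain ⟨x, hxL, hcx⟩ := exists_adj_mem (hC.leafless c hc) huw
    rw [hLeq, Set.mem_ofPred_eq, deg_eq_degree] at hxL
    exact isControlVertex_of_dGraph (by omega) φ hxL hcx
  · obtain rfl : α = (n + 1) / 2 := by omega
    obtain ⟨hTt, ⟨φ⟩⟩ := hT.isTree_and_iso_pathGraph (by omega)
    obtain ⟨φ, hφ⟩ := hL.exists_iso hn φ
    have := card_oddVertices φ
    exact ⟨_, isSkeleton_of_pathGraph hn hTt φ hφ, by omega,
      fun c hc huw => isControlVertex_of_pathGraph hn φ hφ hc huw⟩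

end

end MinimizerGraph

theorem theorem3p1 {V : Type*} [Fintype V] (n α : ℕ) (hn : 2 ≤ n)
    (hα : ⌈(n : ℝ) / 2⌉₊ ≤ α) (T : SimpleGraph V)
    (hT : MinimizerGraph.IsMinimizer n α T)
    (L : Set V) (hL : MinimizerGraph.IsLeafSet T L) :
    ∃ D ∈ MinimizerGraph.mainTrees n α, ∃ l : D.V₂ → ℕ,
      ∃ φ : T ≃g MinimizerGraph.attachPendants D.graph D.V₂ l,
        -- the attached pendant vertices are exactly the leaves, so the main tree is `T - L`
        φ '' L = Set.range Sum.inr ∧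
        (∑ᶠ u : D.V₂, l u) = L.ncard ∧
        (L.ncard : ℤ) = 2 * α - n + 1 ∧
        D.graph.IsTree ∧
        D.graph.IsBipartiteWith D.V₁ D.V₂ ∧
        D.V₁ ∪ D.V₂ = Set.univ ∧
        (D.V₂.ncard : ℤ) = n - α ∧
        (D.V₁.ncard : ℤ) = n - α - 1 ∧
        (∀ x ∈ D.V₁, MinimizerGraph.deg D.graph x = 2) ∧
        -- the path of the main tree is a control path of `T`
        MinimizerGraph.IsControlVertex T L (φ.symm (Sum.inl D.pathStart)) ∧
        MinimizerGraph.IsControlVertex T L (φ.symm (Sum.inl D.pathEnd)) := by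
  have h1 : n ≤ 2 * α := by
    have h2 : (n : ℝ) / 2 ≤ α := Nat.ceil_le.1 hα
    have h3 : (n : ℝ) ≤ ((2 * α : ℕ) : ℝ) := by push_cast; linarith
    exact_mod_cast h3
  have h2 : α ≤ n := by
    have := MinimizerGraph.indepNum_le_card T
    rwa [hT.mem.indep, hT.mem.order] at this
  obtain ⟨C, hC, hk, hP⟩ := hT.exists_skeleton hn h1 hL
  exact hC.exists_mainTree hn hT.mem.order h2 hk _ hP
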